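/- Let $\mu,\nu,r_0>0$ and let $\theta:[0,\infty)\to\mathbb R$ be smooth with $\theta(0)=1$ and $\theta(r)=0$ for $r\ge r_0$. Let $W$ be the principal branch of the Lambert function (the inverse of $s\mapsto s\,e^{s}$ on $[-1,\infty)$), assume $\mu W(1)^2/\nu>1/4$, and put $$\beta=\sqrt{\tfrac{\mu W(1)^2}{\nu}-\tfrac14},\qquad \mathcal E(r)=-\frac{\big(W(e^{\theta(r)})-\theta(r)\big)^2}{\nu r^2}\quad(r>0),\qquad v=\mu\,\mathcal E|_{(0,r_0]}.$$ Consider the $s$-wave eigenvalue problem $$-\zeta''(r)-\tfrac2r\,\zeta'(r)+\mu\,\mathcal E(r)\,\zeta(r)=\mu E\,\zeta(r)\ \ (r>0),\qquad \inf\mathcal E\le E<0,\qquad r\,\zeta(r)\in H^2(0,\infty),$$ for $\zeta\not\equiv0$ continuous on $(0,\infty)$ with a finite limit at $0$ (derivatives are weak derivatives), and write $u(r)=r\,\zeta(r)$. Let $K_{i\beta}$ be the Macdonald function (modified Bessel function of the second kind of order $i\beta$) and $\vartheta_\beta=\arg\Gamma(1+i\beta)\in(-\pi,\pi]$. For $c\in\mathbb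 R\setminus\{0\}$ and $\lambda\ge0$ let $w_\lambda\in C^2([0,r_0])$ be the solution of $$w_\lambda''=(v+\lambda^2)\,w_\lambda\ \text{ on }(0,r_0],\qquad w_\lambda(0)=0,\quad w_\lambda'(0)=c .$$ Let $a=\tfrac12 w_0(r_0)-r_0\,w_0'(r_0)$, $b=\beta\,w_0(r_0)$, let $\alpha=\arctan\frac ba$ if $a\ne0$ and $\alpha=\frac\pi2$ if $a=0$, and let $\lambda_n^0=\frac2{r_0}e^{(\vartheta_\beta-\alpha)/\beta}e^{-n\pi/\beta}$ for $n\in\mathbb Z$. Then there is $n_0\in\mathbb Z$, depending only on $v$, $r_0$ and $\beta$, such that for every $n\ge n_0$ there is exactly one $\eta_n\in(-\frac\pi2,\frac\pi2)$ for which $\lambda_n=\lambda_n^0e^{\eta_n/\beta}$ satisfies $$\Big[\tfrac{w_{\lambda_n}(r_0)}2-r_0\,w_{\lambda_n}'(r_0)\Big]K_{i\beta}(\lambda_nr_0)+\lambda_nr_0\,w_{\lambda_n}(r_0)\,K_{i\beta}'(\lambda_nr_0)=0 ;$$ moreover $\eta_n\to0$ as $n\to\infty$, $\eta_n$ does not depend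 on $c$, and the $s$-wave problem has the infinitely many distinct negative eigenvalues $$E_{\mathrm{BO};n}=-\frac4{\mu r_0^2}\,e^{\frac2\beta(\vartheta_\beta-\alpha+\eta_n)}\,e^{-\frac{2\pi}\beta n},\qquad n\ge n_0,\qquad \lim_{n\to\infty}E_{\mathrm{BO};n}=0 .$$ For every $n\ge n_0$, the eigenfunctions for $E_{\mathrm{BO};n}$ are exactly the functions $\zeta$ with $$r\,\zeta(r)=u_n(r)=\begin{cases}A_n\,w_{\lambda_n}(r),&0<r\le r_0,\\ B_n\sqrt r\,K_{i\beta}(\lambda_nr),&r>r_0,\end{cases}$$ where $B_n\in\mathbb C\setminus\{0\}$ and $$A_n=\begin{cases}\dfrac{\sqrt{r_0}}{w_{\lambda_n}(r_0)}\,K_{i\beta}(\lambda_nr_0)\,B_n,&w_{\lambda_n}(r_0)\ne0,\\[2ex]\dfrac{K_{i\beta}(\lambda_nr_0)+2\lambda_nr_0\,K_{i\beta}'(\lambda_nr_0)}{2\sqrt{r_0}\,w_{\lambda_n}'(r_0)}\,B_n,&w_{\lambda_n}(r_0)=0,\end{cases}$$ and $B_n>0$ can be chosen so that $\int_0^\infty|u_n(r)|^2\,dr=1$.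 -/

import Mathlib

open Set Filter Topology MeasureTheory
open scoped ContDiff

namespace BornOppenheimer

/-- The principal branch of the Lambert function: the inverse of `s ↦ s * exp s` on `[-1, ∞)`
(meaningful for arguments `≥ -1/e`; only positive arguments are used). -/
noncomputable def lambertW : ℝ → ℝ :=
  Function.invFunOn (fun s : ℝ => s * Real.exp s) (Ici (-1))

/-- The effective potential `𝓔(r) = -(W(exp θ(r)) - θ(r))² / (ν r²)`, for `r > 0`. -/
noncomputable def potential (ν : ℝ) (θ : ℝ → ℝ) (r : ℝ) : ℝ :=
  -(lambertW (Real.exp (θ r)) - θ r) ^ 2 / (ν * r ^ 2)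

/-- `β = √(μ W(1)² / ν - 1/4)`. -/
noncomputable def betaParam (μ ν : ℝ) : ℝ :=
  Real.sqrt (μ * lambertW 1 ^ 2 / ν - 1 / 4)

/-- The modified Bessel function of the second kind, `K_σ(z) = ∫₀^∞ exp(-z cosh t) cosh(σ t) dt`,
of complex order `σ` and argument `z > 0`. -/
noncomputable def besselK (σ : ℂ) (z : ℝ) : ℂ :=
  ∫ t in Ioi (0 : ℝ), (Real.exp (-z * Real.cosh t) : ℂ) * Complex.cosh (σ * t)

/-- The Macdonald function `K_{iβ}(z)`, `z > 0`, which is real since `cosh(iβt) = cos(βt)`. -/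
noncomputable def macdonaldK (β z : ℝ) : ℝ :=
  ∫ t in Ioi (0 : ℝ), Real.exp (-z * Real.cosh t) * Real.cos (β * t)

theorem besselK_imaginary_order (β z : ℝ) :
    besselK (Complex.I * β) z = (macdonaldK β z : ℂ) := by
  unfold besselK macdonaldK
  rw [← integral_complex_ofReal]
  refine integral_congr_ae (Eventually.of_forall fun t => ?_)
  have h : Complex.I * (β : ℂ) * t = ((β * t : ℝ) : ℂ) * Complex.I := by
    push_cast; ring
  simp only [h, Complex.cosh_mul_I]
  push_cast
  rfl

/-- `ϑ_β = arg Γ(1 + iβ) ∈ (-π, π]`. -/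
noncomputable def gammaPhase (β : ℝ) : ℝ :=
  Complex.arg (Complex.Gamma (1 + Complex.I * β))

/-! ### The half-line Sobolev space and the s-wave eigenvalue problem -/

/-- `g` is the weak derivative of `f` on `(0, ∞)`. -/
def IsWeakDeriv (f g : ℝ → ℂ) : Prop :=
  LocallyIntegrableOn f (Ioi 0) ∧ LocallyIntegrableOn g (Ioi 0) ∧
    ∀ φ : ℝ → ℝ, ContDiff ℝ ∞ φ → HasCompactSupport φ → tsupport φ ⊆ Ioi 0 →
      ∫ r in Ioi (0 : ℝ), deriv φ r • f r = -∫ r in Ioi (0 : ℝ), φ r • g r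

/-- `u ∈ H²(0, ∞)`. -/
def MemH2 (u : ℝ → ℂ) : Prop :=
  ∃ u₁ u₂ : ℝ → ℂ, IsWeakDeriv u u₁ ∧ IsWeakDeriv u₁ u₂ ∧
    MemLp u 2 (volume.restrict (Ioi 0)) ∧ MemLp u₁ 2 (volume.restrict (Ioi 0)) ∧
    MemLp u₂ 2 (volume.restrict (Ioi 0))

/-- `ζ` (a radial profile on `(0, ∞)`) solves the s-wave eigenvalue problem
`-ζ'' - (2/r) ζ' + μ V ζ = μ E ζ`, `inf V ≤ E < 0`, `r ζ(r) ∈ H²(0, ∞)`, and is not zero.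
As the profile of an element of `H²(ℝ³) ⊂ C⁰(ℝ³)`, `ζ` is taken to be its continuous
representative, with a finite value (limit) at the origin.
(For a continuous bounded `V` attaining its minimum on `[0, ∞)`, the infimum over `(0, ∞)` is
that minimum.) -/
structure IsSWaveEigenfunction (μ : ℝ) (V : ℝ → ℝ) (E : ℝ) (ζ : ℝ → ℂ) : Prop where
  inf_le : sInf (V '' Ioi 0) ≤ E
  neg : E < 0
  continuousOn : ContinuousOn ζ (Ioi 0)
  finite_at_origin : ∃ z : ℂ, Tendsto ζ (𝓝[>] 0) (𝓝 z)
  memH2 : MemH2 (fun r => (r : ℂ) * ζ r)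
  equation : ∃ ζ₁ ζ₂ : ℝ → ℂ, IsWeakDeriv ζ ζ₁ ∧ IsWeakDeriv ζ₁ ζ₂ ∧
    ∀ᵐ r ∂(volume.restrict (Ioi (0 : ℝ))),
      -ζ₂ r - (2 / r : ℂ) * ζ₁ r + (μ * V r : ℂ) * ζ r = (μ * E : ℂ) * ζ r
  ne_zero : ∃ r : ℝ, 0 < r ∧ ζ r ≠ 0

/-- `E` is a negative eigenvalue in the s-wave sector. -/
def IsSWaveEigenvalue (μ : ℝ) (V : ℝ → ℝ) (E : ℝ) : Prop :=
  ∃ ζ : ℝ → ℂ, IsSWaveEigenfunction μ V E ζ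

/-! ### The inner solution and the matching at `r₀` -/

/-- `w ∈ C²([0, r₀])` solves `w'' = (v + l²) w` on `(0, r₀]` with `w(0) = 0`, `w'(0) = c`
(these conditions determine `w` on `[0, r₀]`). -/
structure IsInnerSolution (v : ℝ → ℝ) (r₀ c l : ℝ) (w : ℝ → ℝ) : Prop where
  contDiffOn : ContDiffOn ℝ 2 w (Icc 0 r₀)
  equation : ∀ r ∈ Ioc 0 r₀, iteratedDerivWithin 2 w (Icc 0 r₀) r = (v r + l ^ 2) * w r
  value_zero : w 0 = 0
  deriv_zero : derivWithin w (Icc 0 r₀) 0 = c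

/-- `a = w(r₀)/2 - r₀ w'(r₀)`; to be used with the inner solution `w` for `l = 0`. -/
noncomputable def coeffA (r₀ : ℝ) (w : ℝ → ℝ) : ℝ :=
  w r₀ / 2 - r₀ * derivWithin w (Icc 0 r₀) r₀

/-- `b = β w(r₀)`; to be used with the inner solution `w` for `l = 0`. -/
noncomputable def coeffB (β r₀ : ℝ) (w : ℝ → ℝ) : ℝ :=
  β * w r₀

/-- `arctan (b / a)`, read as `π / 2` if `a = 0`. -/
noncomputable def matchAngle (a b : ℝ) : ℝ :=
  if a = 0 then Real.pi / 2 else Real.arctan (b / a)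

/-- `λₙ⁰ = (2 / r₀) exp((ϑ_β - α) / β) exp(-n π / β)`, with `α` the angle above. -/
noncomputable def unperturbedRoot (β r₀ α : ℝ) (n : ℤ) : ℝ :=
  2 / r₀ * Real.exp ((gammaPhase β - α) / β) * Real.exp (-(n * (Real.pi / β)))

/-- The left-hand side of the condition for `C¹` matching at `r₀` of multiples of the inner
solution `w` and of `√r K_{iβ}(l r)`:
`[w(r₀)/2 - r₀ w'(r₀)] K_{iβ}(l r₀) + l r₀ w(r₀) K_{iβ}'(l r₀)`. -/
noncomputable def matchDet (β r₀ l : ℝ) (w : ℝ → ℝ) : ℝ :=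
  (w r₀ / 2 - r₀ * derivWithin w (Icc 0 r₀) r₀) * macdonaldK β (l * r₀) +
    l * r₀ * w r₀ * deriv (macdonaldK β) (l * r₀)

/-- The ratio `A / B` of the inner and the outer constants of an eigenfunction. -/
noncomputable def innerRatio (β r₀ l : ℝ) (w : ℝ → ℝ) : ℝ :=
  if w r₀ ≠ 0 then
    Real.sqrt r₀ / w r₀ * macdonaldK β (l * r₀)
  else
    (macdonaldK β (l * r₀) + 2 * l * r₀ * deriv (macdonaldK β) (l * r₀)) /
      (2 * Real.sqrt r₀ * derivWithin w (Icc 0 r₀) r₀)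

/-- The function equal to `A w(r)` on `[0, r₀]` and to `B √r K_{iβ}(l r)` for `r > r₀`, where
`A = innerRatio * B`. -/
noncomputable def gluedFunction (β r₀ l : ℝ) (w : ℝ → ℝ) (B : ℂ) (r : ℝ) : ℂ :=
  if r ≤ r₀ then (innerRatio β r₀ l w * B) * (w r : ℂ)
  else B * (Real.sqrt r * macdonaldK β (l * r) : ℝ)

end BornOppenheimer

namespace BornOppenheimer

/-! ### Global existence for linear differential equations -/

section LinearODE

variable {E : Type*} [NormedAddCommGroup E] [NormedSpace ℝ E]

/-! With `u = r ζ` and `E = -λ² / μ` the eigenvalue equation becomes `u'' = (q + λ²) u`, `q = μ 𝓔`.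
Two features of the potential make it tractable. Since `W(e) = 1 = θ(0)`, the square in the
numerator cancels the pole at the origin, so `q` extends to a bounded continuous function on the
line, and the solutions vanishing at `0` are the multiples of one regular solution `w_λ`. Beyond
`r₀`, `q` is exactly `-(β² + 1/4) / r²`, for which `√r K_{iβ}(λ r)` is an exponentially decaying
solution. A zero of the matching determinant makes these two solutions proportional, and then `w_λ`
decays and is an eigenfunction (`innerRatio_mul_eq_outerSol`,
`IsRegularSolution.isSWaveEigenfunction`). Conversely, a weak eigenfunction is a classical solution
(`radial_regularity`), and comparing Wronskians at the origin makes it a multiple of `w_λ`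
(`exists_eq_mul_of_tendsto_zero`).

The zeros come from the log-periodic behaviour of `K_{iβ}` at small argument: with `φ(z) = ϑ_β - β
log(z/2)`, `β K_{iβ}(z) = |Γ(1+iβ)| sin φ + O(z)` and `-z K_{iβ}'(z) = |Γ(1+iβ)| cos φ + O(z)`, by
comparison with Euler's integral. Hence `β` times the determinant is `|Γ(1+iβ)| (a sin φ - b cos φ)`
plus a remainder. At `z = r₀ λₙ⁰ e^{y/β}` the phase is `α + nπ - y`, so the equation reads `sin y +
e(y) = 0`. Smallness of `e` gives a root near `0`; uniqueness on all of `(-π/2, π/2)` also needs `e`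
to have a small Lipschitz constant. This is why remainders are tracked as Lipschitz functions of
`z`: the errors in the asymptotics have bounded derivative, and the `O(λ²)` change of `w_λ(r₀)` and
`w_λ'(r₀)` beats the `1/z` growth of the derivatives of the Bessel terms. Both bounds are then
`O(e^{-nπ/β})` (`exists_unique_scaledRoot`, `exists_unique_matching`).

Replacing the initial slope `1` by `c` multiplies `w_λ` by `c`, which changes neither `α` nor the
roots. -/

theorem norm_integral_le_exp_of_nonneg {h : ℝ → E} {C κ : ℝ} (hC : 0 ≤ C) (hκ : 0 < κ)
    (hb : ∀ s, ‖h s‖ ≤ C * Real.exp (κ * |s|)) {t : ℝ} (ht : 0 ≤ t) :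
    ‖∫ s in (0 : ℝ)..t, h s‖ ≤ C / κ * Real.exp (κ * |t|) := by
  have hint : ∀ x : ℝ, HasDerivAt (fun s => C / κ * Real.exp (κ * s)) (C * Real.exp (κ * x)) x := by
    intro x
    have := (((hasDerivAt_id x).const_mul κ).exp).const_mul (C / κ)
    convert! this using 1
    simp only [id, mul_one]
    field_simp
  have hcont : Continuous fun s => C * Real.exp (κ * s) := by fun_prop
  have h1 : ‖∫ s in (0 : ℝ)..t, h s‖ ≤ ∫ s in (0 : ℝ)..t, C * Real.exp (κ * s) := by
    refine intervalIntegral.norm_integral_le_of_norm_le ht ?_ (hcont.intervalIntegrable _ _)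
    refine Eventually.of_forall fun s hs => ?_
    simpa [abs_of_pos hs.1] using hb s
  rw [intervalIntegral.integral_eq_sub_of_hasDerivAt (fun x _ => hint x)
    (hcont.intervalIntegrable _ _)] at h1
  rw [abs_of_nonneg ht]
  have : 0 ≤ C / κ * Real.exp (κ * 0) := by positivity
  linarith

theorem norm_integral_le_exp {h : ℝ → E} {C κ : ℝ} (hC : 0 ≤ C) (hκ : 0 < κ)
    (hb : ∀ s, ‖h s‖ ≤ C * Real.exp (κ * |s|)) (t : ℝ) :
    ‖∫ s in (0 : ℝ)..t, h s‖ ≤ C / κ * Real.exp (κ * |t|) := by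
  rcases le_total 0 t with ht | ht
  · exact norm_integral_le_exp_of_nonneg hC hκ hb ht
  · have := norm_integral_le_exp_of_nonneg (h := fun s => h (-s)) hC hκ
      (fun s => by simpa using hb (-s)) (neg_nonneg.2 ht)
    rwa [intervalIntegral.integral_comp_neg, neg_neg, neg_zero, intervalIntegral.integral_symm,
      norm_neg, abs_neg] at this

variable [CompleteSpace E]

/-- A linear differential equation with bounded continuous coefficients has global solutions. -/
theorem exists_linear_ode_solution {A : ℝ → E →L[ℝ] E} (hA : Continuous A) {M : ℝ} (hM : 0 < M)
    (hAM : ∀ t, ‖A t‖ ≤ M) (y₀ : E) :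
    ∃ y : ℝ → E, y 0 = y₀ ∧ ∀ t, HasDerivAt y (A t (y t)) t := by
  -- Bielecki's weight: in the norm `sup e^{-κ|t|} ‖y t‖` the Picard operator has Lipschitz constant
  -- `M / κ = 1 / 2` on the whole line at once.
  let κ := 2 * M
  have hκ : 0 < κ := by positivity
  -- The bounded unknown is `g = e^{-κ|t|} y`, so `F g` is `A y`.
  let F : BoundedContinuousFunction ℝ E → ℝ → E := fun g s => Real.exp (κ * |s|) • A s (g s)
  have hFc : ∀ g, Continuous (F g) := fun g => by
    have := g.continuous
    fun_prop
  have hFb : ∀ g s, ‖F g s‖ ≤ M * ‖g‖ * Real.exp (κ * |s|) := fun g s => by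
    rw [norm_smul, Real.norm_eq_abs, Real.abs_exp, mul_comm]
    gcongr
    exact ((A s).le_opNorm _).trans (mul_le_mul (hAM s) (g.norm_coe_le_norm s) (norm_nonneg _) hM.le)
  have hIc : ∀ g, Continuous fun t => ∫ s in (0 : ℝ)..t, F g s := fun g =>
    intervalIntegral.continuous_primitive (fun a b => (hFc g).intervalIntegrable a b) 0
  have hexp : ∀ t : ℝ, Real.exp (-(κ * |t|)) * Real.exp (κ * |t|) = 1 := fun t => by
    rw [← Real.exp_add]; simp
  have hTb : ∀ g t, ‖Real.exp (-(κ * |t|)) • (y₀ + ∫ s in (0 : ℝ)..t, F g s)‖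
      ≤ ‖y₀‖ + M * ‖g‖ / κ := fun g t => by
    rw [norm_smul, Real.norm_eq_abs, Real.abs_exp]
    have h1 := norm_integral_le_exp (by positivity) hκ (hFb g) t
    have h2 := norm_add_le y₀ (∫ s in (0 : ℝ)..t, F g s)
    have h3 : Real.exp (-(κ * |t|)) ≤ 1 := Real.exp_le_one_iff.2 (by simp; positivity)
    calc _ ≤ Real.exp (-(κ * |t|)) * (‖y₀‖ + M * ‖g‖ / κ * Real.exp (κ * |t|)) := by
          gcongr; linarith
      _ = Real.exp (-(κ * |t|)) * ‖y₀‖ + M * ‖g‖ / κ := by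
          rw [mul_add, mul_left_comm, hexp, mul_one]
      _ ≤ _ := by
          have := mul_le_mul_of_nonneg_right h3 (norm_nonneg y₀)
          linarith
  let T : BoundedContinuousFunction ℝ E → BoundedContinuousFunction ℝ E := fun g =>
    BoundedContinuousFunction.ofNormedAddCommGroup
      (fun t => Real.exp (-(κ * |t|)) • (y₀ + ∫ s in (0 : ℝ)..t, F g s))
      (by have := hIc g; fun_prop) _ (hTb g)
  have hT : ContractingWith (1 / 2) T := by
    refine ⟨by norm_num, LipschitzWith.of_dist_le_mul fun g h => ?_⟩
    rw [BoundedContinuousFunction.dist_le (by positivity)]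
    intro t
    have hsub : T g t - T h t = Real.exp (-(κ * |t|)) • ∫ s in (0 : ℝ)..t, F (g - h) s := by
      have : ∫ s in (0 : ℝ)..t, F (g - h) s
          = (∫ s in (0 : ℝ)..t, F g s) - ∫ s in (0 : ℝ)..t, F h s := by
        rw [← intervalIntegral.integral_sub ((hFc g).intervalIntegrable _ _)
          ((hFc h).intervalIntegrable _ _)]
        refine intervalIntegral.integral_congr fun s _ => ?_
        simp [F, smul_sub]
      rw [this]
      change Real.exp (-(κ * |t|)) • (y₀ + ∫ s in (0 : ℝ)..t, F g s)
        - Real.exp (-(κ * |t|)) • (y₀ + ∫ s in (0 : ℝ)..t, F h s) = _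
      rw [← smul_sub, add_sub_add_left_eq_sub]
    rw [dist_eq_norm, hsub, norm_smul, Real.norm_eq_abs, Real.abs_exp, dist_eq_norm]
    have h1 := norm_integral_le_exp (by positivity) hκ (hFb (g - h)) t
    calc _ ≤ Real.exp (-(κ * |t|)) * (M * ‖g - h‖ / κ * Real.exp (κ * |t|)) := by gcongr
      _ = M * ‖g - h‖ / κ := by rw [mul_left_comm, hexp, mul_one]
      _ = _ := by
        simp only [κ]
        push_cast
        field_simp
  obtain ⟨g, hg⟩ : ∃ g, T g = g := ⟨_, hT.fixedPoint_isFixedPt⟩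
  have hy : ∀ t, Real.exp (κ * |t|) • g t = y₀ + ∫ s in (0 : ℝ)..t, F g s := fun t => by
    conv_lhs => rw [← hg]
    change Real.exp (κ * |t|) • (Real.exp (-(κ * |t|)) • (y₀ + ∫ s in (0 : ℝ)..t, F g s)) = _
    rw [smul_smul, mul_comm, hexp, one_smul]
  refine ⟨fun t => y₀ + ∫ s in (0 : ℝ)..t, F g s, by simp, fun t => ?_⟩
  have hd := (intervalIntegral.integral_hasDerivAt_right ((hFc g).intervalIntegrable 0 t)
    (hFc g).aestronglyMeasurable.stronglyMeasurableAtFilter (hFc g).continuousAt).const_add y₀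
  convert hd using 1
  simp only [F, ← hy t, map_smul]

end LinearODE

/-- Global solvability of `w'' = q w`. -/
theorem exists_second_order_solution {q : ℝ → ℝ} (hq : Continuous q) {M : ℝ}
    (hM : ∀ t, |q t| ≤ M) (a b : ℝ) :
    ∃ w w' : ℝ → ℝ, w 0 = a ∧ w' 0 = b ∧ (∀ t, HasDerivAt w (w' t) t) ∧
      ∀ t, HasDerivAt w' (q t * w t) t := by
  -- The companion system `(w, w')' = (w', q w)`; the sup norm on the product gives the bound `max 1
  -- M`.
  let A : ℝ → ℝ × ℝ →L[ℝ] ℝ × ℝ := fun t =>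
    (ContinuousLinearMap.inl ℝ ℝ ℝ).comp (ContinuousLinearMap.snd ℝ ℝ ℝ) +
      q t • (ContinuousLinearMap.inr ℝ ℝ ℝ).comp (ContinuousLinearMap.fst ℝ ℝ ℝ)
  have hAb : ∀ t, ‖A t‖ ≤ max 1 M := fun t => by
    refine ContinuousLinearMap.opNorm_le_bound _ (by positivity) fun x => ?_
    have h1 : A t x = (x.2, q t * x.1) := by simp [A]
    rw [h1, Prod.norm_def]
    refine max_le ?_ ?_
    · calc ‖x.2‖ ≤ 1 * ‖x‖ := by rw [one_mul]; exact norm_snd_le x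
        _ ≤ _ := by gcongr; exact le_max_left _ _
    · rw [norm_mul]
      exact mul_le_mul ((hM t).trans (le_max_right _ _)) (norm_fst_le x) (norm_nonneg _)
        (by positivity)
  obtain ⟨y, hy0, hy⟩ := exists_linear_ode_solution (A := A) (by fun_prop)
    (lt_of_lt_of_le one_pos (le_max_left 1 M)) hAb (a, b)
  refine ⟨fun t => (y t).1, fun t => (y t).2, by simp [hy0], by simp [hy0], fun t => ?_,
    fun t => ?_⟩
  · simpa [A] using! (HasFDerivAt.fst (hy t).hasFDerivAt).hasDerivAt
  · simpa [A] using! (HasFDerivAt.snd (hy t).hasFDerivAt).hasDerivAt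

/-! ### Grönwall estimates and uniqueness for second-order equations -/

section Uniqueness

variable {E : Type*} [NormedAddCommGroup E] [NormedSpace ℝ E]

/-- Grönwall's inequality for `f'' = q f + g`. -/
theorem second_order_gronwall {f f' g : ℝ → E} {q : ℝ → ℝ} {a b K δ ε : ℝ} (hK : 1 ≤ K)
    (hε : 0 ≤ ε)
    (hf : ∀ t ∈ Icc a b, HasDerivAt f (f' t) t)
    (hf' : ∀ t ∈ Icc a b, HasDerivAt f' (q t • f t + g t) t)
    (hq : ∀ t ∈ Icc a b, |q t| ≤ K) (hg : ∀ t ∈ Icc a b, ‖g t‖ ≤ ε)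
    (h0 : ‖f a‖ ≤ δ) (h1 : ‖f' a‖ ≤ δ) :
    ∀ t ∈ Icc a b, ‖f t‖ ≤ gronwallBound δ K ε (t - a) ∧ ‖f' t‖ ≤ gronwallBound δ K ε (t - a) := by
  -- Grönwall for the pair `(f, f')` in the sup norm; `1 ≤ K` takes care of the first component `f'
  -- ≤ K max(f, f')`.
  have key := norm_le_gronwallBound_of_norm_deriv_right_le (f := fun t => (f t, f' t))
    (f' := fun t => (f' t, q t • f t + g t)) (δ := δ) (K := K) (ε := ε) (a := a) (b := b)
    (fun t ht => ((hf t ht).continuousAt.prodMk (hf' t ht).continuousAt).continuousWithinAt)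
    (fun t ht => ((hf t (Ico_subset_Icc_self ht)).prodMk
      (hf' t (Ico_subset_Icc_self ht))).hasDerivWithinAt)
    (by rw [Prod.norm_def]; exact max_le h0 h1)
    (fun t ht => by
      have ht := Ico_subset_Icc_self ht
      rw [Prod.norm_def, Prod.norm_def]
      have hn : 0 ≤ max ‖f t‖ ‖f' t‖ := (norm_nonneg _).trans (le_max_left _ _)
      refine max_le ?_ ?_
      · have h2 : ‖f' t‖ ≤ max ‖f t‖ ‖f' t‖ := le_max_right _ _
        have h3 : 1 * max ‖f t‖ ‖f' t‖ ≤ K * max ‖f t‖ ‖f' t‖ := by gcongr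
        simp only
        linarith
      · refine (norm_add_le _ _).trans (add_le_add ?_ (hg t ht))
        rw [norm_smul]
        exact mul_le_mul (hq t ht) (le_max_left _ _) (norm_nonneg _) (by linarith))
  intro t ht
  have := key t ht
  rw [Prod.norm_def] at this
  exact max_le_iff.1 this

theorem second_order_eq_zero_right {f f' : ℝ → E} {q : ℝ → ℝ} {a b : ℝ}
    (hf : ∀ t ∈ Icc a b, HasDerivAt f (f' t) t)
    (hf' : ∀ t ∈ Icc a b, HasDerivAt f' (q t • f t) t)
    (hq : ContinuousOn q (Icc a b)) (h0 : f a = 0) (h1 : f' a = 0) :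
    ∀ t ∈ Icc a b, f t = 0 := by
  obtain ⟨C, hC⟩ := isCompact_Icc.exists_bound_of_continuousOn hq
  have key := second_order_gronwall (g := 0) (δ := 0) (le_max_left 1 C) le_rfl hf
    (by simpa using hf') (fun t ht => (hC t ht).trans (le_max_right _ _)) (by simp)
    (by simp [h0]) (by simp [h1])
  intro t ht
  simpa [gronwallBound_ε0_δ0] using (key t ht).1

/-- Grönwall runs forward in time; points to the left of `t₀` are reached by the reflection `t ↦
-t`. The interval is open at `c` because the coefficient `1 / r²` is singular at `0`. -/
theorem second_order_eq_zero_on {f f' : ℝ → E} {q : ℝ → ℝ} {c : ℝ}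
    (hf : ∀ t ∈ Ioi c, HasDerivAt f (f' t) t)
    (hf' : ∀ t ∈ Ioi c, HasDerivAt f' (q t • f t) t)
    (hq : ContinuousOn q (Ioi c)) {t₀ : ℝ} (ht₀ : c < t₀) (h0 : f t₀ = 0) (h1 : f' t₀ = 0) :
    ∀ t ∈ Ioi c, f t = 0 := by
  intro t ht
  rcases le_total t₀ t with h | h
  · have hsub : Icc t₀ t ⊆ Ioi c := fun s hs => ht₀.trans_le hs.1
    exact second_order_eq_zero_right (fun s hs => hf s (hsub hs))
      (fun s hs => hf' s (hsub hs)) (hq.mono hsub) h0 h1 t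
      ⟨h, le_rfl⟩
  · have hsub : ∀ s ∈ Icc (-t₀) (-t), -s ∈ Ioi c := fun s hs => by
      have : t ≤ -s := by linarith [hs.2]
      exact lt_of_lt_of_le ht this
    have := second_order_eq_zero_right (f := fun s => f (-s)) (f' := fun s => -f' (-s))
      (q := fun s => q (-s)) (a := -t₀) (b := -t)
      (fun s hs => by simpa using! (hf (-s) (hsub s hs)).scomp s (hasDerivAt_neg s))
      (fun s hs => by simpa using! ((hf' (-s) (hsub s hs)).scomp s (hasDerivAt_neg s)).neg)
      (fun s hs => (hq.continuousAt (Ioi_mem_nhds (hsub s hs))).comp_continuousWithinAt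
        (f := fun s : ℝ => -s) continuous_neg.continuousWithinAt)
      (by simpa using h0) (by simpa using h1) (-t) ⟨by linarith, le_rfl⟩
    simpa using this

end Uniqueness

/-! ### The Macdonald function: differential equation and decay -/

/-- Apply `x^(k+1) / (k+1)! ≤ e^x` at `x = z cosh t`; the one surplus power of `cosh t ≥ e^t / 2`
supplies the factor `e^{-t}`. This dominates every Bessel-type integral below. -/
theorem cosh_pow_mul_exp_le (k : ℕ) {z : ℝ} (hz : 0 < z) (t : ℝ) :
    Real.cosh t ^ k * Real.exp (-z * Real.cosh t)
      ≤ 2 * ((k + 1).factorial / z ^ (k + 1)) * Real.exp (-t) := by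
  have hc : 0 < Real.cosh t := Real.cosh_pos t
  have h1 := Real.pow_div_factorial_le_exp _ (mul_pos hz hc).le (k + 1)
  have h2 : Real.exp t / 2 ≤ Real.cosh t := by
    rw [Real.cosh_eq]
    have := Real.exp_pos (-t)
    linarith
  have h3 : (z * Real.cosh t) ^ (k + 1) * Real.exp (-z * Real.cosh t) ≤ (k + 1).factorial := by
    rw [div_le_iff₀ (by positivity)] at h1
    rw [neg_mul, Real.exp_neg, ← div_eq_mul_inv, div_le_iff₀ (Real.exp_pos _)]
    linarith
  rw [mul_pow, pow_succ (Real.cosh t)] at h3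
  have h4 : Real.cosh t ^ k * Real.exp (-z * Real.cosh t) * Real.cosh t
      ≤ (k + 1).factorial / z ^ (k + 1) := by
    rw [le_div_iff₀ (by positivity)]
    linarith
  have h5 : Real.cosh t ^ k * Real.exp (-z * Real.cosh t) * (Real.exp t / 2)
      ≤ (k + 1).factorial / z ^ (k + 1) := by
    refine le_trans ?_ h4
    gcongr
  rw [Real.exp_neg, ← div_eq_mul_inv, le_div_iff₀ (Real.exp_pos t)]
  linarith

theorem integrableOn_of_le_cosh_pow {E : Type*} [NormedAddCommGroup E] {f : ℝ → E}
    (hf : Continuous f) {C z : ℝ} (k : ℕ) (hz : 0 < z) (hC : 0 ≤ C)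
    (hb : ∀ t > 0, ‖f t‖ ≤ C * (Real.cosh t ^ k * Real.exp (-z * Real.cosh t))) :
    IntegrableOn f (Ioi 0) := by
  refine Integrable.mono' ((integrableOn_exp_neg_Ioi 0).const_mul
    (C * (2 * ((k + 1).factorial / z ^ (k + 1))))) hf.aestronglyMeasurable ?_
  refine (ae_restrict_iff' measurableSet_Ioi).2 (Eventually.of_forall fun t ht => ?_)
  rw [mul_assoc]
  exact (hb t ht).trans (mul_le_mul_of_nonneg_left (cosh_pow_mul_exp_le k hz t) hC)

theorem tendsto_zero_of_le_cosh_pow {f : ℝ → ℝ} {C z : ℝ} (k : ℕ) (hz : 0 < z) (hC : 0 ≤ C)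
    (hb : ∀ t > 0, ‖f t‖ ≤ C * (Real.cosh t ^ k * Real.exp (-z * Real.cosh t))) :
    Tendsto f atTop (𝓝 0) := by
  have h := (Real.tendsto_exp_neg_atTop_nhds_zero).const_mul
    (C * (2 * ((k + 1).factorial / z ^ (k + 1))))
  rw [mul_zero] at h
  refine squeeze_zero_norm' ?_ h
  filter_upwards [eventually_gt_atTop 0] with t ht
  rw [mul_assoc]
  exact (hb t ht).trans (mul_le_mul_of_nonneg_left (cosh_pow_mul_exp_le k hz t) hC)

/-- `∫₀^∞ cosh(t)^k exp(-z cosh t) cos(β t) dt`, up to sign the `k`-th derivative of `K_{iβ}`. -/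
noncomputable def macdonaldMoment (k : ℕ) (β z : ℝ) : ℝ :=
  ∫ t in Ioi (0 : ℝ), Real.cosh t ^ k * Real.exp (-z * Real.cosh t) * Real.cos (β * t)

theorem macdonaldMoment_zero (β : ℝ) : macdonaldMoment 0 β = macdonaldK β := by
  ext z
  simp [macdonaldMoment, macdonaldK]

theorem norm_cosh_pow_mul_le {g : ℝ} (hg : |g| ≤ 1) (k : ℕ) (z t : ℝ) :
    ‖Real.cosh t ^ k * Real.exp (-z * Real.cosh t) * g‖
      ≤ 1 * (Real.cosh t ^ k * Real.exp (-z * Real.cosh t)) := by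
  have hc := Real.cosh_pos t
  rw [norm_mul, Real.norm_of_nonneg (by positivity), one_mul]
  exact mul_le_of_le_one_right (by positivity) hg

theorem integrableOn_cosh_pow_mul_cos (k : ℕ) (β : ℝ) {z : ℝ} (hz : 0 < z) :
    IntegrableOn (fun t => Real.cosh t ^ k * Real.exp (-z * Real.cosh t) * Real.cos (β * t))
      (Ioi 0) :=
  integrableOn_of_le_cosh_pow (by fun_prop) k hz zero_le_one
    fun t _ => norm_cosh_pow_mul_le (Real.abs_cos_le_one _) k z t

/-- Each derivative in `z` brings down `-cosh t`. For `x > z / 2` the differentiated integrand is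
dominated by its absolute bound at `z / 2`. -/
theorem hasDerivAt_macdonaldMoment (k : ℕ) (β : ℝ) {z : ℝ} (hz : 0 < z) :
    HasDerivAt (macdonaldMoment k β) (-macdonaldMoment (k + 1) β z) z := by
  have h := hasDerivAt_integral_of_dominated_loc_of_deriv_le (μ := volume.restrict (Ioi (0 : ℝ)))
    (F := fun z t => Real.cosh t ^ k * Real.exp (-z * Real.cosh t) * Real.cos (β * t))
    (F' := fun z t =>
      -(Real.cosh t ^ (k + 1) * Real.exp (-z * Real.cosh t) * Real.cos (β * t)))
    (bound := fun t => Real.cosh t ^ (k + 1) * Real.exp (-(z / 2) * Real.cosh t))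
    (x₀ := z) (Ioi_mem_nhds (half_lt_self hz))
    (Eventually.of_forall fun z => Continuous.aestronglyMeasurable (by fun_prop))
    (integrableOn_cosh_pow_mul_cos k β hz)
    (Continuous.aestronglyMeasurable (by fun_prop))
    (Eventually.of_forall fun t x hx => by
      rw [norm_neg]
      refine (norm_cosh_pow_mul_le (Real.abs_cos_le_one _) (k + 1) x t).trans ?_
      have hc := Real.cosh_pos t
      have hx' : z / 2 ≤ x := le_of_lt hx
      rw [one_mul]
      gcongr)
    (integrableOn_of_le_cosh_pow (by fun_prop) (k + 1) (half_pos hz) zero_le_one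
      fun t _ => by
        simpa using norm_cosh_pow_mul_le (g := 1) (by simp) (k + 1) (z / 2) t)
    (Eventually.of_forall fun t x _ => by
      have := ((((hasDerivAt_id x).neg.mul_const (Real.cosh t)).exp).const_mul
        (Real.cosh t ^ k)).mul_const (Real.cos (β * t))
      convert! this using 1
      simp only [id, Pi.neg_apply]
      ring)
  have h2 := h.2
  rw [integral_neg] at h2
  exact h2

theorem hasDerivAt_macdonaldK (β : ℝ) {z : ℝ} (hz : 0 < z) :
    HasDerivAt (macdonaldK β) (-macdonaldMoment 1 β z) z := by
  rw [← macdonaldMoment_zero]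
  exact hasDerivAt_macdonaldMoment 0 β hz

theorem deriv_macdonaldK (β : ℝ) {z : ℝ} (hz : 0 < z) :
    deriv (macdonaldK β) z = -macdonaldMoment 1 β z :=
  (hasDerivAt_macdonaldK β hz).deriv

theorem hasDerivAt_neg_mul_cosh_exp (z t : ℝ) :
    HasDerivAt (fun t => Real.exp (-z * Real.cosh t))
      (Real.exp (-z * Real.cosh t) * (-z * Real.sinh t)) t :=
  ((Real.hasDerivAt_cosh t).const_mul (-z)).exp

theorem hasDerivAt_sin_const_mul (β t : ℝ) :
    HasDerivAt (fun t => Real.sin (β * t)) (Real.cos (β * t) * β) t := by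
  simpa using! ((hasDerivAt_id t).const_mul β).sin

theorem hasDerivAt_cos_const_mul (β t : ℝ) :
    HasDerivAt (fun t => Real.cos (β * t)) (-Real.sin (β * t) * β) t := by
  simpa using! ((hasDerivAt_id t).const_mul β).cos

theorem abs_sinh_le_cosh (t : ℝ) : |Real.sinh t| ≤ Real.cosh t := by
  rw [abs_le]
  have h1 := Real.cosh_add_sinh t
  have h2 := Real.cosh_sub_sinh t
  have h3 := Real.exp_pos t
  have h4 := Real.exp_pos (-t)
  constructor <;> linarith

/-- Bessel's equation for `K_{iβ}`. -/
theorem macdonaldMoment_bessel (β : ℝ) {z : ℝ} (hz : 0 < z) :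
    z ^ 2 * macdonaldMoment 2 β z - z * macdonaldMoment 1 β z
      = (z ^ 2 - β ^ 2) * macdonaldK β z := by
  -- `f` is an antiderivative of the integrand of the difference of the two sides; it vanishes at
  -- `0` and at infinity.
  let f : ℝ → ℝ := fun t => (-z * Real.sinh t) * Real.exp (-z * Real.cosh t) * Real.cos (β * t)
    + β * (Real.exp (-z * Real.cosh t) * Real.sin (β * t))
  let f' : ℝ → ℝ := fun t =>
    z ^ 2 * (Real.cosh t ^ 2 * Real.exp (-z * Real.cosh t) * Real.cos (β * t))
    - z * (Real.cosh t ^ 1 * Real.exp (-z * Real.cosh t) * Real.cos (β * t))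
    - (z ^ 2 - β ^ 2) * (Real.cosh t ^ 0 * Real.exp (-z * Real.cosh t) * Real.cos (β * t))
  have hd : ∀ t ∈ Ici (0 : ℝ), HasDerivAt f (f' t) t := fun t _ => by
    have h := ((((Real.hasDerivAt_sinh t).const_mul (-z)).mul
      (hasDerivAt_neg_mul_cosh_exp z t)).mul (hasDerivAt_cos_const_mul β t)).add
      (((hasDerivAt_neg_mul_cosh_exp z t).mul (hasDerivAt_sin_const_mul β t)).const_mul β)
    convert! h using 1
    simp only [f', Pi.mul_apply]
    linear_combination (z ^ 2 * Real.exp (-z * Real.cosh t) * Real.cos (β * t)) *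
      Real.cosh_sq t
  have i2 := (integrableOn_cosh_pow_mul_cos 2 β hz).const_mul (z ^ 2)
  have i1 := (integrableOn_cosh_pow_mul_cos 1 β hz).const_mul z
  have i0 := (integrableOn_cosh_pow_mul_cos 0 β hz).const_mul (z ^ 2 - β ^ 2)
  have hlim : Tendsto f atTop (𝓝 0) := by
    refine tendsto_zero_of_le_cosh_pow (C := z + |β|) 1 hz (by positivity) fun t _ => ?_
    have hs := abs_sinh_le_cosh t
    have hc1 := Real.one_le_cosh t
    have hcos := Real.abs_cos_le_one (β * t)
    have hsin := Real.abs_sin_le_one (β * t)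
    have he := Real.exp_pos (-z * Real.cosh t)
    rw [Real.norm_eq_abs]
    calc |f t| ≤ |(-z * Real.sinh t) * Real.exp (-z * Real.cosh t) * Real.cos (β * t)|
          + |β * (Real.exp (-z * Real.cosh t) * Real.sin (β * t))| := abs_add_le _ _
      _ = z * |Real.sinh t| * Real.exp (-z * Real.cosh t) * |Real.cos (β * t)|
          + |β| * (Real.exp (-z * Real.cosh t) * |Real.sin (β * t)|) := by
          simp only [abs_mul, abs_neg, abs_of_pos hz, Real.abs_exp]
      _ ≤ z * Real.cosh t * Real.exp (-z * Real.cosh t) * 1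
          + |β| * (Real.exp (-z * Real.cosh t) * Real.cosh t) := by
          gcongr
          exact hsin.trans hc1
      _ = _ := by ring
  have h := integral_Ioi_of_hasDerivAt_of_tendsto' hd ((i2.sub i1).sub i0) hlim
  have h2 : ∫ t in Ioi (0 : ℝ), f' t = z ^ 2 * macdonaldMoment 2 β z
      - z * macdonaldMoment 1 β z - (z ^ 2 - β ^ 2) * macdonaldMoment 0 β z := by
    simp only [f']
    rw [integral_sub (by exact i2.sub i1) i0, integral_sub i2 i1, integral_const_mul,
      integral_const_mul, integral_const_mul]
    rfl
  rw [h2, macdonaldMoment_zero] at h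
  have : f 0 = 0 := by simp [f]
  rw [this] at h
  linarith

/-- Exponential decay of `K_{iβ}` and its derivatives. -/
theorem exists_macdonaldMoment_le_exp (k : ℕ) (β : ℝ) {z₀ : ℝ} (hz₀ : 0 < z₀) :
    ∃ C, 0 ≤ C ∧ ∀ z, z₀ ≤ z → |macdonaldMoment k β z| ≤ C * Real.exp (-z) := by
  have hint : IntegrableOn (fun t => Real.cosh t ^ k * Real.exp (-z₀ * Real.cosh t)) (Ioi 0) := by
    simpa using integrableOn_cosh_pow_mul_cos k 0 hz₀
  -- Since `cosh t ≥ 1`, `e^{-z cosh t} ≤ e^{z₀ - z} e^{-z₀ cosh t}` for `z ≥ z₀`.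
  refine ⟨Real.exp z₀ * ∫ t in Ioi (0 : ℝ), Real.cosh t ^ k * Real.exp (-z₀ * Real.cosh t),
    mul_nonneg (Real.exp_pos _).le (integral_nonneg fun t => by
      have := Real.cosh_pos t
      positivity), fun z hz => ?_⟩
  rw [mul_right_comm, ← Real.exp_add, ← Real.norm_eq_abs, ← integral_const_mul]
  refine norm_integral_le_of_norm_le (hint.const_mul _) (Eventually.of_forall fun t => ?_)
  refine (norm_cosh_pow_mul_le (Real.abs_cos_le_one _) k z t).trans ?_
  rw [one_mul, mul_left_comm, ← Real.exp_add]
  have hc := Real.one_le_cosh t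
  gcongr
  nlinarith

/-! ### The Macdonald function at small arguments -/

theorem integrableOn_exp_mul_exp_cosh {φ : ℝ → ℝ} (hφ : Continuous φ) (hb : ∀ t, |φ t| ≤ 1)
    {z : ℝ} (hz : 0 < z) :
    IntegrableOn (fun t => z * Real.exp t / 2 * Real.exp (-z * Real.cosh t) * φ t) (Ioi 0) := by
  refine integrableOn_of_le_cosh_pow (C := z) (by fun_prop) 1 hz hz.le fun t _ => ?_
  have h : Real.exp t / 2 ≤ Real.cosh t := by
    rw [Real.cosh_eq]
    have := Real.exp_pos (-t)
    linarith
  rw [norm_mul, Real.norm_of_nonneg (by positivity), pow_one]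
  calc _ ≤ z * Real.exp t / 2 * Real.exp (-z * Real.cosh t) * 1 := by
        gcongr
        exact hb t
    _ = z * (Real.exp t / 2 * Real.exp (-z * Real.cosh t)) := by ring
    _ ≤ _ := by gcongr

/-- The share of `e^{-t}` in `z sinh t` and `z cosh t` contributes only `O(z)`, so the asymptotics
are carried by `z e^t / 2`. -/
theorem norm_integral_exp_neg_le {φ : ℝ → ℝ} (hb : ∀ t, |φ t| ≤ 1) {z : ℝ} (hz : 0 < z) :
    |∫ t in Ioi (0 : ℝ), z * Real.exp (-t) / 2 * Real.exp (-z * Real.cosh t) * φ t| ≤ z / 2 := by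
  have h : ∫ t in Ioi (0 : ℝ), z / 2 * Real.exp (-t) = z / 2 := by
    rw [integral_const_mul, integral_exp_neg_Ioi_zero, mul_one]
  rw [← h, ← Real.norm_eq_abs]
  refine norm_integral_le_of_norm_le ((integrableOn_exp_neg_Ioi 0).const_mul _)
    (Eventually.of_forall fun t => ?_)
  rw [norm_mul, Real.norm_of_nonneg (by positivity)]
  have h1 : Real.exp (-z * Real.cosh t) ≤ 1 := Real.exp_le_one_iff.2 (by
    have := Real.cosh_pos t
    nlinarith)
  calc _ ≤ z * Real.exp (-t) / 2 * 1 * 1 := by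
        gcongr
        exact hb t
    _ = _ := by ring

/-- Integration by parts, through the vanishing boundary values of `exp(-z cosh t) sin(β t)`, turns
`β K` into the integral with weight `z sinh t`; then the `e^{-t}` half is discarded. -/
theorem abs_mul_macdonaldK_sub_le (β : ℝ) {z : ℝ} (hz : 0 < z) :
    |β * macdonaldK β z - ∫ t in Ioi (0 : ℝ),
      z * Real.exp t / 2 * Real.exp (-z * Real.cosh t) * Real.sin (β * t)| ≤ z / 2 := by
  have hi := integrableOn_exp_mul_exp_cosh (φ := fun t => Real.sin (β * t)) (by fun_prop)
    (fun t => Real.abs_sin_le_one _) hz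
  have hK := (integrableOn_cosh_pow_mul_cos 0 β hz).const_mul β
  have hd : ∀ t ∈ Ici (0 : ℝ), HasDerivAt
      (fun t => Real.exp (-z * Real.cosh t) * Real.sin (β * t))
      (z * Real.exp (-t) / 2 * Real.exp (-z * Real.cosh t) * Real.sin (β * t)
        - (z * Real.exp t / 2 * Real.exp (-z * Real.cosh t) * Real.sin (β * t)
        - β * (Real.cosh t ^ 0 * Real.exp (-z * Real.cosh t) * Real.cos (β * t)))) t := fun t _ => by
    convert! (hasDerivAt_neg_mul_cosh_exp z t).mul (hasDerivAt_sin_const_mul β t) using 1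
    rw [Real.sinh_eq]
    ring
  have hi2 : IntegrableOn
      (fun t => z * Real.exp (-t) / 2 * Real.exp (-z * Real.cosh t) * Real.sin (β * t))
      (Ioi 0) := by
    refine Integrable.mono' hi.norm (Continuous.aestronglyMeasurable (by fun_prop)) ?_
    refine (ae_restrict_iff' measurableSet_Ioi).2 (Eventually.of_forall fun t ht => ?_)
    have ht' : -t ≤ t := by
      have : (0 : ℝ) < t := ht
      linarith
    simp only [Real.norm_eq_abs, abs_mul, abs_div, Real.abs_exp]
    gcongr
  have hlim : Tendsto (fun t => Real.exp (-z * Real.cosh t) * Real.sin (β * t)) atTop (𝓝 0) := by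
    refine tendsto_zero_of_le_cosh_pow (C := 1) 0 hz zero_le_one fun t _ => ?_
    simpa using norm_cosh_pow_mul_le (Real.abs_sin_le_one (β * t)) 0 z t
  have h := integral_Ioi_of_hasDerivAt_of_tendsto' hd (hi2.sub (hi.sub hK)) hlim
  rw [integral_sub hi2 (by exact hi.sub hK), integral_sub hi hK, integral_const_mul] at h
  have h2 : macdonaldMoment 0 β z = macdonaldK β z := by rw [macdonaldMoment_zero]
  rw [macdonaldMoment] at h2
  rw [h2] at h
  have h3 := norm_integral_exp_neg_le (φ := fun t => Real.sin (β * t))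
    (fun t => Real.abs_sin_le_one _) hz
  simp only [mul_zero, Real.sin_zero, sub_zero] at h
  rw [sub_eq_zero.1 h, abs_sub_comm] at h3
  exact h3

theorem abs_mul_macdonaldMoment_one_sub_le (β : ℝ) {z : ℝ} (hz : 0 < z) :
    |z * macdonaldMoment 1 β z - ∫ t in Ioi (0 : ℝ),
      z * Real.exp t / 2 * Real.exp (-z * Real.cosh t) * Real.cos (β * t)| ≤ z / 2 := by
  have hi := integrableOn_exp_mul_exp_cosh (φ := fun t => Real.cos (β * t)) (by fun_prop)
    (fun t => Real.abs_cos_le_one _) hz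
  have hK := (integrableOn_cosh_pow_mul_cos 1 β hz).const_mul z
  rw [macdonaldMoment, ← integral_const_mul, ← integral_sub hK hi]
  refine le_trans (le_of_eq ?_) (norm_integral_exp_neg_le (φ := fun t => Real.cos (β * t))
    (fun t => Real.abs_cos_le_one _) hz)
  congr 2
  ext t
  rw [Real.cosh_eq t]
  ring

/-- The integral `∫₀^∞ (z e^t / 2) exp(-z cosh t) e^{iβt} dt` tends to a Gamma integral. -/
theorem norm_integral_sub_Gamma_le (β : ℝ) {z : ℝ} (hz : 0 < z) :
    ‖(∫ t in Ioi (0 : ℝ), ((z * Real.exp t / 2 * Real.exp (-z * Real.cosh t) : ℝ) : ℂ)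
        * Complex.exp (Complex.I * β * t))
      - (1 / (z / 2 : ℝ) : ℂ) ^ (Complex.I * β) * Complex.Gamma (1 + Complex.I * β)‖ ≤ z := by
  have hz2 : 0 < z / 2 := by positivity
  let F : ℝ → ℂ := fun x => (x : ℂ) ^ (Complex.I * β)
  have hF : ∀ x > 0, ‖F x‖ = 1 := fun x hx => by
    simp [F, Complex.norm_cpow_eq_rpow_re_of_pos hx]
  have hFc : ContinuousOn F (Ioi 0) := fun x hx => by
    refine ContinuousAt.continuousWithinAt ?_
    exact (continuousAt_cpow_const (Complex.ofReal_mem_slitPlane.2 hx)).comp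
      Complex.continuous_ofReal.continuousAt
  let g : ℝ → ℂ := fun x => ((z / 2 * Real.exp (-(z / 2) * (x + x⁻¹)) : ℝ) : ℂ) * F x
  let h : ℝ → ℂ := fun x => ((z / 2 * Real.exp (-(z / 2) * x) : ℝ) : ℂ) * F x
  have hG : (∫ t in Ioi (0 : ℝ), ((z * Real.exp t / 2 * Real.exp (-z * Real.cosh t) : ℝ) : ℂ)
        * Complex.exp (Complex.I * β * t)) = ∫ x in Ioi (1 : ℝ), g x := by
    rw [← Real.exp_zero, ← integral_comp_exp_Ioi]
    refine integral_congr_ae (Eventually.of_forall fun t => ?_)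
    have h1 : F (Real.exp t) = Complex.exp (Complex.I * β * t) := by
      simp only [F]
      rw [Complex.cpow_def_of_ne_zero (by exact_mod_cast (Real.exp_pos t).ne'),
        ← Complex.ofReal_log (Real.exp_pos t).le, Real.log_exp]
      ring_nf
    simp only [g]
    rw [h1, Complex.real_smul, ← mul_assoc, ← Complex.ofReal_mul, Real.cosh_eq, ← Real.exp_neg]
    congr 2
    rw [show -(z / 2) * (Real.exp t + Real.exp (-t))
      = -z * ((Real.exp t + Real.exp (-t)) / 2) by ring]
    ring
  have hH : (1 / (z / 2 : ℝ) : ℂ) ^ (Complex.I * β) * Complex.Gamma (1 + Complex.I * β)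
      = ∫ x in Ioi (0 : ℝ), h x := by
    have h1 := Complex.integral_cpow_mul_exp_neg_mul_Ioi (a := 1 + Complex.I * β) (r := z / 2)
      (by simp) hz2
    have h2 : (1 / (z / 2 : ℝ) : ℂ) ≠ 0 := one_div_ne_zero (by exact_mod_cast hz2.ne')
    rw [Complex.cpow_add _ _ h2, Complex.cpow_one] at h1
    have h3 : ((z / 2 : ℝ) : ℂ) ≠ 0 := by exact_mod_cast hz2.ne'
    calc _ = ((z / 2 : ℝ) : ℂ) * (1 / (z / 2 : ℝ) * (1 / (z / 2 : ℝ) : ℂ) ^ (Complex.I * β)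
          * Complex.Gamma (1 + Complex.I * β)) := by
          field_simp
      _ = _ := by
        rw [← h1, ← integral_const_mul]
        refine integral_congr_ae (Eventually.of_forall fun x => ?_)
        simp only [h, F, add_sub_cancel_left]
        push_cast
        rw [neg_mul]
        ring
  have hexpint : IntegrableOn (fun x : ℝ => z / 2 * Real.exp (-(z / 2) * x)) (Ioi 0) :=
    (integrableOn_exp_mul_Ioi (by linarith) 0).const_mul _
  have hhi : IntegrableOn h (Ioi 0) := by
    refine Integrable.mono' hexpint ?_ ?_
    · exact (ContinuousOn.mul (by fun_prop) hFc).aestronglyMeasurable measurableSet_Ioi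
    · refine (ae_restrict_iff' measurableSet_Ioi).2 (Eventually.of_forall fun x hx => ?_)
      rw [norm_mul, hF x hx, mul_one, Complex.norm_of_nonneg (by positivity)]
  have hsub1 : Ioi (1 : ℝ) ⊆ Ioi 0 := Ioi_subset_Ioi zero_le_one
  have hgi : IntegrableOn g (Ioi 1) := by
    refine Integrable.mono' (hexpint.mono_set hsub1) ?_ ?_
    · refine ContinuousOn.aestronglyMeasurable ?_ measurableSet_Ioi
      refine ContinuousOn.mul ?_ (hFc.mono hsub1)
      refine Complex.continuous_ofReal.comp_continuousOn ?_
      have : ContinuousOn (fun x : ℝ => x⁻¹) (Ioi 1) :=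
        continuousOn_inv₀.mono fun x hx => (zero_lt_one.trans hx).ne'
      fun_prop
    · refine (ae_restrict_iff' measurableSet_Ioi).2 (Eventually.of_forall fun x hx => ?_)
      have hx0 : 0 < x := zero_lt_one.trans hx
      have hx1 : 0 < x⁻¹ := inv_pos.2 hx0
      rw [norm_mul, hF x hx0, mul_one, Complex.norm_of_nonneg (by positivity)]
      gcongr ?_ * Real.exp ?_
      nlinarith
  have hsplit : ∫ x in Ioi (0 : ℝ), h x = (∫ x in Ioc (0 : ℝ) 1, h x) + ∫ x in Ioi (1 : ℝ), h x := by
    rw [← setIntegral_union Ioc_disjoint_Ioi_same measurableSet_Ioi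
      (hhi.mono_set Ioc_subset_Ioi_self) (hhi.mono_set hsub1), Ioc_union_Ioi_eq_Ioi zero_le_one]
  have hb1 : ‖∫ x in Ioc (0 : ℝ) 1, h x‖ ≤ z / 2 := by
    have := norm_setIntegral_le_of_norm_le_const (μ := volume) (s := Ioc (0 : ℝ) 1) (f := h)
      (C := z / 2) (by simp) (fun x hx => by
        rw [norm_mul, hF x hx.1, mul_one, Complex.norm_of_nonneg (by positivity)]
        refine mul_le_of_le_one_right hz2.le (Real.exp_le_one_iff.2 ?_)
        have := hx.1
        nlinarith)
    simpa using this
  have hb2 : ‖∫ x in Ioi (1 : ℝ), (g x - h x)‖ ≤ z / 2 := by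
    have h1 : ∫ x in Ioi (0 : ℝ), z / 2 * (z / 2 * Real.exp (-(z / 2) * x)) = z / 2 := by
      rw [integral_const_mul, integral_const_mul, integral_exp_mul_Ioi (by linarith)]
      simp
      field_simp
    have hnn : ∀ x : ℝ, 0 ≤ z / 2 * (z / 2 * Real.exp (-(z / 2) * x)) := fun x => by positivity
    rw [← h1]
    refine le_trans ?_ (setIntegral_mono_set (hexpint.const_mul (z / 2))
      (Eventually.of_forall hnn) hsub1.eventuallyLE)
    refine norm_integral_le_of_norm_le ((hexpint.mono_set hsub1).const_mul _) ?_
    refine (ae_restrict_iff' measurableSet_Ioi).2 (Eventually.of_forall fun x hx => ?_)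
    have hx0 : 0 < x := zero_lt_one.trans hx
    have hx1 : x⁻¹ ≤ 1 := inv_le_one_of_one_le₀ (le_of_lt hx)
    have hx2 : 0 < x⁻¹ := inv_pos.2 hx0
    simp only [g, h]
    rw [← sub_mul, norm_mul, hF x hx0, mul_one, ← Complex.ofReal_sub, Complex.norm_real,
      mul_add, Real.exp_add, Real.norm_eq_abs, abs_sub_comm]
    have h4 : Real.exp (-(z / 2) * x⁻¹) ≤ 1 := Real.exp_le_one_iff.2 (by nlinarith)
    have h5 : 1 - z / 2 ≤ Real.exp (-(z / 2) * x⁻¹) := by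
      have := Real.add_one_le_exp (-(z / 2) * x⁻¹)
      nlinarith
    have h6 := Real.exp_pos (-(z / 2) * x)
    rw [abs_of_nonneg]
    · have : z / 2 * Real.exp (-(z / 2) * x)
          - z / 2 * (Real.exp (-(z / 2) * x) * Real.exp (-(z / 2) * x⁻¹))
          = (1 - Real.exp (-(z / 2) * x⁻¹)) * (z / 2 * Real.exp (-(z / 2) * x)) := by ring
      rw [this]
      gcongr
      linarith
    · rw [← mul_sub]
      refine mul_nonneg hz2.le ?_
      nlinarith
  rw [hG, hH, hsplit]
  have : (∫ x in Ioi (1 : ℝ), g x) - ((∫ x in Ioc (0 : ℝ) 1, h x) + ∫ x in Ioi (1 : ℝ), h x)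
      = (∫ x in Ioi (1 : ℝ), (g x - h x)) - ∫ x in Ioc (0 : ℝ) 1, h x := by
    rw [integral_sub hgi (hhi.mono_set hsub1)]
    ring
  rw [this]
  refine (norm_sub_le _ _).trans ?_
  linarith

/-- `|Γ(1 + iβ)|`. -/
noncomputable def gammaNorm (β : ℝ) : ℝ := ‖Complex.Gamma (1 + Complex.I * β)‖

theorem gammaNorm_pos (β : ℝ) : 0 < gammaNorm β :=
  norm_pos_iff.2 (Complex.Gamma_ne_zero_of_re_pos (by simp))

/-- The phase `ϑ_β - β log(z/2)` of the small-argument asymptotics of `K_{iβ}`. -/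
noncomputable def macdonaldPhase (β z : ℝ) : ℝ := gammaPhase β - β * Real.log (z / 2)

theorem inv_cpow_mul_Gamma (β : ℝ) {z : ℝ} (hz : 0 < z) :
    (1 / (z / 2 : ℝ) : ℂ) ^ (Complex.I * β) * Complex.Gamma (1 + Complex.I * β)
      = gammaNorm β * Complex.exp (macdonaldPhase β z * Complex.I) := by
  have hz2 : 0 < z / 2 := by positivity
  conv_lhs => rw [← Complex.norm_mul_exp_arg_mul_I (Complex.Gamma (1 + Complex.I * β))]
  rw [← Complex.ofReal_one, ← Complex.ofReal_div, Complex.cpow_def_of_ne_zero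
    (by exact_mod_cast (one_div_pos.2 hz2).ne'), ← Complex.ofReal_log (one_div_pos.2 hz2).le,
    one_div, Real.log_inv, mul_left_comm, ← Complex.exp_add, gammaNorm, macdonaldPhase, gammaPhase]
  congr 2
  push_cast
  ring

theorem integral_exp_mul_exp_cosh_eq (β : ℝ) {z : ℝ} (hz : 0 < z) :
    (∫ t in Ioi (0 : ℝ), ((z * Real.exp t / 2 * Real.exp (-z * Real.cosh t) : ℝ) : ℂ)
        * Complex.exp (Complex.I * β * t))
    = ((∫ t in Ioi (0 : ℝ),
        z * Real.exp t / 2 * Real.exp (-z * Real.cosh t) * Real.cos (β * t) : ℝ) : ℂ)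
      + ((∫ t in Ioi (0 : ℝ),
        z * Real.exp t / 2 * Real.exp (-z * Real.cosh t) * Real.sin (β * t) : ℝ) : ℂ)
        * Complex.I := by
  have hc := integrableOn_exp_mul_exp_cosh (φ := fun t => Real.cos (β * t)) (by fun_prop)
    (fun t => Real.abs_cos_le_one _) hz
  have hs := integrableOn_exp_mul_exp_cosh (φ := fun t => Real.sin (β * t)) (by fun_prop)
    (fun t => Real.abs_sin_le_one _) hz
  rw [← integral_complex_ofReal, ← integral_complex_ofReal, ← integral_mul_const,
    ← integral_add hc.ofReal (hs.ofReal.mul_const _)]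
  refine integral_congr_ae (Eventually.of_forall fun t => ?_)
  have : Complex.I * β * t = ((β * t : ℝ) : ℂ) * Complex.I := by push_cast; ring
  simp only
  rw [this, Complex.exp_mul_I]
  push_cast
  ring

/-- Imaginary part of the comparison with `Γ(1 + iβ)`: the errors `z / 2` and `z` add up to less
than `2 z`. The real part gives the companion estimate for the first moment. -/
theorem abs_macdonaldK_sub_sin_le (β : ℝ) {z : ℝ} (hz : 0 < z) :
    |β * macdonaldK β z - gammaNorm β * Real.sin (macdonaldPhase β z)| ≤ 2 * z := by
  have h1 := abs_mul_macdonaldK_sub_le β hz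
  have h2 := norm_integral_sub_Gamma_le β hz
  rw [inv_cpow_mul_Gamma β hz, integral_exp_mul_exp_cosh_eq β hz, Complex.exp_mul_I] at h2
  have h3 := (Complex.abs_im_le_norm _).trans h2
  simp only [Complex.sub_im, Complex.add_im, Complex.mul_im, Complex.ofReal_re, Complex.ofReal_im,
    Complex.I_re, Complex.I_im, ← Complex.ofReal_cos, ← Complex.ofReal_sin, Complex.add_re,
    Complex.mul_re, mul_zero, mul_one, zero_mul, zero_add, add_zero, sub_zero] at h3
  have := abs_sub_le (β * macdonaldK β z) (∫ t in Ioi (0 : ℝ),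
      z * Real.exp t / 2 * Real.exp (-z * Real.cosh t) * Real.sin (β * t))
      (gammaNorm β * Real.sin (macdonaldPhase β z))
  linarith

theorem abs_macdonaldMoment_one_sub_cos_le (β : ℝ) {z : ℝ} (hz : 0 < z) :
    |z * macdonaldMoment 1 β z - gammaNorm β * Real.cos (macdonaldPhase β z)| ≤ 2 * z := by
  have h1 := abs_mul_macdonaldMoment_one_sub_le β hz
  have h2 := norm_integral_sub_Gamma_le β hz
  rw [inv_cpow_mul_Gamma β hz, integral_exp_mul_exp_cosh_eq β hz, Complex.exp_mul_I] at h2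
  have h3 := (Complex.abs_re_le_norm _).trans h2
  simp only [Complex.sub_re, Complex.add_im, Complex.mul_im, Complex.ofReal_re, Complex.ofReal_im,
    Complex.I_re, Complex.I_im, ← Complex.ofReal_cos, ← Complex.ofReal_sin, Complex.add_re,
    Complex.mul_re, mul_zero, mul_one, zero_mul, zero_add, add_zero, sub_zero] at h3
  have := abs_sub_le (z * macdonaldMoment 1 β z) (∫ t in Ioi (0 : ℝ),
      z * Real.exp t / 2 * Real.exp (-z * Real.cosh t) * Real.cos (β * t))
      (gammaNorm β * Real.cos (macdonaldPhase β z))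
  linarith

/-! ### Remainders that are small and Lipschitz near the origin -/

/-- `e` is Lipschitz on `(0, 1]` with `e(0+) = 0`. -/
def IsLipschitzRemainder (e : ℝ → ℝ) : Prop :=
  ∃ C, 0 ≤ C ∧ ∀ x ∈ Ioc (0 : ℝ) 1, |e x| ≤ C * x ∧ ∀ y ∈ Ioc (0 : ℝ) 1, |e x - e y| ≤ C * |x - y|

theorem IsLipschitzRemainder.add {e f : ℝ → ℝ} (he : IsLipschitzRemainder e)
    (hf : IsLipschitzRemainder f) : IsLipschitzRemainder fun x => e x + f x := by
  obtain ⟨C, hC, h⟩ := he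
  obtain ⟨D, hD, k⟩ := hf
  refine ⟨C + D, by positivity, fun x hx => ⟨?_, fun y hy => ?_⟩⟩
  · have h1 := (h x hx).1
    have h2 := (k x hx).1
    have := abs_add_le (e x) (f x)
    linarith
  · have h1 := (h x hx).2 y hy
    have h2 := (k x hx).2 y hy
    have := abs_add_le (e x - e y) (f x - f y)
    rw [add_sub_add_comm]
    linarith

theorem IsLipschitzRemainder.const_mul {e : ℝ → ℝ} (he : IsLipschitzRemainder e) (c : ℝ) :
    IsLipschitzRemainder fun x => c * e x := by
  obtain ⟨C, hC, h⟩ := he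
  refine ⟨|c| * C, by positivity, fun x hx => ⟨?_, fun y hy => ?_⟩⟩
  · rw [abs_mul, mul_assoc]
    exact mul_le_mul_of_nonneg_left (h x hx).1 (abs_nonneg c)
  · rw [← mul_sub, abs_mul, mul_assoc]
    exact mul_le_mul_of_nonneg_left ((h x hx).2 y hy) (abs_nonneg c)

theorem IsLipschitzRemainder.of_deriv_le {e e' : ℝ → ℝ} {C : ℝ} (hC : 0 ≤ C)
    (hb : ∀ x ∈ Ioc (0 : ℝ) 1, |e x| ≤ C * x) (hd : ∀ x ∈ Ioc (0 : ℝ) 1, HasDerivAt e (e' x) x)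
    (hd' : ∀ x ∈ Ioc (0 : ℝ) 1, |e' x| ≤ C) : IsLipschitzRemainder e :=
  ⟨C, hC, fun x hx => ⟨hb x hx, fun y hy => by
    simpa using (convex_Ioc (0 : ℝ) 1).norm_image_sub_le_of_norm_hasDerivWithin_le
      (fun z hz => (hd z hz).hasDerivWithinAt) hd' hy hx⟩⟩

/-- Product of a quadratically small function with one that is Lipschitz in `log x`. -/
theorem IsLipschitzRemainder.mul_log_lipschitz {f p p' : ℝ → ℝ} {C D : ℝ} (hC : 0 ≤ C)
    (hD : 0 ≤ D) (hf : ∀ x ∈ Ioc (0 : ℝ) 1, |f x| ≤ C * x ^ 2)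
    (hf' : ∀ x ∈ Ioc (0 : ℝ) 1, ∀ y ∈ Ioc (0 : ℝ) 1, |f x - f y| ≤ C * |x ^ 2 - y ^ 2|)
    (hp : ∀ x ∈ Ioc (0 : ℝ) 1, |p x| ≤ D) (hd : ∀ x ∈ Ioc (0 : ℝ) 1, HasDerivAt p (p' x) x)
    (hp' : ∀ x ∈ Ioc (0 : ℝ) 1, |p' x| ≤ D / x) : IsLipschitzRemainder fun x => f x * p x := by
  -- On `[y, x]` the slope of `p` is at most `D / y`, the worst case at the left end; pairing the
  -- increment of `p` with `f y = O(y²)` absorbs the `1 / y`.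
  have key : ∀ x ∈ Ioc (0 : ℝ) 1, ∀ y ∈ Ioc (0 : ℝ) 1, y ≤ x →
      |f x * p x - f y * p y| ≤ 3 * (C * D) * |x - y| := by
    intro x hx y hy hyx
    have h1 : |p x - p y| ≤ D / y * |x - y| := by
      have hsub : Icc y x ⊆ Ioc 0 1 := fun z hz => ⟨hy.1.trans_le hz.1, hz.2.trans hx.2⟩
      simpa using (convex_Icc y x).norm_image_sub_le_of_norm_hasDerivWithin_le
        (fun z hz => (hd z (hsub hz)).hasDerivWithinAt)
        (fun z hz => (hp' z (hsub hz)).trans (div_le_div_of_nonneg_left hD hy.1 hz.1))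
        ⟨le_rfl, hyx⟩ ⟨hyx, le_rfl⟩
    have h2 : |x ^ 2 - y ^ 2| ≤ 2 * |x - y| := by
      rw [sq_sub_sq, abs_mul, abs_of_pos (add_pos hx.1 hy.1)]
      have := hx.2
      have := hy.2
      gcongr
      linarith
    have h3 : f x * p x - f y * p y = (f x - f y) * p x + f y * (p x - p y) := by ring
    have hy0 := hy.1
    rw [h3]
    calc _ ≤ |f x - f y| * |p x| + |f y| * |p x - p y| := by
          rw [← abs_mul, ← abs_mul]
          exact abs_add_le _ _
      _ ≤ (C * (2 * |x - y|)) * D + (C * y ^ 2) * (D / y * |x - y|) := by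
          have := hp x hx
          have := hf y hy
          have := hf' x hx y hy
          gcongr
          exact this.trans (by gcongr)
      _ = C * D * |x - y| * (2 + y) := by field_simp
      _ ≤ C * D * |x - y| * 3 := by
          have := hy.2
          gcongr
          linarith
      _ = _ := by ring
  refine ⟨3 * (C * D), by positivity, fun x hx => ⟨?_, fun y hy => ?_⟩⟩
  · rw [abs_mul]
    have hx0 := hx.1
    calc _ ≤ C * x ^ 2 * D := mul_le_mul (hf x hx) (hp x hx) (abs_nonneg _) (by positivity)
      _ = C * D * x * x := by ring
      _ ≤ C * D * x * 3 := by
        have := hx.2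
        gcongr
        linarith
      _ = _ := by ring
  · rcases le_total y x with h | h
    · exact key x hx y hy h
    · rw [abs_sub_comm, abs_sub_comm x y]
      exact key y hy x hx h

theorem hasDerivAt_macdonaldPhase (β : ℝ) {x : ℝ} (hx : 0 < x) :
    HasDerivAt (macdonaldPhase β) (-(β / x)) x := by
  have h := ((((hasDerivAt_id x).div_const 2).log (by simpa using hx.ne')).const_mul β).const_sub
    (gammaPhase β)
  convert! h using 1
  simp only [id]
  field_simp

theorem abs_mul_macdonaldK_le (β : ℝ) {x : ℝ} (hx : x ∈ Ioc (0 : ℝ) 1) :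
    |β * macdonaldK β x| ≤ gammaNorm β + 2 := by
  have h1 := abs_macdonaldK_sub_sin_le β hx.1
  have h2 : |gammaNorm β * Real.sin (macdonaldPhase β x)| ≤ gammaNorm β := by
    rw [abs_mul, abs_of_pos (gammaNorm_pos β)]
    exact mul_le_of_le_one_right (gammaNorm_pos β).le (Real.abs_sin_le_one _)
  have h3 := hx.2
  rw [abs_le] at *
  constructor <;> linarith

theorem abs_mul_macdonaldMoment_one_le (β : ℝ) {x : ℝ} (hx : x ∈ Ioc (0 : ℝ) 1) :
    |x * macdonaldMoment 1 β x| ≤ gammaNorm β + 2 := by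
  have h1 := abs_macdonaldMoment_one_sub_cos_le β hx.1
  have h2 : |gammaNorm β * Real.cos (macdonaldPhase β x)| ≤ gammaNorm β := by
    rw [abs_mul, abs_of_pos (gammaNorm_pos β)]
    exact mul_le_of_le_one_right (gammaNorm_pos β).le (Real.abs_cos_le_one _)
  have h3 := hx.2
  rw [abs_le] at *
  constructor <;> linarith

theorem abs_macdonaldK_le {β : ℝ} (hβ : 0 < β) {x : ℝ} (hx : x ∈ Ioc (0 : ℝ) 1) :
    |macdonaldK β x| ≤ (gammaNorm β + 2) / β := by
  have := abs_mul_macdonaldK_le β hx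
  rw [abs_mul, abs_of_pos hβ] at this
  rwa [le_div_iff₀ hβ, mul_comm]

/-- Bessel's equation eliminates the second moment. The pair `(β K, x M₁)`, with `M₁` the first
moment, thus rotates at the rate `-β / x` of the phase, up to the term `-x K`. -/
theorem hasDerivAt_mul_macdonaldMoment_one (β : ℝ) {x : ℝ} (hx : 0 < x) :
    HasDerivAt (fun x => x * macdonaldMoment 1 β x) (-(x * macdonaldK β x) +
      β / x * (β * macdonaldK β x)) x := by
  have h := (hasDerivAt_id x).mul (hasDerivAt_macdonaldMoment 1 β hx)
  convert! h using 1
  have hb := macdonaldMoment_bessel β hx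
  simp only [id]
  field_simp
  linear_combination hb

/-- Differentiation turns the error of the sine asymptotics into `-β / x` times the error of the
cosine asymptotics, which is `O(x)`; the derivative is therefore bounded even though the phase
oscillates ever faster. -/
theorem isLipschitzRemainder_macdonaldK {β : ℝ} (hβ : 0 < β) :
    IsLipschitzRemainder fun x =>
      β * macdonaldK β x - gammaNorm β * Real.sin (macdonaldPhase β x) := by
  refine IsLipschitzRemainder.of_deriv_le (C := 2 + 2 * β)
    (e' := fun x => -(β / x * (x * macdonaldMoment 1 β x
      - gammaNorm β * Real.cos (macdonaldPhase β x)))) (by positivity) (fun x hx => ?_)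
    (fun x hx => ?_) fun x hx => ?_
  · have hx0 := hx.1
    refine (abs_macdonaldK_sub_sin_le β hx.1).trans ?_
    gcongr
    linarith
  · have hx0 := hx.1
    convert! ((hasDerivAt_macdonaldK β hx0).const_mul β).sub
      ((hasDerivAt_macdonaldPhase β hx0).sin.const_mul (gammaNorm β)) using 1
    field_simp
    ring
  · have hx0 := hx.1
    rw [abs_neg, abs_mul, abs_of_pos (div_pos hβ hx0)]
    calc _ ≤ β / x * (2 * x) := by
          gcongr
          exact abs_macdonaldMoment_one_sub_cos_le β hx0
      _ = 2 * β := by field_simp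
      _ ≤ _ := by linarith

theorem isLipschitzRemainder_macdonaldMoment_one {β : ℝ} (hβ : 0 < β) :
    IsLipschitzRemainder fun x =>
      x * macdonaldMoment 1 β x - gammaNorm β * Real.cos (macdonaldPhase β x) := by
  have hg := gammaNorm_pos β
  refine IsLipschitzRemainder.of_deriv_le (C := 2 + ((gammaNorm β + 2) / β + 2 * β))
    (e' := fun x => -(x * macdonaldK β x) + β / x * (β * macdonaldK β x
      - gammaNorm β * Real.sin (macdonaldPhase β x))) (by positivity) (fun x hx => ?_)
    (fun x hx => ?_) fun x hx => ?_
  · have hx0 := hx.1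
    refine (abs_macdonaldMoment_one_sub_cos_le β hx.1).trans ?_
    gcongr
    have : 0 < (gammaNorm β + 2) / β + 2 * β := by positivity
    linarith
  · have hx0 := hx.1
    convert! (hasDerivAt_mul_macdonaldMoment_one β hx0).sub
      ((hasDerivAt_macdonaldPhase β hx0).cos.const_mul (gammaNorm β)) using 1
    field_simp
    ring
  · have hx0 := hx.1
    have hK := abs_macdonaldK_le hβ hx
    have hE := abs_macdonaldK_sub_sin_le β hx0
    calc _ ≤ |-(x * macdonaldK β x)| + |β / x * (β * macdonaldK β x
          - gammaNorm β * Real.sin (macdonaldPhase β x))| := abs_add_le _ _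
      _ ≤ 1 * ((gammaNorm β + 2) / β) + β / x * (2 * x) := by
          rw [abs_neg, abs_mul, abs_mul, abs_of_pos (div_pos hβ hx0), abs_of_pos hx0]
          have := hx.2
          gcongr
      _ = (gammaNorm β + 2) / β + 2 * β := by field_simp
      _ ≤ _ := by linarith

/-! ### Roots -/

/-- The intermediate value theorem on `[-1, 1]` gives a root. Jordan's inequality confines every
root to `|y| ≤ 2ε ≤ 1/2`, where the sine has slope at least `1/2`, more than the perturbation with
slope at most `1/4` can compensate. -/
theorem exists_unique_root_sin_add {ε : ℝ} (hε : ε ≤ 1 / 4) {e : ℝ → ℝ}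
    (hb : ∀ y ∈ Ioo (-(Real.pi / 2)) (Real.pi / 2), |e y| ≤ ε)
    (hl : ∀ y ∈ Ioo (-(Real.pi / 2)) (Real.pi / 2), ∀ z ∈ Ioo (-(Real.pi / 2)) (Real.pi / 2),
      |e y - e z| ≤ ε * |y - z|) :
    ∃ y ∈ Ioo (-(Real.pi / 2)) (Real.pi / 2), Real.sin y + e y = 0 ∧ |y| ≤ 2 * ε ∧
      ∀ z ∈ Ioo (-(Real.pi / 2)) (Real.pi / 2), Real.sin z + e z = 0 → z = y := by
  have hpi := Real.pi_gt_three
  have hpi4 := Real.pi_lt_four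
  have hpi0 := Real.pi_pos
  have hε0 : 0 ≤ ε := (abs_nonneg _).trans (hb 0 ⟨by linarith, by linarith⟩)
  have small : ∀ z ∈ Ioo (-(Real.pi / 2)) (Real.pi / 2), Real.sin z + e z = 0 → |z| ≤ 2 * ε := by
    intro z hz h
    have h1 : |Real.sin z| ≤ ε := by
      rw [eq_neg_of_add_eq_zero_left h, abs_neg]
      exact hb z hz
    have h2 := Real.mul_abs_le_abs_sin (abs_le.2 ⟨hz.1.le, hz.2.le⟩)
    have h3 : 1 / 2 * |z| ≤ 2 / Real.pi * |z| := by
      refine mul_le_mul_of_nonneg_right ?_ (abs_nonneg z)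
      rw [div_le_div_iff₀ (by norm_num) hpi0]
      linarith
    linarith
  have hsub : Icc (-1 : ℝ) 1 ⊆ Ioo (-(Real.pi / 2)) (Real.pi / 2) := fun y hy =>
    ⟨by linarith [hy.1], by linarith [hy.2]⟩
  have hcont : ContinuousOn (fun y => Real.sin y + e y) (Icc (-1) 1) := by
    refine Real.continuous_sin.continuousOn.add ?_
    refine (LipschitzOnWith.of_dist_le_mul (K := ⟨ε, hε0⟩) fun y hy z hz => ?_).continuousOn
    exact hl y (hsub hy) z (hsub hz)
  have hs1 : 1 / 2 ≤ Real.sin 1 := by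
    have := Real.mul_le_sin (x := 1) zero_le_one (by linarith)
    have h3 : 1 / 2 ≤ 2 / Real.pi := by
      rw [div_le_div_iff₀ (by norm_num) hpi0]
      linarith
    linarith
  have h1 := hb 1 (hsub ⟨by norm_num, le_rfl⟩)
  have h2 := hb (-1) (hsub ⟨le_rfl, by norm_num⟩)
  rw [abs_le] at h1 h2
  obtain ⟨y, hy, hy0⟩ := intermediate_value_Icc (by norm_num) hcont
    (show (0 : ℝ) ∈ Icc _ _ by
      simp only [Real.sin_neg]
      constructor <;> linarith)
  refine ⟨y, hsub hy, hy0, small y (hsub hy) hy0, fun z hz hz0 => ?_⟩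
  by_contra hne
  have hy1 := small y (hsub hy) hy0
  have hz1 := small z hz hz0
  -- On `[-1/2, 1/2]` the derivative satisfies `cos x ≥ 1 - x²/2 ≥ 1/2`.
  have hs : ∀ u ∈ Icc (-(1 / 2) : ℝ) (1 / 2), ∀ v ∈ Icc (-(1 / 2) : ℝ) (1 / 2), v < u →
      1 / 2 * (u - v) ≤ Real.sin u - Real.sin v := by
    intro u hu v hv huv
    refine Convex.mul_sub_le_image_sub_of_le_deriv (convex_Icc (-(1 / 2) : ℝ) (1 / 2))
      Real.continuous_sin.continuousOn Real.differentiable_sin.differentiableOn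
      (fun x hx => ?_) v hv u hu huv.le
    rw [interior_Icc] at hx
    rw [Real.deriv_sin]
    have := Real.one_sub_sq_div_two_le_cos (x := x)
    nlinarith [hx.1, hx.2]
  have hyI : y ∈ Icc (-(1 / 2) : ℝ) (1 / 2) := abs_le.1 (by linarith)
  have hzI : z ∈ Icc (-(1 / 2) : ℝ) (1 / 2) := abs_le.1 (by linarith)
  have hl1 := abs_le.1 (hl y (hsub hy) z hz)
  rcases lt_or_gt_of_ne hne with h | h
  · have := hs y hyI z hzI h
    rw [abs_of_pos (sub_pos.2 h)] at hl1
    nlinarith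
  · have := hs z hzI y hyI h
    rw [abs_of_neg (sub_neg.2 h)] at hl1
    nlinarith

/-- Polar coordinates with a signed amplitude: the angle lies in `(-π/2, π/2]`, so `R` carries the
sign. Only `R ≠ 0` matters for locating zeros. -/
theorem exists_amplitude {a b : ℝ} (h : a ≠ 0 ∨ b ≠ 0) :
    ∃ R : ℝ, R ≠ 0 ∧ a = R * Real.cos (matchAngle a b) ∧ b = R * Real.sin (matchAngle a b) := by
  unfold matchAngle
  by_cases ha : a = 0
  · refine ⟨b, by tauto, by simp [ha], by simp [ha]⟩
  · rw [if_neg ha]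
    have hc := Real.cos_arctan_pos (b / a)
    refine ⟨a / Real.cos (Real.arctan (b / a)), div_ne_zero ha hc.ne', by field_simp, ?_⟩
    have := Real.tan_arctan (b / a)
    rw [Real.tan_eq_sin_div_cos] at this
    field_simp at this ⊢
    linarith

/-- The point `r₀ λₙ⁰ e^{y/β}`. -/
noncomputable def scaledRoot (β α : ℝ) (n : ℤ) (y : ℝ) : ℝ :=
  2 * Real.exp ((gammaPhase β - α) / β) * Real.exp (-(n * (Real.pi / β))) * Real.exp (y / β)

theorem scaledRoot_pos (β α : ℝ) (n : ℤ) (y : ℝ) : 0 < scaledRoot β α n y := by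
  unfold scaledRoot
  positivity

theorem unperturbedRoot_mul_exp {β r₀ : ℝ} (hr₀ : r₀ ≠ 0) (α : ℝ) (n : ℤ) (y : ℝ) :
    unperturbedRoot β r₀ α n * Real.exp (y / β) * r₀ = scaledRoot β α n y := by
  unfold unperturbedRoot scaledRoot
  field_simp

/-- The reason for the form of `λₙ⁰`: the phase there is `α + nπ`, and the factor `e^{y/β}` shifts
it by exactly `-y`. -/
theorem macdonaldPhase_scaledRoot {β : ℝ} (hβ : β ≠ 0) (α : ℝ) (n : ℤ) (y : ℝ) :
    macdonaldPhase β (scaledRoot β α n y) = α + (n * Real.pi - y) := by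
  have : scaledRoot β α n y / 2
      = Real.exp ((gammaPhase β - α) / β + -(n * (Real.pi / β)) + y / β) := by
    rw [Real.exp_add, Real.exp_add, scaledRoot]
    ring
  rw [macdonaldPhase, this, Real.log_exp]
  field_simp
  ring

theorem tendsto_scaledRoot {β : ℝ} (hβ : 0 < β) (α y : ℝ) :
    Tendsto (fun n => scaledRoot β α n y) atTop (𝓝 0) := by
  have h1 : Tendsto (fun n : ℤ => (n : ℝ) * (Real.pi / β)) atTop atTop :=
    tendsto_intCast_atTop_atTop.atTop_mul_const (div_pos Real.pi_pos hβ)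
  have h2 := ((Real.tendsto_exp_neg_atTop_nhds_zero.comp h1).const_mul
    (2 * Real.exp ((gammaPhase β - α) / β))).mul_const (Real.exp (y / β))
  simpa [scaledRoot, Function.comp_def] using h2

theorem abs_scaledRoot_sub_le {β : ℝ} (hβ : 0 < β) (α : ℝ) (n : ℤ) {y z Y : ℝ} (hy : y ≤ Y)
    (hz : z ≤ Y) :
    |scaledRoot β α n y - scaledRoot β α n z| ≤ scaledRoot β α n Y / β * |y - z| := by
  refine (convex_Iic Y).norm_image_sub_le_of_norm_hasDerivWithin_le
    (f := scaledRoot β α n) (f' := fun x => scaledRoot β α n x / β)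
    (fun x _ => HasDerivAt.hasDerivWithinAt ?_) (fun x hx => ?_) hz hy
  · convert! ((hasDerivAt_id x).div_const β).exp.const_mul
      (2 * Real.exp ((gammaPhase β - α) / β) * Real.exp (-(n * (Real.pi / β)))) using 1
    unfold scaledRoot
    simp only [id]
    ring
  · rw [Real.norm_of_nonneg (div_pos (scaledRoot_pos β α n x) hβ).le]
    have hx' : x ≤ Y := hx
    unfold scaledRoot
    gcongr

/-- Along the scaled points the trigonometric combination is `R sin(nπ - y)`. Division by the
amplitude leaves `sin y` plus a remainder that is small and has small Lipschitz constant in `y`,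
because the points themselves tend to `0`. -/
theorem exists_unique_scaledRoot {β : ℝ} (hβ : 0 < β) {a b : ℝ} (hab : a ≠ 0 ∨ b ≠ 0)
    {e : ℝ → ℝ} (he : IsLipschitzRemainder e) :
    ∃ n₀ : ℤ, ∃ η : ℤ → ℝ, Tendsto η atTop (𝓝 0) ∧ ∀ n, n₀ ≤ n →
      η n ∈ Ioo (-(Real.pi / 2)) (Real.pi / 2) ∧
      (∀ y ∈ Ioo (-(Real.pi / 2)) (Real.pi / 2),
        gammaNorm β * (a * Real.sin (macdonaldPhase β (scaledRoot β (matchAngle a b) n y))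
          - b * Real.cos (macdonaldPhase β (scaledRoot β (matchAngle a b) n y)))
          + e (scaledRoot β (matchAngle a b) n y) = 0 ↔ y = η n) ∧
      ∀ y ∈ Ioo (-(Real.pi / 2)) (Real.pi / 2), scaledRoot β (matchAngle a b) n y ≤ 1 / 2 := by
  obtain ⟨R, hR, haR, hbR⟩ := exists_amplitude hab
  obtain ⟨C, hC, he⟩ := he
  set α := matchAngle a b
  have hg := gammaNorm_pos β
  have hρ : 0 < gammaNorm β * |R| := by positivity
  let X : ℤ → ℝ := fun n => scaledRoot β α n (Real.pi / 2)
  -- One number for two bounds: the term `1` covers the size of the remainder, the term `1 / β` its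
  -- Lipschitz constant in `y`. `X n` is the largest scaled point, at `y = π / 2`.
  let ε : ℤ → ℝ := fun n => C * X n * (1 + 1 / β) / (gammaNorm β * |R|)
  have hX : Tendsto X atTop (𝓝 0) := tendsto_scaledRoot hβ α _
  have hε : Tendsto ε atTop (𝓝 0) := by
    simpa [ε] using ((hX.const_mul C).mul_const (1 + 1 / β)).div_const (gammaNorm β * |R|)
  -- The bound `1 / 4` is for the root lemma; `X n ≤ 1 / 2` keeps the points in `(0, 1]` and later
  -- keeps the energies above the infimum of the potential.
  have hev : ∀ᶠ n in atTop, X n ≤ 1 / 2 ∧ ε n ≤ 1 / 4 :=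
    (hX.eventually_le_const (by norm_num)).and (hε.eventually_le_const (by norm_num))
  obtain ⟨n₀, hn₀⟩ := eventually_atTop.1 hev
  have hle : ∀ n, ∀ y ∈ Ioo (-(Real.pi / 2)) (Real.pi / 2), scaledRoot β α n y ≤ X n := by
    intro n y hy
    have := hy.2
    simp only [X]
    unfold scaledRoot
    gcongr
  have main : ∀ n y, a * Real.sin (macdonaldPhase β (scaledRoot β α n y))
      - b * Real.cos (macdonaldPhase β (scaledRoot β α n y)) = -(R * (-1) ^ n * Real.sin y) := by
    intro n y
    rw [macdonaldPhase_scaledRoot hβ.ne', Real.sin_add, Real.cos_add, haR, hbR]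
    have h1 := Real.sin_int_mul_pi_sub y n
    have h2 := Real.sin_sq_add_cos_sq α
    linear_combination R * h1 + R * Real.sin (n * Real.pi - y) * h2
  have hs : ∀ n : ℤ, ((-1 : ℝ) ^ n) * (-1) ^ n = 1 := fun n => by
    rw [← mul_zpow]; simp
  have hsa : ∀ n : ℤ, |(-1 : ℝ) ^ n| = 1 := fun n => by rw [abs_zpow]; simp
  have key : ∀ n, n₀ ≤ n → ∃ y ∈ Ioo (-(Real.pi / 2)) (Real.pi / 2), |y| ≤ 2 * ε n ∧
      ∀ z ∈ Ioo (-(Real.pi / 2)) (Real.pi / 2),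
        gammaNorm β * (a * Real.sin (macdonaldPhase β (scaledRoot β α n z))
          - b * Real.cos (macdonaldPhase β (scaledRoot β α n z)))
          + e (scaledRoot β α n z) = 0 ↔ z = y := by
    intro n hn
    obtain ⟨hX1, hε1⟩ := hn₀ n hn
    have hmem : ∀ y ∈ Ioo (-(Real.pi / 2)) (Real.pi / 2), scaledRoot β α n y ∈ Ioc (0 : ℝ) 1 :=
      fun y hy => ⟨scaledRoot_pos _ _ _ _, (hle n y hy).trans (by linarith)⟩
    have hX0 : 0 < X n := scaledRoot_pos _ _ _ _
    have hcoef : |(-1 : ℝ) ^ n / (gammaNorm β * R)| = 1 / (gammaNorm β * |R|) := by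
      rw [abs_div, abs_mul, hsa, abs_of_pos hg]
    obtain ⟨y, hy, hy0, hys, hyu⟩ := exists_unique_root_sin_add hε1
      (e := fun y => -((-1) ^ n / (gammaNorm β * R)) * e (scaledRoot β α n y))
      (fun y hy => by
        rw [abs_mul, abs_neg, hcoef]
        calc _ ≤ 1 / (gammaNorm β * |R|) * (C * X n) := by
              gcongr
              exact ((he _ (hmem y hy)).1).trans (by gcongr; exact hle n y hy)
          _ = C * X n * 1 / (gammaNorm β * |R|) := by ring
          _ ≤ _ := by
              simp only [ε]
              gcongr
              have : 0 < 1 / β := by positivity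
              linarith)
      (fun y hy z hz => by
        rw [← mul_sub, abs_mul, abs_neg, hcoef]
        calc _ ≤ 1 / (gammaNorm β * |R|) * (C * (X n / β * |y - z|)) := by
              gcongr
              refine ((he _ (hmem y hy)).2 _ (hmem z hz)).trans ?_
              gcongr
              exact abs_scaledRoot_sub_le hβ α n hy.2.le hz.2.le
          _ = C * X n * (1 / β) / (gammaNorm β * |R|) * |y - z| := by ring
          _ ≤ _ := by
              simp only [ε]
              gcongr
              linarith)
    have hiff : ∀ z, gammaNorm β * (a * Real.sin (macdonaldPhase β (scaledRoot β α n z))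
          - b * Real.cos (macdonaldPhase β (scaledRoot β α n z)))
          + e (scaledRoot β α n z) = 0 ↔
        Real.sin z + -((-1) ^ n / (gammaNorm β * R)) * e (scaledRoot β α n z) = 0 := by
      intro z
      rw [main]
      have hne : -(gammaNorm β * R * (-1) ^ n) ≠ 0 := by
        refine neg_ne_zero.2 (mul_ne_zero (mul_ne_zero hg.ne' hR) ?_)
        exact zpow_ne_zero _ (by norm_num)
      have : gammaNorm β * -(R * (-1) ^ n * Real.sin z) + e (scaledRoot β α n z)
          = -(gammaNorm β * R * (-1) ^ n) *
            (Real.sin z + -((-1) ^ n / (gammaNorm β * R)) * e (scaledRoot β α n z)) := by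
        field_simp
        linear_combination (-e (scaledRoot β α n z)) * hs n
      rw [this, mul_eq_zero, or_iff_right hne]
    refine ⟨y, hy, hys, fun z hz => ?_⟩
    rw [hiff]
    exact ⟨hyu z hz, fun h => h ▸ hy0⟩
  have hch : ∀ n, ∃ y, n₀ ≤ n → y ∈ Ioo (-(Real.pi / 2)) (Real.pi / 2) ∧ |y| ≤ 2 * ε n ∧
      ∀ z ∈ Ioo (-(Real.pi / 2)) (Real.pi / 2),
        gammaNorm β * (a * Real.sin (macdonaldPhase β (scaledRoot β α n z))
          - b * Real.cos (macdonaldPhase β (scaledRoot β α n z)))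
          + e (scaledRoot β α n z) = 0 ↔ z = y := by
    intro n
    by_cases hn : n₀ ≤ n
    · obtain ⟨y, h1, h2, h3⟩ := key n hn
      exact ⟨y, fun _ => ⟨h1, h2, h3⟩⟩
    -- Below `n₀` the value is an arbitrary default.
    · exact ⟨0, fun h => absurd h hn⟩
  choose η hη using hch
  refine ⟨n₀, η, ?_, fun n hn => ⟨(hη n hn).1, (hη n hn).2.2, fun y hy =>
    (hle n y hy).trans (hn₀ n hn).1⟩⟩
  have h2ε : Tendsto (fun n => 2 * ε n) atTop (𝓝 0) := by simpa using hε.const_mul 2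
  refine squeeze_zero_norm' ?_ h2ε
  filter_upwards [eventually_ge_atTop n₀] with n hn
  exact (hη n hn).2.1

/-! ### Weak derivatives on the half-line -/

theorem integrable_smul_of_tsupport_subset {φ : ℝ → ℝ} {f : ℝ → ℂ} (hφ : Continuous φ)
    (hc : HasCompactSupport φ) (hs : tsupport φ ⊆ Ioi 0) (hf : LocallyIntegrableOn f (Ioi 0)) :
    Integrable fun r => φ r • f r := by
  have h1 : IntegrableOn f (tsupport φ) := hf.integrableOn_compact_subset hs hc
  have h2 : IntegrableOn (fun r => φ r • f r) (tsupport φ) :=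
    h1.continuousOn_smul hφ.continuousOn hc
  refine (integrableOn_iff_integrable_of_support_subset fun r hr => subset_tsupport φ ?_).1 h2
  intro h
  simp [h] at hr

theorem setIntegral_Ioi_smul_eq {φ : ℝ → ℝ} (hs : tsupport φ ⊆ Ioi 0) (f : ℝ → ℂ) :
    ∫ r in Ioi (0 : ℝ), φ r • f r = ∫ r, φ r • f r := by
  refine setIntegral_eq_integral_of_forall_compl_eq_zero fun r hr => ?_
  rw [image_eq_zero_of_notMem_tsupport fun h => hr (hs h), zero_smul]

theorem tsupport_deriv_subset_Ioi {φ : ℝ → ℝ} (hs : tsupport φ ⊆ Ioi 0) :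
    tsupport (deriv φ) ⊆ Ioi 0 :=
  (closure_minimal support_deriv_subset (isClosed_tsupport φ)).trans hs

theorem locallyIntegrableOn_of_continuousOn {f : ℝ → ℂ} (hf : ContinuousOn f (Ioi 0)) :
    LocallyIntegrableOn f (Ioi 0) :=
  hf.locallyIntegrableOn measurableSet_Ioi

theorem isWeakDeriv_of_hasDerivAt {f g : ℝ → ℂ} (hd : ∀ r > 0, HasDerivAt f (g r) r)
    (hg : ContinuousOn g (Ioi 0)) : IsWeakDeriv f g := by
  have hf : LocallyIntegrableOn f (Ioi 0) := locallyIntegrableOn_of_continuousOn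
    fun r hr => (hd r hr).continuousAt.continuousWithinAt
  have hgl := locallyIntegrableOn_of_continuousOn hg
  refine ⟨hf, hgl, fun φ hφ hc hs => ?_⟩
  have hs' := tsupport_deriv_subset_Ioi hs
  have hφ' : Continuous (deriv φ) := hφ.continuous_deriv (by simp)
  have i1 := integrable_smul_of_tsupport_subset hφ' hc.deriv hs' hf
  have i2 := integrable_smul_of_tsupport_subset hφ.continuous hc hs hgl
  have i3 := integrable_smul_of_tsupport_subset hφ.continuous hc hs hf
  -- Extended by the zeros of `φ`, the product `φ f` is differentiable on the whole line, so its
  -- derivative integrates to zero.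
  have hD : ∀ r, HasDerivAt (fun r => φ r • f r) (φ r • g r + deriv φ r • f r) r := by
    intro r
    by_cases hr : r ∈ tsupport φ
    · exact ((hφ.differentiable (by simp)) r).hasDerivAt.smul (hd r (hs hr))
    · have h0 : φ =ᶠ[𝓝 r] 0 := notMem_tsupport_iff_eventuallyEq.1 hr
      have h1 : deriv φ r = 0 := by
        rw [h0.deriv_eq]
        simp
      rw [h1, h0.eq_of_nhds]
      simp only [Pi.zero_apply, zero_smul, add_zero]
      refine (hasDerivAt_const r (0 : ℂ)).congr_of_eventuallyEq ?_
      filter_upwards [h0] with x hx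
      simp [hx]
  have := integral_eq_zero_of_hasDerivAt_of_integrable hD (i2.add i1) i3
  rw [integral_add i2 i1] at this
  rw [setIntegral_Ioi_smul_eq hs', setIntegral_Ioi_smul_eq hs]
  exact eq_neg_of_add_eq_zero_right this

theorem exists_tsupport_subset_Icc {φ : ℝ → ℝ} (hc : HasCompactSupport φ)
    (hs : tsupport φ ⊆ Ioi 0) : ∃ a b : ℝ, 0 < a ∧ tsupport φ ⊆ Icc a b := by
  rcases (tsupport φ).eq_empty_or_nonempty with h | h
  · exact ⟨1, 1, one_pos, by simp [h]⟩
  · obtain ⟨a, ha, hamin⟩ := IsCompact.exists_isLeast hc h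
    obtain ⟨b, hb, hbmax⟩ := IsCompact.exists_isGreatest hc h
    exact ⟨a, b, hs ha, fun x hx => ⟨hamin hx, hbmax hx⟩⟩

/-- The primitive from `0` vanishes before the support of `χ`; beyond it, it equals the total
integral, which is zero. -/
theorem exists_primitive_of_integral_eq_zero {χ : ℝ → ℝ} (hχ : ContDiff ℝ ∞ χ)
    (hc : HasCompactSupport χ) (hs : tsupport χ ⊆ Ioi 0) (h0 : ∫ r, χ r = 0) :
    ∃ φ : ℝ → ℝ, ContDiff ℝ ∞ φ ∧ HasCompactSupport φ ∧ tsupport φ ⊆ Ioi 0 ∧ deriv φ = χ := by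
  obtain ⟨a, b, ha, hab⟩ := exists_tsupport_subset_Icc hc hs
  have hcont := hχ.continuous
  have hint : Integrable χ := hcont.integrable_of_hasCompactSupport hc
  have hd : ∀ r, HasDerivAt (fun r => ∫ t in (0 : ℝ)..r, χ t) (χ r) r := fun r =>
    intervalIntegral.integral_hasDerivAt_right (hcont.intervalIntegrable _ _)
      hcont.aestronglyMeasurable.stronglyMeasurableAtFilter hcont.continuousAt
  have hderiv : deriv (fun r => ∫ t in (0 : ℝ)..r, χ t) = χ := funext fun r => (hd r).deriv
  have hz : ∀ t, t ∉ Icc a b → χ t = 0 := fun t ht =>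
    image_eq_zero_of_notMem_tsupport fun h => ht (hab h)
  have hsupp : Function.support (fun r => ∫ t in (0 : ℝ)..r, χ t) ⊆ Icc a b := by
    intro r hr
    by_contra hrI
    apply hr
    simp only [mem_Icc, not_and_or, not_le] at hrI
    rcases hrI with h | h
    · refine intervalIntegral.integral_zero_ae (Eventually.of_forall fun t ht => hz t fun hab' => ?_)
      rcases mem_uIoc.1 ht with h' | h'
      · linarith [h'.2, hab'.1]
      · linarith [h'.2, hab'.1]
    · by_cases hr0 : 0 ≤ r
      · beta_reduce
        rw [intervalIntegral.integral_of_le hr0, setIntegral_eq_integral_of_forall_compl_eq_zero, h0]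
        intro t ht
        refine hz t fun hab' => ht ⟨ha.trans_le hab'.1, hab'.2.trans h.le⟩
      · refine intervalIntegral.integral_zero_ae
          (Eventually.of_forall fun t ht => hz t fun hab' => ?_)
        rw [uIoc_of_ge (not_le.1 hr0).le] at ht
        linarith [ht.2, hab'.1]
  have hts := closure_minimal hsupp isClosed_Icc
  refine ⟨fun r => ∫ t in (0 : ℝ)..r, χ t, ?_, ?_, fun r hr => ha.trans_le (hts hr).1, hderiv⟩
  · rw [contDiff_infty_iff_deriv, hderiv]
    exact ⟨fun r => (hd r).differentiableAt, hχ⟩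
  · exact HasCompactSupport.of_support_subset_isCompact isCompact_Icc hsupp

/-- The du Bois-Reymond lemma. -/
theorem ae_eq_const_of_weakDeriv_zero {f : ℝ → ℂ} (hf : LocallyIntegrableOn f (Ioi 0))
    (h : ∀ φ : ℝ → ℝ, ContDiff ℝ ∞ φ → HasCompactSupport φ → tsupport φ ⊆ Ioi 0 →
      ∫ r in Ioi (0 : ℝ), deriv φ r • f r = 0) :
    ∃ c : ℂ, ∀ᵐ r ∂(volume.restrict (Ioi (0 : ℝ))), f r = c := by
  -- A reference test function of integral one, supported in `[1, 3]` and so away from the boundary;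
  -- it measures the constant.
  let bump : ContDiffBump (2 : ℝ) := ⟨1 / 2, 1, by norm_num, by norm_num⟩
  let ρ : ℝ → ℝ := bump.normed volume
  have hρ : ContDiff ℝ ∞ ρ := bump.contDiff_normed
  have hρc : HasCompactSupport ρ := bump.hasCompactSupport_normed
  have hρs : tsupport ρ ⊆ Ioi 0 := by
    rw [bump.tsupport_normed_eq, Real.closedBall_eq_Icc]
    intro x hx
    have : (2 : ℝ) - 1 ≤ x := hx.1
    exact lt_of_lt_of_le (by norm_num) this
  have hρ1 : ∫ r, ρ r = 1 := bump.integral_normed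
  refine ⟨∫ r, ρ r • f r, ?_⟩
  set c : ℂ := ∫ r, ρ r • f r
  have hcl : LocallyIntegrableOn (fun _ : ℝ => c) (Ioi 0) :=
    locallyIntegrableOn_of_continuousOn continuousOn_const
  rw [ae_restrict_iff' measurableSet_Ioi]
  have key := isOpen_Ioi.ae_eq_zero_of_integral_contDiff_smul_eq_zero (μ := volume)
    (f := fun r => f r - c) (hf.sub hcl) (fun ψ hψ hψc hψs => by
      have i1 := integrable_smul_of_tsupport_subset hψ.continuous hψc hψs hf
      have i2 := integrable_smul_of_tsupport_subset hψ.continuous hψc hψs hcl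
      have i3 := integrable_smul_of_tsupport_subset hρ.continuous hρc hρs hf
      have iψ : Integrable ψ := hψ.continuous.integrable_of_hasCompactSupport hψc
      have iρ : Integrable ρ := hρ.continuous.integrable_of_hasCompactSupport hρc
      set m : ℝ := ∫ r, ψ r
      -- Removing the mean makes `χ` the derivative of a test function, and the hypothesis becomes
      -- `∫ ψ f = (∫ ψ) c`.
      let χ : ℝ → ℝ := fun r => ψ r - m * ρ r
      have hsub : tsupport χ ⊆ tsupport ψ ∪ tsupport ρ := by
        refine closure_minimal (fun r hr => ?_) ((isClosed_tsupport ψ).union (isClosed_tsupport ρ))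
        by_contra hn
        rw [mem_union, not_or] at hn
        apply hr
        simp [χ, image_eq_zero_of_notMem_tsupport hn.1, image_eq_zero_of_notMem_tsupport hn.2]
      obtain ⟨φ, h1, h2, h3, h4⟩ := exists_primitive_of_integral_eq_zero (χ := χ)
        (hψ.sub (contDiff_const.mul hρ))
        (HasCompactSupport.of_support_subset_isCompact (hψc.isCompact.union hρc.isCompact)
          ((subset_tsupport χ).trans hsub))
        (hsub.trans (union_subset hψs hρs))
        (by
          simp only [χ]
          rw [integral_sub iψ (iρ.const_mul m), integral_const_mul, hρ1, mul_one, sub_self])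
      have h5 := h φ h1 h2 h3
      rw [setIntegral_Ioi_smul_eq (tsupport_deriv_subset_Ioi h3), h4] at h5
      have h6 : ∫ r, χ r • f r = (∫ r, ψ r • f r) - m • c := by
        have : ∀ r, χ r • f r = ψ r • f r - m • ρ r • f r := fun r => by
          simp only [χ, sub_smul, mul_smul]
        simp only [this]
        rw [integral_sub i1 (by exact i3.smul m), integral_smul]
      simp only [smul_sub]
      rw [integral_sub i1 i2, integral_smul_const, ← h6, h5])
  filter_upwards [key] with r hr hr0
  exact sub_eq_zero.1 (hr hr0)

theorem IsWeakDeriv.congr_ae {f f' g g' : ℝ → ℂ} (h : IsWeakDeriv f g)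
    (hf : f =ᵐ[volume.restrict (Ioi (0 : ℝ))] f') (hg : g =ᵐ[volume.restrict (Ioi (0 : ℝ))] g') :
    IsWeakDeriv f' g' := by
  refine ⟨h.1.congr hf, h.2.1.congr hg, fun φ h1 h2 h3 => ?_⟩
  have e1 : ∫ r in Ioi (0 : ℝ), deriv φ r • f' r = ∫ r in Ioi (0 : ℝ), deriv φ r • f r :=
    integral_congr_ae (hf.mono fun r hr => by simp only [hr])
  have e2 : ∫ r in Ioi (0 : ℝ), φ r • g' r = ∫ r in Ioi (0 : ℝ), φ r • g r :=
    integral_congr_ae (hg.mono fun r hr => by simp only [hr])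
  rw [e1, e2, h.2.2 φ h1 h2 h3]

theorem exists_primitive_Ioi {g : ℝ → ℂ} (hg : ContinuousOn g (Ioi 0)) :
    ∃ G : ℝ → ℂ, ∀ r > 0, HasDerivAt G (g r) r := by
  refine ⟨fun r => ∫ t in (1 : ℝ)..r, g t, fun r hr => ?_⟩
  have hsub : uIcc 1 r ⊆ Ioi (0 : ℝ) := fun t ht =>
    lt_of_lt_of_le (lt_min one_pos hr) ht.1
  refine intervalIntegral.integral_hasDerivAt_right ((hg.mono hsub).intervalIntegrable) ?_
    (hg.continuousAt (Ioi_mem_nhds hr))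
  exact hg.stronglyMeasurableAtFilter isOpen_Ioi r hr

/-- A function with continuous weak derivative is a.e. equal to a `C¹` function. -/
theorem IsWeakDeriv.exists_hasDerivAt {f g : ℝ → ℂ} (h : IsWeakDeriv f g)
    (hg : ContinuousOn g (Ioi 0)) :
    ∃ F : ℝ → ℂ, (∀ r > 0, HasDerivAt F (g r) r) ∧ f =ᵐ[volume.restrict (Ioi (0 : ℝ))] F := by
  obtain ⟨G, hG⟩ := exists_primitive_Ioi hg
  have hGw := isWeakDeriv_of_hasDerivAt hG hg
  obtain ⟨c, hc⟩ := ae_eq_const_of_weakDeriv_zero (f := fun r => f r - G r) (h.1.sub hGw.1)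
    (fun φ h1 h2 h3 => by
      have hs' := tsupport_deriv_subset_Ioi h3
      have hφ' : Continuous (deriv φ) := h1.continuous_deriv (by simp)
      have i1 := integrable_smul_of_tsupport_subset hφ' h2.deriv hs' h.1
      have i2 := integrable_smul_of_tsupport_subset hφ' h2.deriv hs' hGw.1
      simp only [smul_sub]
      rw [integral_sub i1.integrableOn i2.integrableOn, h.2.2 φ h1 h2 h3, hGw.2.2 φ h1 h2 h3,
        sub_self])
  refine ⟨fun r => G r + c, fun r hr => (hG r hr).add_const c, hc.mono fun r hr => ?_⟩
  simp only at hr ⊢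
  rw [← hr]
  ring

/-- Product rule for weak derivatives and smooth factors. -/
theorem IsWeakDeriv.smooth_smul {f g : ℝ → ℂ} (h : IsWeakDeriv f g) {p : ℝ → ℝ}
    (hp : ContDiff ℝ ∞ p) :
    IsWeakDeriv (fun r => p r • f r) (fun r => deriv p r • f r + p r • g r) := by
  have hp' : Continuous (deriv p) := hp.continuous_deriv (by simp)
  have lf : LocallyIntegrableOn (fun r => p r • f r) (Ioi 0) :=
    h.1.continuousOn_smul isOpen_Ioi.isLocallyClosed hp.continuous.continuousOn
  have lf' : LocallyIntegrableOn (fun r => deriv p r • f r) (Ioi 0) :=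
    h.1.continuousOn_smul isOpen_Ioi.isLocallyClosed hp'.continuousOn
  have lg : LocallyIntegrableOn (fun r => p r • g r) (Ioi 0) :=
    h.2.1.continuousOn_smul isOpen_Ioi.isLocallyClosed hp.continuous.continuousOn
  refine ⟨lf, lf'.add lg, fun φ h1 h2 h3 => ?_⟩
  have hs' := tsupport_deriv_subset_Ioi h3
  have hφ' : Continuous (deriv φ) := h1.continuous_deriv (by simp)
  have i1 := integrable_smul_of_tsupport_subset hφ' h2.deriv hs' lf
  have i2 := integrable_smul_of_tsupport_subset h1.continuous h2 h3 lf'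
  have i3 := integrable_smul_of_tsupport_subset h1.continuous h2 h3 lg
  have hprod := h.2.2 (fun r => φ r * p r) (h1.mul hp) h2.mul_right
    ((tsupport_mul_subset_left).trans h3)
  have hderiv : ∀ r, deriv (fun r => φ r * p r) r • f r
      = deriv φ r • p r • f r + φ r • deriv p r • f r := fun r => by
    rw [deriv_fun_mul (h1.differentiable (by simp) r) (hp.differentiable (by simp) r), add_smul,
      mul_smul, mul_smul]
  simp only [hderiv, mul_smul] at hprod
  rw [integral_add i1.integrableOn i2.integrableOn] at hprod
  simp only [smul_add]
  rw [integral_add i2.integrableOn i3.integrableOn, neg_add]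
  linear_combination hprod

/-- Regularity: a continuous weak solution of the radial equation is a classical one. -/
theorem radial_regularity {ζ ζ₁ ζ₂ : ℝ → ℂ} {Q : ℝ → ℝ} (hζ : ContinuousOn ζ (Ioi 0))
    (hQ : ContinuousOn Q (Ioi 0)) (h1 : IsWeakDeriv ζ ζ₁) (h2 : IsWeakDeriv ζ₁ ζ₂)
    (heq : ∀ᵐ r ∂(volume.restrict (Ioi (0 : ℝ))), ζ₂ r + (2 / r : ℂ) * ζ₁ r = Q r * ζ r) :
    ∃ u' : ℝ → ℂ, (∀ r > 0, HasDerivAt (fun r : ℝ => (r : ℂ) * ζ r) (u' r) r) ∧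
      ∀ r > 0, HasDerivAt u' (Q r • ((r : ℂ) * ζ r)) r := by
  let k : ℝ → ℂ := fun r => (r : ℂ) ^ 2 * (Q r * ζ r)
  have hk : ContinuousOn k (Ioi 0) := by
    have := Complex.continuous_ofReal.comp_continuousOn hQ
    exact ContinuousOn.mul (by fun_prop) (this.mul hζ)
  -- Divergence form `(r² ζ')' = r² Q ζ`: the right side is continuous, so `r² ζ₁` is `C¹` up to a
  -- null set, and then `ζ` is `C¹`.
  have hw : IsWeakDeriv (fun r => (r ^ 2 : ℝ) • ζ₁ r) k := by
    have := h2.smooth_smul (p := fun r => r ^ 2) (by fun_prop)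
    refine this.congr_ae (EventuallyEq.refl _ _) ?_
    have hpos : ∀ᵐ r ∂(volume.restrict (Ioi (0 : ℝ))), r ∈ Ioi (0 : ℝ) :=
      ae_restrict_mem measurableSet_Ioi
    filter_upwards [heq, hpos] with r hr hr0
    have hr' : (r : ℂ) ≠ 0 := by exact_mod_cast (ne_of_gt hr0)
    simp only [k]
    rw [← hr]
    simp only [deriv_pow_field, Complex.real_smul]
    push_cast
    field_simp
    ring
  obtain ⟨F, hF, hFe⟩ := hw.exists_hasDerivAt hk
  let g : ℝ → ℂ := fun r => F r / (r : ℂ) ^ 2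
  have hFc : ContinuousOn F (Ioi 0) := fun r hr => (hF r hr).continuousAt.continuousWithinAt
  have hg : ContinuousOn g (Ioi 0) := hFc.div (by fun_prop) fun r hr =>
    pow_ne_zero 2 (by exact_mod_cast (ne_of_gt hr))
  have hpos : ∀ᵐ r ∂(volume.restrict (Ioi (0 : ℝ))), r ∈ Ioi (0 : ℝ) :=
    ae_restrict_mem measurableSet_Ioi
  have hge : ζ₁ =ᵐ[volume.restrict (Ioi (0 : ℝ))] g := by
    filter_upwards [hFe, hpos] with r hr hr0
    have hr' : (r : ℂ) ≠ 0 := by exact_mod_cast (ne_of_gt hr0)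
    simp only [g]
    rw [← hr, Complex.real_smul]
    push_cast
    field_simp
  obtain ⟨Z, hZ, hZe⟩ := (h1.congr_ae (EventuallyEq.refl _ _) hge).exists_hasDerivAt hg
  have hZζ : EqOn ζ Z (Ioi 0) := Measure.eqOn_open_of_ae_eq hZe isOpen_Ioi hζ
    fun r hr => (hZ r hr).continuousAt.continuousWithinAt
  have hζd : ∀ r > 0, HasDerivAt ζ (g r) r := fun r hr =>
    (hZ r hr).congr_of_eventuallyEq (hZζ.eventuallyEq_of_mem (Ioi_mem_nhds hr))
  -- `u' = ζ + r ζ'`, and `F = r² ζ'`.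
  refine ⟨fun r => ζ r + F r / r, fun r hr => ?_, fun r hr => ?_⟩
  · have hr' : (r : ℂ) ≠ 0 := by exact_mod_cast (ne_of_gt hr)
    have := (Complex.ofRealCLM.hasDerivAt (x := r)).mul (hζd r hr)
    convert! this using 1
    simp only [g, Complex.ofRealCLM_apply, Complex.ofReal_one]
    field_simp
  · have hr' : (r : ℂ) ≠ 0 := by exact_mod_cast (ne_of_gt hr)
    have := (hζd r hr).add ((hF r hr).div (Complex.ofRealCLM.hasDerivAt (x := r)) hr')
    convert! this using 1
    simp only [g, k, Complex.ofRealCLM_apply, Complex.ofReal_one, Complex.real_smul]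
    field_simp
    ring

/-- A solution vanishing at the origin is a multiple of the regular real solution. -/
theorem exists_eq_mul_of_tendsto_zero {u u' : ℝ → ℂ} {w w' Q : ℝ → ℝ} (hQ : Continuous Q)
    (hu : ∀ r > 0, HasDerivAt u (u' r) r) (hu' : ∀ r > 0, HasDerivAt u' (Q r • u r) r)
    (hw : ∀ r, HasDerivAt w (w' r) r) (hw' : ∀ r, HasDerivAt w' (Q r * w r) r)
    (hw0 : w 0 = 0) (hw1 : w' 0 ≠ 0) (hlim : Tendsto u (𝓝[>] 0) (𝓝 0)) :
    ∃ A : ℂ, ∀ r > 0, u r = A * w r := by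
  have hwc : ∀ r, HasDerivAt (fun r => (w r : ℂ)) (w' r : ℂ) r := fun r => (hw r).ofReal_comp
  have hwc' : ∀ r, HasDerivAt (fun r => (w' r : ℂ)) ((Q r * w r : ℝ) : ℂ) r :=
    fun r => (hw' r).ofReal_comp
  -- `u'' = Q u` is bounded near `0`, hence so is `u'`; this makes the term `u' w` of the Wronskian
  -- tend to zero.
  obtain ⟨C, hC⟩ : ∃ C, ∀ᶠ r in 𝓝[>] (0 : ℝ), ‖u' r‖ ≤ C := by
    obtain ⟨δ, hδ, hδu⟩ : ∃ δ : ℝ, 0 < δ ∧ ∀ r ∈ Ioo 0 δ, ‖u r‖ ≤ 1 := by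
      have : ∀ᶠ r in 𝓝[>] (0 : ℝ), ‖u r‖ ≤ 1 := by
        have := hlim.norm
        rw [norm_zero] at this
        exact this.eventually_le_const one_pos
      obtain ⟨δ, hδ, h⟩ := mem_nhdsGT_iff_exists_Ioo_subset.1 this
      exact ⟨δ, hδ, fun r hr => h hr⟩
    obtain ⟨M, hM⟩ := isCompact_Icc.exists_bound_of_continuousOn (hQ.continuousOn (s := Icc 0 δ))
    refine ⟨‖u' (δ / 2)‖ + M * δ, mem_nhdsGT_iff_exists_Ioo_subset.2 ⟨δ, hδ, fun r hr => ?_⟩⟩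
    have hmid : δ / 2 ∈ Ioo 0 δ := ⟨by linarith, by linarith⟩
    have h1 := (convex_Ioo 0 δ).norm_image_sub_le_of_norm_hasDerivWithin_le
      (f := u') (f' := fun r => Q r • u r) (C := M)
      (fun x hx => (hu' x hx.1).hasDerivWithinAt) (fun x hx => by
        rw [norm_smul]
        have := hM x (Ioo_subset_Icc_self hx)
        calc _ ≤ M * 1 := mul_le_mul this (hδu x hx) (norm_nonneg _) ((norm_nonneg _).trans this)
          _ = M := mul_one M) hmid hr
    have hM0 : 0 ≤ M := (norm_nonneg _).trans (hM 0 ⟨le_rfl, hδ.le⟩)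
    have h2 : ‖r - δ / 2‖ ≤ δ := by
      rw [Real.norm_eq_abs, abs_le]
      constructor <;> linarith [hr.1, hr.2]
    have h3 := norm_le_insert' (u' r) (u' (δ / 2))
    have h4 : M * ‖r - δ / 2‖ ≤ M * δ := by gcongr
    simp only [mem_ofPred_eq]
    linarith
  -- The Wronskian is constant with limit `0` at the origin, so it vanishes and the Cauchy data of
  -- `u` and `w` at `1` are proportional.
  let W : ℝ → ℂ := fun r => u r * w' r - u' r * w r
  have hWd : ∀ r > 0, HasDerivAt W 0 r := fun r hr => by
    have := ((hu r hr).mul (hwc' r)).sub ((hu' r hr).mul (hwc r))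
    convert! this using 1
    simp only [Complex.real_smul]
    push_cast
    ring
  have hWc : ∀ r > 0, W r = W 1 := fun r hr => by
    have := (convex_Ioi (0 : ℝ)).norm_image_sub_le_of_norm_hasDerivWithin_le
      (f := W) (f' := fun _ => 0) (C := 0) (fun x hx => (hWd x hx).hasDerivWithinAt)
      (fun x _ => by simp) (mem_Ioi.2 one_pos) hr
    rw [zero_mul] at this
    exact sub_eq_zero.1 (norm_le_zero_iff.1 this)
  have hwlim : Tendsto (fun r => (w r : ℂ)) (𝓝[>] 0) (𝓝 0) := by
    have := (hwc 0).continuousAt.tendsto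
    rw [hw0, Complex.ofReal_zero] at this
    exact this.mono_left nhdsWithin_le_nhds
  have hwlim' : Tendsto (fun r => (w' r : ℂ)) (𝓝[>] 0) (𝓝 (w' 0)) :=
    (hwc' 0).continuousAt.tendsto.mono_left nhdsWithin_le_nhds
  have hWlim : Tendsto W (𝓝[>] 0) (𝓝 0) := by
    have t1 := hlim.mul hwlim'
    have t2 : Tendsto (fun r => u' r * w r) (𝓝[>] 0) (𝓝 0) := by
      have t3 := hwlim.norm.const_mul C
      rw [norm_zero, mul_zero] at t3
      refine squeeze_zero_norm' ?_ t3
      filter_upwards [hC] with r hr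
      rw [norm_mul]
      gcongr
    simpa using t1.sub t2
  have hW1 : W 1 = 0 := by
    refine tendsto_nhds_unique ?_ hWlim
    refine (tendsto_const_nhds).congr' ?_
    filter_upwards [self_mem_nhdsWithin] with r hr
    exact (hWc r hr).symm
  have hne : w 1 ≠ 0 ∨ w' 1 ≠ 0 := by
    by_contra hcon
    push Not at hcon
    have hz := second_order_eq_zero_on (c := -1) (fun t _ => hw t) (fun t _ => hw' t)
      hQ.continuousOn (by norm_num : (-1 : ℝ) < 1) hcon.1 hcon.2
    have hev : w =ᶠ[𝓝 0] fun _ => 0 := by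
      filter_upwards [Ioi_mem_nhds (by norm_num : (-1 : ℝ) < 0)] with t ht
      exact hz t ht
    exact hw1 ((hw 0).unique ((hasDerivAt_const (0 : ℝ) (0 : ℝ)).congr_of_eventuallyEq hev))
  obtain ⟨A, hA1, hA2⟩ : ∃ A : ℂ, u 1 = A * w 1 ∧ u' 1 = A * w' 1 := by
    have hW1' : u 1 * w' 1 = u' 1 * w 1 := sub_eq_zero.1 hW1
    by_cases h : w 1 = 0
    · have h' : (w' 1 : ℂ) ≠ 0 := by
        have := hne.resolve_left (not_not.2 h)
        exact_mod_cast this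
      refine ⟨u' 1 / w' 1, ?_, by field_simp⟩
      rw [h, Complex.ofReal_zero, mul_zero] at hW1' ⊢
      exact (mul_eq_zero.1 hW1').resolve_right h'
    · have h' : (w 1 : ℂ) ≠ 0 := by exact_mod_cast h
      refine ⟨u 1 / w 1, by field_simp, ?_⟩
      field_simp
      exact hW1'.symm
  refine ⟨A, fun r hr => ?_⟩
  refine sub_eq_zero.1 (second_order_eq_zero_on (f := fun r => u r - A * w r)
    (f' := fun r => u' r - A * w' r) (q := Q) (c := 0) (t₀ := 1)
    (fun t ht => (hu t ht).sub ((hwc t).const_mul A)) (fun t ht => ?_) hQ.continuousOn one_pos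
    (sub_eq_zero.2 hA1) (sub_eq_zero.2 hA2) r hr)
  convert! (hu' t ht).sub ((hwc' t).const_mul A) using 1
  simp only [Complex.real_smul]
  push_cast
  ring

/-! ### The outer solution -/

/-- The decaying solution `√r K_{iβ}(l r)` of the outer equation. -/
noncomputable def outerSol (β l r : ℝ) : ℝ := Real.sqrt r * macdonaldK β (l * r)

/-- The derivative of `outerSol`. -/
noncomputable def outerSolDeriv (β l r : ℝ) : ℝ :=
  (macdonaldK β (l * r) - 2 * (l * r) * macdonaldMoment 1 β (l * r)) / (2 * Real.sqrt r)

theorem hasDerivAt_outerSol (β : ℝ) {l r : ℝ} (hl : 0 < l) (hr : 0 < r) :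
    HasDerivAt (outerSol β l) (outerSolDeriv β l r) r := by
  have h1 := Real.hasDerivAt_sqrt hr.ne'
  have h2 := (hasDerivAt_macdonaldK β (mul_pos hl hr)).comp r ((hasDerivAt_id r).const_mul l)
  convert! h1.mul h2 using 1
  have hs := Real.sqrt_pos.2 hr
  have hs2 := Real.sq_sqrt hr.le
  simp only [outerSolDeriv, Function.comp_apply]
  field_simp
  linear_combination 2 * l * macdonaldMoment 1 β (l * r) * hs2

theorem hasDerivAt_outerSolDeriv (β : ℝ) {l r : ℝ} (hl : 0 < l) (hr : 0 < r) :
    HasDerivAt (outerSolDeriv β l) ((-(β ^ 2 + 1 / 4) / r ^ 2 + l ^ 2) * outerSol β l r) r := by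
  have hlr := mul_pos hl hr
  have h1 := Real.hasDerivAt_sqrt hr.ne'
  have hi := (hasDerivAt_id r).const_mul l
  have h2 := (hasDerivAt_macdonaldK β hlr).comp r hi
  have h3 := (hasDerivAt_macdonaldMoment 1 β hlr).comp r hi
  have hs := Real.sqrt_pos.2 hr
  have hs2 := Real.sq_sqrt hr.le
  have h := (h2.sub ((hi.const_mul 2).mul h3)).div (h1.const_mul 2) (by positivity)
  convert! h using 1
  have hb := macdonaldMoment_bessel β hlr
  simp only [outerSol, Function.comp_apply, id, Pi.sub_apply, Pi.mul_apply, Nat.reduceAdd]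
  generalize macdonaldK β (l * r) = k₀ at hb ⊢
  generalize macdonaldMoment 1 β (l * r) = k₁ at hb ⊢
  generalize macdonaldMoment 2 β (l * r) = k₂ at hb ⊢
  set s := Real.sqrt r
  rw [← hs2] at hb ⊢
  field_simp
  linear_combination (-16 : ℝ) * hb

/-- Half of the decay rate `l` is given up to absorb the polynomial factors in `r`, through `r e^{-l
r/2} ≤ 2 / l`. -/
theorem exists_outerSol_le_exp (β : ℝ) {l r₀ : ℝ} (hl : 0 < l) (hr₀ : 0 < r₀) :
    ∃ C, ∀ r, r₀ ≤ r → |outerSol β l r| ≤ C * Real.exp (-(l / 2) * r) ∧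
      |outerSolDeriv β l r| ≤ C * Real.exp (-(l / 2) * r) := by
  obtain ⟨C₀, hC₀, h0⟩ := exists_macdonaldMoment_le_exp 0 β (mul_pos hl hr₀)
  obtain ⟨C₁, hC₁, h1⟩ := exists_macdonaldMoment_le_exp 1 β (mul_pos hl hr₀)
  rw [macdonaldMoment_zero] at h0
  have hs₀ := Real.sqrt_pos.2 hr₀
  have hlin : ∀ r, l / 2 * r ≤ Real.exp (l / 2 * r) := fun r => by
    have := Real.add_one_le_exp (l / 2 * r)
    linarith
  have hexp : ∀ r, Real.exp (-(l * r)) = Real.exp (-(l / 2) * r) * Real.exp (-(l / 2) * r) :=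
    fun r => by rw [← Real.exp_add]; ring_nf
  have hone : ∀ r, Real.exp (l / 2 * r) * Real.exp (-(l / 2) * r) = 1 :=
    fun r => by rw [← Real.exp_add, neg_mul, add_neg_cancel, Real.exp_zero]
  refine ⟨max ((1 + 2 / l) * C₀) ((C₀ + 4 * C₁) / (2 * Real.sqrt r₀)), fun r hr => ?_⟩
  have hr0 : 0 < r := hr₀.trans_le hr
  have hlr : l * r₀ ≤ l * r := by gcongr
  have hk0 := h0 (l * r) hlr
  have hk1 := h1 (l * r) hlr
  rw [hexp] at hk0 hk1
  have hE1 : Real.exp (-(l / 2) * r) ≤ 1 := Real.exp_le_one_iff.2 (by nlinarith)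
  have hE0 := Real.exp_pos (-(l / 2) * r)
  have hrE : r * Real.exp (-(l / 2) * r) ≤ 2 / l := by
    have := mul_le_mul_of_nonneg_right (hlin r) hE0.le
    rw [hone] at this
    rw [le_div_iff₀ hl]
    linarith
  set e := Real.exp (-(l / 2) * r)
  have hsr : Real.sqrt r ≤ 1 + r := by
    have := Real.sq_sqrt hr0.le
    nlinarith [sq_nonneg (Real.sqrt r - 1)]
  constructor
  · calc |outerSol β l r| = Real.sqrt r * |macdonaldK β (l * r)| := by
          rw [outerSol, abs_mul, abs_of_nonneg (Real.sqrt_nonneg r)]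
      _ ≤ (1 + r) * (C₀ * (e * e)) := by gcongr
      _ = (e + r * e) * C₀ * e := by ring
      _ ≤ (1 + 2 / l) * C₀ * e := by gcongr
      _ ≤ _ := by gcongr; exact le_max_left _ _
  · calc |outerSolDeriv β l r|
        = |macdonaldK β (l * r) - 2 * (l * r) * macdonaldMoment 1 β (l * r)|
          / (2 * Real.sqrt r) := by
          rw [outerSolDeriv, abs_div, abs_of_nonneg (by positivity : 0 ≤ 2 * Real.sqrt r)]
      _ ≤ (|macdonaldK β (l * r)| + |2 * (l * r) * macdonaldMoment 1 β (l * r)|)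
          / (2 * Real.sqrt r) := by
          gcongr
          exact abs_sub _ _
      _ = (|macdonaldK β (l * r)| + 2 * (l * r) * |macdonaldMoment 1 β (l * r)|)
          / (2 * Real.sqrt r) := by
          rw [abs_mul, abs_of_pos (by positivity : 0 < 2 * (l * r))]
      _ ≤ (C₀ * (e * e) + 2 * (l * r) * (C₁ * (e * e))) / (2 * Real.sqrt r₀) := by gcongr
      _ = (C₀ * e + 2 * l * (r * e) * C₁) * e / (2 * Real.sqrt r₀) := by ring
      _ ≤ (C₀ * 1 + 2 * l * (2 / l) * C₁) * e / (2 * Real.sqrt r₀) := by gcongr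
      _ = (C₀ + 4 * C₁) / (2 * Real.sqrt r₀) * e := by field_simp; ring
      _ ≤ _ := by gcongr; exact le_max_right _ _

/-- The outer solution and its derivative have no common zero. -/
theorem outerSol_ne_zero_or (β : ℝ) {l r₀ : ℝ} (hl : 0 < l) (hr₀ : 0 < r₀) :
    outerSol β l r₀ ≠ 0 ∨ outerSolDeriv β l r₀ ≠ 0 := by
  by_contra hcon
  push Not at hcon
  have hq : ContinuousOn (fun r : ℝ => -(β ^ 2 + 1 / 4) / r ^ 2 + l ^ 2) (Ioi 0) := by
    refine ContinuousOn.add (ContinuousOn.div (by fun_prop) (by fun_prop) fun x hx => ?_)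
      continuousOn_const
    exact pow_ne_zero 2 (ne_of_gt hx)
  have hz := second_order_eq_zero_on (c := 0) (fun t ht => hasDerivAt_outerSol β hl ht)
    (fun t ht => hasDerivAt_outerSolDeriv β hl ht) hq hr₀ hcon.1 hcon.2
  have hz' : ∀ t > 0, outerSolDeriv β l t = 0 := fun t ht =>
    (hasDerivAt_outerSol β hl ht).unique ((hasDerivAt_const t (0 : ℝ)).congr_of_eventuallyEq
      (by filter_upwards [Ioi_mem_nhds ht] with s hs using hz s hs))
  have hg := gammaNorm_pos β
  -- A common zero would make `K` and its first moment vanish identically; since `|sin| + |cos| ≥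
  -- 1`, the asymptotics at `x` would then give `|Γ(1+iβ)| ≤ 4 x`.
  obtain ⟨x, hx, hxg⟩ : ∃ x : ℝ, 0 < x ∧ 4 * x < gammaNorm β :=
    ⟨gammaNorm β / 8, by positivity, by linarith⟩
  have hr : 0 < x / l := by positivity
  have hlx : l * (x / l) = x := by field_simp
  have hK : macdonaldK β x = 0 := by
    have := hz (x / l) hr
    rw [outerSol, hlx] at this
    exact (mul_eq_zero.1 this).resolve_left (Real.sqrt_pos.2 hr).ne'
  have hM : macdonaldMoment 1 β x = 0 := by
    have := hz' (x / l) hr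
    rw [outerSolDeriv, hlx, hK, div_eq_zero_iff] at this
    have h2 := this.resolve_right (mul_pos two_pos (Real.sqrt_pos.2 hr)).ne'
    rw [zero_sub, neg_eq_zero, mul_eq_zero] at h2
    exact h2.resolve_left (by positivity)
  have h1 := abs_macdonaldK_sub_sin_le β hx
  have h2 := abs_macdonaldMoment_one_sub_cos_le β hx
  rw [hK, mul_zero, zero_sub, abs_neg, abs_mul, abs_of_pos hg] at h1
  rw [hM, mul_zero, zero_sub, abs_neg, abs_mul, abs_of_pos hg] at h2
  have h3 : 1 ≤ |Real.sin (macdonaldPhase β x)| + |Real.cos (macdonaldPhase β x)| := by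
    have h4 := Real.sin_sq_add_cos_sq (macdonaldPhase β x)
    rw [← sq_abs, ← sq_abs (Real.cos _)] at h4
    have h5 := Real.abs_sin_le_one (macdonaldPhase β x)
    have h6 := Real.abs_cos_le_one (macdonaldPhase β x)
    nlinarith [abs_nonneg (Real.sin (macdonaldPhase β x)),
      abs_nonneg (Real.cos (macdonaldPhase β x))]
  nlinarith

/-! ### The regular solution -/

/-- `w` is the global solution of `w'' = (q + l²) w`, `w(0) = 0`, `w'(0) = c`. -/
structure IsRegularSolution (q : ℝ → ℝ) (l c : ℝ) (w w' : ℝ → ℝ) : Prop where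
  hasDerivAt : ∀ r, HasDerivAt w (w' r) r
  hasDerivAt' : ∀ r, HasDerivAt w' ((q r + l ^ 2) * w r) r
  zero : w 0 = 0
  deriv_zero : w' 0 = c

section Regular

variable {q w w' : ℝ → ℝ} {l c : ℝ}

theorem exists_isRegularSolution (hq : Continuous q) {M : ℝ} (hM : ∀ r, |q r| ≤ M) (l c : ℝ) :
    ∃ w w', IsRegularSolution q l c w w' := by
  obtain ⟨w, w', h1, h2, h3, h4⟩ := exists_second_order_solution (q := fun r => q r + l ^ 2)
    (M := M + l ^ 2) (by fun_prop) (fun r => (abs_add_le _ _).trans (by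
      rw [abs_of_nonneg (sq_nonneg l)]
      linarith [hM r])) 0 c
  exact ⟨w, w', h3, h4, h1, h2⟩

theorem IsRegularSolution.const_mul (h : IsRegularSolution q l c w w') (b : ℝ) :
    IsRegularSolution q l (b * c) (fun r => b * w r) (fun r => b * w' r) where
  hasDerivAt r := (h.hasDerivAt r).const_mul b
  hasDerivAt' r := by
    convert! (h.hasDerivAt' r).const_mul b using 1
    ring
  zero := by rw [h.zero, mul_zero]
  deriv_zero := by rw [h.deriv_zero]

theorem IsRegularSolution.continuous (h : IsRegularSolution q l c w w') : Continuous w :=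
  continuous_iff_continuousAt.2 fun r => (h.hasDerivAt r).continuousAt

theorem IsRegularSolution.continuous' (h : IsRegularSolution q l c w w') : Continuous w' :=
  continuous_iff_continuousAt.2 fun r => (h.hasDerivAt' r).continuousAt

theorem IsRegularSolution.ne_zero_or (h : IsRegularSolution q l c w w') (hq : Continuous q)
    (hc : c ≠ 0) (r : ℝ) : w r ≠ 0 ∨ w' r ≠ 0 := by
  by_contra hcon
  push Not at hcon
  have hlt : min r 0 - 1 < r := by linarith [min_le_left r 0]
  have hlt0 : min r 0 - 1 < 0 := by linarith [min_le_right r 0]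
  have hz := second_order_eq_zero_on (q := fun r => q r + l ^ 2) (fun t _ => h.hasDerivAt t)
    (fun t _ => h.hasDerivAt' t) (by fun_prop) hlt hcon.1 hcon.2
  have hev : w =ᶠ[𝓝 0] fun _ => 0 := by
    filter_upwards [Ioi_mem_nhds hlt0] with t ht using hz t ht
  apply hc
  rw [← h.deriv_zero]
  exact (h.hasDerivAt 0).unique ((hasDerivAt_const (0 : ℝ) (0 : ℝ)).congr_of_eventuallyEq hev)

theorem IsRegularSolution.tendsto_div (h : IsRegularSolution q l c w w') :
    Tendsto (fun r => w r / r) (𝓝[>] 0) (𝓝 c) := by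
  have := (hasDerivAt_iff_tendsto_slope.1 (h.hasDerivAt 0)).mono_left
    (nhdsWithin_mono 0 fun r (hr : 0 < r) => ne_of_gt hr)
  rw [h.deriv_zero] at this
  refine this.congr fun r => ?_
  rw [slope_def_field, h.zero, sub_zero, sub_zero]

theorem IsRegularSolution.exists_pos_ne_zero (h : IsRegularSolution q l c w w') (hc : c ≠ 0) :
    ∃ r, 0 < r ∧ w r ≠ 0 := by
  obtain ⟨r, hr, hr0⟩ := ((h.tendsto_div.eventually_ne hc).and self_mem_nhdsWithin).exists
  exact ⟨r, hr0, fun h0 => hr (by rw [h0, zero_div])⟩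

theorem IsRegularSolution.derivWithin (h : IsRegularSolution q l c w w') {r₀ r : ℝ} (hr₀ : 0 < r₀)
    (hr : r ∈ Icc 0 r₀) : derivWithin w (Icc 0 r₀) r = w' r :=
  (h.hasDerivAt r).hasDerivWithinAt.derivWithin (uniqueDiffOn_Icc hr₀ r hr)

theorem IsRegularSolution.isInnerSolution (h : IsRegularSolution q l c w w') (hq : Continuous q)
    {v : ℝ → ℝ} {r₀ : ℝ} (hr₀ : 0 < r₀) (hv : EqOn q v (Ioc 0 r₀)) :
    IsInnerSolution v r₀ c l w := by
  have hd : deriv w = w' := funext fun r => (h.hasDerivAt r).deriv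
  have hd' : deriv w' = fun r => (q r + l ^ 2) * w r := funext fun r => (h.hasDerivAt' r).deriv
  have hw' : ContDiff ℝ 1 w' := by
    rw [contDiff_one_iff_deriv, hd']
    have := h.continuous
    exact ⟨fun r => (h.hasDerivAt' r).differentiableAt, by fun_prop⟩
  have hw : ContDiff ℝ 2 w := by
    rw [show (2 : WithTop ℕ∞) = 1 + 1 from (one_add_one_eq_two).symm, contDiff_succ_iff_deriv, hd]
    exact ⟨fun r => (h.hasDerivAt r).differentiableAt, by simp, hw'⟩
  refine ⟨hw.contDiffOn, fun r hr => ?_, h.zero, ?_⟩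
  · rw [iteratedDerivWithin_eq_iteratedDeriv (uniqueDiffOn_Icc hr₀) hw.contDiffAt
      (Ioc_subset_Icc_self hr), iteratedDeriv_succ, iteratedDeriv_one, hd, hd', ← hv hr]
  · rw [h.derivWithin hr₀ ⟨le_rfl, hr₀.le⟩, h.deriv_zero]

/-- Lipschitz dependence of the regular solution on `l²`. -/
theorem exists_regularSolution_lipschitz (hq : Continuous q) {r₀ L : ℝ} (hr₀ : 0 < r₀)
    {w w' : ℝ → ℝ → ℝ} (h : ∀ l, IsRegularSolution q l 1 (w l) (w' l)) :
    ∃ C, 0 ≤ C ∧ ∀ l ∈ Icc 0 L, ∀ m ∈ Icc 0 L,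
      |w l r₀ - w m r₀| ≤ C * |l ^ 2 - m ^ 2| ∧ |w' l r₀ - w' m r₀| ≤ C * |l ^ 2 - m ^ 2| := by
  obtain ⟨M, hM⟩ := isCompact_Icc.exists_bound_of_continuousOn (hq.continuousOn (s := Icc 0 r₀))
  have hM0 : 0 ≤ M := (norm_nonneg _).trans (hM 0 ⟨le_rfl, hr₀.le⟩)
  set K := max 1 (M + L ^ 2)
  have hK : 1 ≤ K := le_max_left _ _
  have hK0 : 0 < K := by linarith
  have hmem : r₀ ∈ Icc 0 r₀ := ⟨hr₀.le, le_rfl⟩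
  have hQ : ∀ l ∈ Icc 0 L, ∀ t ∈ Icc 0 r₀, |q t + l ^ 2| ≤ K := fun l hl t ht => by
    have h1 := hM t ht
    rw [Real.norm_eq_abs] at h1
    have h2 : l ^ 2 ≤ L ^ 2 := pow_le_pow_left₀ hl.1 hl.2 2
    refine (abs_add_le _ _).trans ((le_trans ?_ (le_max_right _ _)))
    rw [abs_of_nonneg (sq_nonneg l)]
    linarith
  have hB : ∀ l ∈ Icc 0 L, ∀ t ∈ Icc 0 r₀, |w l t| ≤ Real.exp (K * r₀) := fun l hl t ht => by
    have h1 := (second_order_gronwall (f := w l) (f' := w' l) (g := 0) (δ := 1)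
      (q := fun t => q t + l ^ 2) hK le_rfl
      (fun t _ => (h l).hasDerivAt t) (fun t _ => by simpa using (h l).hasDerivAt' t)
      (hQ l hl) (by simp) (by simp [(h l).zero]) (by simp [(h l).deriv_zero]) t ht).1
    rw [gronwallBound_ε0, one_mul, sub_zero] at h1
    refine h1.trans ?_
    gcongr
    exact ht.2
  refine ⟨Real.exp (K * r₀) / K * (Real.exp (K * r₀) - 1), ?_, fun l hl m hm => ?_⟩
  · have : 1 ≤ Real.exp (K * r₀) := Real.one_le_exp (by positivity)
    have := Real.exp_pos (K * r₀)
    have : 0 ≤ Real.exp (K * r₀) - 1 := by linarith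
    positivity
  -- The difference of two solutions has zero Cauchy data at `0` and source `(l² - m²) w_m`, with
  -- `w_m` bounded by `e^{K r₀}`.
  · have h1 := second_order_gronwall (f := fun t => w l t - w m t) (f' := fun t => w' l t - w' m t)
      (g := fun t => (l ^ 2 - m ^ 2) * w m t) (q := fun t => q t + l ^ 2)
      (δ := 0) (ε := |l ^ 2 - m ^ 2| * Real.exp (K * r₀)) hK
      (by positivity) (fun t _ => ((h l).hasDerivAt t).sub ((h m).hasDerivAt t))
      (fun t _ => by
        convert! ((h l).hasDerivAt' t).sub ((h m).hasDerivAt' t) using 1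
        simp only [smul_eq_mul]
        ring)
      (hQ l hl) (fun t ht => by
        rw [norm_mul]
        exact mul_le_mul_of_nonneg_left (hB m hm t ht) (abs_nonneg _))
      (by simp [(h l).zero, (h m).zero]) (by simp [(h l).deriv_zero, (h m).deriv_zero]) r₀ hmem
    have h2 : gronwallBound 0 K (|l ^ 2 - m ^ 2| * Real.exp (K * r₀)) (r₀ - 0)
        = Real.exp (K * r₀) / K * (Real.exp (K * r₀) - 1) * |l ^ 2 - m ^ 2| := by
      rw [gronwallBound_of_K_ne_0 hK0.ne', sub_zero]
      ring
    rw [h2] at h1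
    exact h1

/-! ### Matching -/

theorem innerRatio_eq (β : ℝ) {r₀ : ℝ} (hr₀ : 0 < r₀) (hl : 0 < l)
    (h : IsRegularSolution q l c w w') :
    innerRatio β r₀ l w = if w r₀ ≠ 0 then Real.sqrt r₀ / w r₀ * macdonaldK β (l * r₀) else
      (macdonaldK β (l * r₀) + 2 * l * r₀ * -macdonaldMoment 1 β (l * r₀)) /
        (2 * Real.sqrt r₀ * w' r₀) := by
  rw [innerRatio, h.derivWithin hr₀ ⟨hr₀.le, le_rfl⟩, deriv_macdonaldK β (mul_pos hl hr₀)]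

theorem matchDet_eq (β : ℝ) {r₀ : ℝ} (hr₀ : 0 < r₀) (hl : 0 < l)
    (h : IsRegularSolution q l c w w') :
    matchDet β r₀ l w = (w r₀ / 2 - r₀ * w' r₀) * macdonaldK β (l * r₀)
      - w r₀ * (l * r₀ * macdonaldMoment 1 β (l * r₀)) := by
  rw [matchDet, h.derivWithin hr₀ ⟨hr₀.le, le_rfl⟩, deriv_macdonaldK β (mul_pos hl hr₀)]
  ring

variable {β r₀ : ℝ}

/-- A vanishing determinant means that the Cauchy data of the inner and outer solutions at `r₀` are
parallel. The factor is read off from whichever of `w r₀`, `w' r₀` is nonzero. -/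
theorem innerRatio_mul (hr₀ : 0 < r₀) (hl : 0 < l) (hc : c ≠ 0) (hq : Continuous q)
    (h : IsRegularSolution q l c w w') (hdet : matchDet β r₀ l w = 0) :
    innerRatio β r₀ l w * w r₀ = outerSol β l r₀ ∧
      innerRatio β r₀ l w * w' r₀ = outerSolDeriv β l r₀ := by
  rw [matchDet_eq β hr₀ hl h] at hdet
  rw [innerRatio_eq β hr₀ hl h, outerSol, outerSolDeriv]
  have hs := Real.sqrt_pos.2 hr₀
  have hs2 := Real.sq_sqrt hr₀.le
  by_cases hw : w r₀ = 0
  · have hw' := (h.ne_zero_or hq hc r₀).resolve_left (not_not.2 hw)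
    rw [if_neg (not_not.2 hw)]
    -- If `w r₀ = 0` then `w' r₀ ≠ 0`, and the determinant reduces to `-r₀ w'(r₀) K(l r₀)`.
    have hK : macdonaldK β (l * r₀) = 0 := by
      rw [hw] at hdet
      have : -(r₀ * w' r₀) * macdonaldK β (l * r₀) = 0 := by linear_combination hdet
      exact (mul_eq_zero.1 this).resolve_left (neg_ne_zero.2 (mul_ne_zero hr₀.ne' hw'))
    refine ⟨by rw [hw, hK, mul_zero, mul_zero], ?_⟩
    field_simp
    ring
  · rw [if_pos hw]
    refine ⟨by field_simp, ?_⟩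
    field_simp
    linear_combination 2 * w' r₀ * macdonaldK β (l * r₀) * hs2 - 2 * hdet

theorem innerRatio_ne_zero (hr₀ : 0 < r₀) (hl : 0 < l) (hc : c ≠ 0) (hq : Continuous q)
    (h : IsRegularSolution q l c w w') (hdet : matchDet β r₀ l w = 0) :
    innerRatio β r₀ l w ≠ 0 := by
  intro h0
  obtain ⟨h1, h2⟩ := innerRatio_mul hr₀ hl hc hq h hdet
  rw [h0, zero_mul] at h1 h2
  rcases outerSol_ne_zero_or β hl hr₀ with h3 | h3
  · exact h3 h1.symm
  · exact h3 h2.symm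

theorem innerRatio_mul_eq_outerSol (hr₀ : 0 < r₀) (hl : 0 < l) (hc : c ≠ 0) (hq : Continuous q)
    (hqo : ∀ r, r₀ ≤ r → q r = -(β ^ 2 + 1 / 4) / r ^ 2)
    (h : IsRegularSolution q l c w w') (hdet : matchDet β r₀ l w = 0) :
    ∀ r, r₀ ≤ r → innerRatio β r₀ l w * w r = outerSol β l r := by
  obtain ⟨h1, h2⟩ := innerRatio_mul hr₀ hl hc hq h hdet
  intro r hr
  have := second_order_eq_zero_right (q := fun r => q r + l ^ 2) (a := r₀) (b := r)
    (f := fun r => innerRatio β r₀ l w * w r - outerSol β l r)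
    (f' := fun r => innerRatio β r₀ l w * w' r - outerSolDeriv β l r)
    (fun t ht => ((h.hasDerivAt t).const_mul _).sub
      (hasDerivAt_outerSol β hl (hr₀.trans_le ht.1)))
    (fun t ht => by
      convert! ((h.hasDerivAt' t).const_mul _).sub
        (hasDerivAt_outerSolDeriv β hl (hr₀.trans_le ht.1)) using 1
      rw [hqo t ht.1, smul_eq_mul]
      ring)
    (by fun_prop) (sub_eq_zero.2 h1) (sub_eq_zero.2 h2) r ⟨hr, le_rfl⟩
  exact sub_eq_zero.1 this

/-- Both pieces are one multiple of the global regular solution, so no regularity across `r₀` has to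
be checked. -/
theorem gluedFunction_eq (hr₀ : 0 < r₀) (hl : 0 < l) (hc : c ≠ 0) (hq : Continuous q)
    (hqo : ∀ r, r₀ ≤ r → q r = -(β ^ 2 + 1 / 4) / r ^ 2)
    (h : IsRegularSolution q l c w w') (hdet : matchDet β r₀ l w = 0) (B : ℂ) (r : ℝ) :
    gluedFunction β r₀ l w B r = innerRatio β r₀ l w * B * w r := by
  rw [gluedFunction]
  split_ifs with hr
  · rfl
  · have := innerRatio_mul_eq_outerSol hr₀ hl hc hq hqo h hdet r (not_le.1 hr).le
    rw [outerSol] at this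
    rw [← this]
    push_cast
    ring

theorem exists_regularSolution_le_exp (hr₀ : 0 < r₀) (hl : 0 < l) (hc : c ≠ 0) (hq : Continuous q)
    (hqo : ∀ r, r₀ ≤ r → q r = -(β ^ 2 + 1 / 4) / r ^ 2)
    (h : IsRegularSolution q l c w w') (hdet : matchDet β r₀ l w = 0) :
    ∃ C, ∀ r, r₀ < r → |w r| ≤ C * Real.exp (-(l / 2) * r) ∧
      |w' r| ≤ C * Real.exp (-(l / 2) * r) := by
  have hρ := innerRatio_ne_zero hr₀ hl hc hq h hdet
  have heq := innerRatio_mul_eq_outerSol hr₀ hl hc hq hqo h hdet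
  obtain ⟨C, hC⟩ := exists_outerSol_le_exp β hl hr₀
  set ρ := innerRatio β r₀ l w
  have hρ0 : 0 < |ρ| := abs_pos.2 hρ
  refine ⟨C / |ρ|, fun r hr => ?_⟩
  have hd : ρ * w' r = outerSolDeriv β l r :=
    ((h.hasDerivAt r).const_mul ρ).unique
      ((hasDerivAt_outerSol β hl (hr₀.trans hr)).congr_of_eventuallyEq (by
        filter_upwards [Ioi_mem_nhds hr] with t ht using heq t (le_of_lt ht)))
  obtain ⟨h1, h2⟩ := hC r hr.le
  rw [← heq r hr.le, abs_mul] at h1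
  rw [← hd, abs_mul] at h2
  rw [div_mul_eq_mul_div, le_div_iff₀ hρ0, le_div_iff₀ hρ0]
  constructor <;> linarith

end Regular

theorem memLp_two_of_le_exp {f : ℝ → ℂ} (hf : Continuous f) {C κ r₀ : ℝ} (hκ : 0 < κ)
    (hb : ∀ r, r₀ < r → ‖f r‖ ≤ C * Real.exp (-κ * r)) :
    MemLp f 2 (volume.restrict (Ioi 0)) := by
  obtain ⟨M, hM⟩ := isCompact_Icc.exists_bound_of_continuousOn (hf.continuousOn (s := Icc 0 r₀))
  -- The enlarged constant extends the exponential bound from `r > r₀` to all `r > 0`.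
  let D := max C (|M| * Real.exp (κ * r₀))
  have hD : ∀ r > 0, ‖f r‖ ≤ D * Real.exp (-κ * r) := fun r hr => by
    rcases lt_or_ge r₀ r with h | h
    · refine (hb r h).trans ?_
      gcongr
      exact le_max_left _ _
    · have h1 := (hM r ⟨hr.le, h⟩).trans (le_abs_self M)
      have h2 : 1 ≤ Real.exp (κ * r₀) * Real.exp (-κ * r) := by
        rw [← Real.exp_add]
        exact Real.one_le_exp (by nlinarith)
      calc ‖f r‖ ≤ |M| * 1 := by linarith
        _ ≤ |M| * (Real.exp (κ * r₀) * Real.exp (-κ * r)) := by gcongr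
        _ = |M| * Real.exp (κ * r₀) * Real.exp (-κ * r) := by ring
        _ ≤ _ := by gcongr; exact le_max_right _ _
  rw [memLp_two_iff_integrable_sq_norm hf.aestronglyMeasurable]
  refine Integrable.mono' ((integrableOn_exp_mul_Ioi (a := -(2 * κ)) (by linarith) 0).const_mul
    (D ^ 2)) (by have := hf.norm.pow 2; exact this.aestronglyMeasurable) ?_
  refine (ae_restrict_iff' measurableSet_Ioi).2 (Eventually.of_forall fun r hr => ?_)
  rw [norm_pow, norm_norm]
  calc ‖f r‖ ^ 2 ≤ (D * Real.exp (-κ * r)) ^ 2 := by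
        gcongr
        exact hD r hr
    _ = D ^ 2 * Real.exp (-(2 * κ) * r) := by
        rw [mul_pow, ← Real.exp_nat_mul]
        congr 2
        push_cast
        ring

/-! ### Eigenfunctions -/

theorem continuousOn_ofReal_div_pow {f : ℝ → ℝ} (hf : Continuous f) (n : ℕ) :
    ContinuousOn (fun r : ℝ => (f r : ℂ) / (r : ℂ) ^ n) (Ioi 0) :=
  ContinuousOn.div (by fun_prop) (by fun_prop) fun r hr =>
    pow_ne_zero n (by exact_mod_cast (ne_of_gt hr))

section Eigen

variable {q V w w' : ℝ → ℝ} {l c μ E : ℝ}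

/-- Finiteness of `ζ` at the origin gives `r ζ → 0`, which singles out the multiples of the regular
solution. -/
theorem IsSWaveEigenfunction.exists_eq_mul (hμ : 0 < μ) (hc : c ≠ 0) (hq : Continuous q)
    (hqV : ∀ r > 0, q r = μ * V r) (h : IsRegularSolution q l c w w') (hE : E = -l ^ 2 / μ)
    {ζ : ℝ → ℂ} (hζ : IsSWaveEigenfunction μ V E ζ) :
    ∃ A : ℂ, A ≠ 0 ∧ ∀ r : ℝ, 0 < r → (r : ℂ) * ζ r = A * w r := by
  obtain ⟨ζ₁, ζ₂, h1, h2, heq⟩ := hζ.equation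
  have hpos : ∀ᵐ r ∂(volume.restrict (Ioi (0 : ℝ))), r ∈ Ioi (0 : ℝ) :=
    ae_restrict_mem measurableSet_Ioi
  have hμE : (μ * E : ℂ) = -(l : ℂ) ^ 2 := by
    rw [hE]
    have : (μ : ℂ) ≠ 0 := by exact_mod_cast hμ.ne'
    push_cast
    field_simp
  obtain ⟨u', hu, hu'⟩ := radial_regularity (Q := fun r => q r + l ^ 2) hζ.continuousOn
    (by fun_prop) h1 h2 (by
      filter_upwards [heq, hpos] with r hr hr0
      rw [hqV r hr0]
      rw [hμE] at hr
      push_cast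
      linear_combination -hr)
  obtain ⟨z, hz⟩ := hζ.finite_at_origin
  have hlim : Tendsto (fun r : ℝ => (r : ℂ) * ζ r) (𝓝[>] 0) (𝓝 0) := by
    have h3 : Tendsto (fun r : ℝ => (r : ℂ)) (𝓝[>] 0) (𝓝 0) := by
      have := Complex.continuous_ofReal.tendsto 0
      rw [Complex.ofReal_zero] at this
      exact this.mono_left nhdsWithin_le_nhds
    simpa using h3.mul hz
  obtain ⟨A, hA⟩ := exists_eq_mul_of_tendsto_zero (Q := fun r => q r + l ^ 2) (by fun_prop) hu hu'
    h.hasDerivAt h.hasDerivAt' h.zero (by rwa [h.deriv_zero]) hlim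
  refine ⟨A, fun hA0 => ?_, hA⟩
  obtain ⟨r, hr, hr0⟩ := hζ.ne_zero
  have := hA r hr
  rw [hA0, zero_mul, mul_eq_zero] at this
  rcases this with h' | h'
  · exact hr.ne' (by exact_mod_cast h')
  · exact hr0 h'

/-- All derivatives are classical: `ζ = A w / r` has limit `A c` at `0`, and boundedness of `q`
transfers the decay of `w` to `w'' = (q + l²) w`, whence `H²`. -/
theorem IsRegularSolution.isSWaveEigenfunction (hμ : 0 < μ) (hl : 0 < l) (hc : c ≠ 0)
    (hq : Continuous q) {M : ℝ} (hM : ∀ r, |q r| ≤ M)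
    (hqV : ∀ r > 0, q r = μ * V r) (h : IsRegularSolution q l c w w') (hE : E = -l ^ 2 / μ)
    (hinf : sInf (V '' Ioi 0) ≤ E) {C κ r₀ : ℝ} (hκ : 0 < κ)
    (hdecay : ∀ r, r₀ < r → |w r| ≤ C * Real.exp (-κ * r) ∧ |w' r| ≤ C * Real.exp (-κ * r))
    {ζ : ℝ → ℂ} {A : ℂ} (hA : A ≠ 0) (hζ : ∀ r : ℝ, 0 < r → (r : ℂ) * ζ r = A * w r) :
    IsSWaveEigenfunction μ V E ζ := by
  have hw := h.continuous
  have hw' := h.continuous'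
  have hwc : ∀ r, HasDerivAt (fun r => (w r : ℂ)) (w' r : ℂ) r := fun r =>
    (h.hasDerivAt r).ofReal_comp
  have hwc' : ∀ r, HasDerivAt (fun r => (w' r : ℂ)) (((q r + l ^ 2) * w r : ℝ) : ℂ) r :=
    fun r => (h.hasDerivAt' r).ofReal_comp
  have hζ' : EqOn (fun r : ℝ => A * ((w r : ℂ) / (r : ℂ) ^ 1)) ζ (Ioi 0) := fun r hr => by
    have hr' : (r : ℂ) ≠ 0 := by exact_mod_cast (ne_of_gt hr)
    have := hζ r hr
    simp only [pow_one]
    field_simp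
    linear_combination -this
  have hζe := hζ'.aeEq_restrict measurableSet_Ioi (μ := volume)
  have huE : EqOn (fun r : ℝ => A * (w r : ℂ)) (fun r : ℝ => (r : ℂ) * ζ r) (Ioi 0) :=
    fun r hr => (hζ r hr).symm
  have hue := huE.aeEq_restrict measurableSet_Ioi (μ := volume)
  have hQw : Continuous fun r => (q r + l ^ 2) * w r := by fun_prop
  have hμE : (μ * E : ℂ) = -(l : ℂ) ^ 2 := by
    rw [hE]
    have : (μ : ℂ) ≠ 0 := by exact_mod_cast hμ.ne'
    push_cast
    field_simp
  have hbd : ∀ f : ℝ → ℝ, Continuous f → (∃ D, ∀ r, r₀ < r → |f r| ≤ D * Real.exp (-κ * r)) →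
      MemLp (fun r => A * (f r : ℂ)) 2 (volume.restrict (Ioi 0)) := by
    rintro f hf ⟨D, hD⟩
    refine memLp_two_of_le_exp (C := ‖A‖ * D) (r₀ := r₀) (by fun_prop) hκ fun r hr => ?_
    rw [norm_mul, Complex.norm_real, mul_assoc]
    exact mul_le_mul_of_nonneg_left (hD r hr) (norm_nonneg A)
  refine ⟨hinf, ?_, ?_, ?_, ?_, ?_, ?_⟩
  · rw [hE]
    exact div_neg_of_neg_of_pos (neg_neg_of_pos (by positivity)) hμ
  · exact ((continuousOn_ofReal_div_pow hw 1).const_mul A).congr hζ'.symm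
  · refine ⟨A * c, ?_⟩
    have h1 := ((Complex.continuous_ofReal.tendsto c).comp h.tendsto_div).const_mul A
    refine h1.congr' ?_
    filter_upwards [self_mem_nhdsWithin] with r hr
    rw [← hζ' hr]
    simp
  · refine ⟨fun r => A * w' r, fun r => A * (((q r + l ^ 2) * w r : ℝ) : ℂ), ?_, ?_, ?_, ?_, ?_⟩
    · refine (isWeakDeriv_of_hasDerivAt (f := fun r : ℝ => A * (w r : ℂ))
        (fun r _ => (hwc r).const_mul A) ?_).congr_ae hue (EventuallyEq.refl _ _)
      exact Continuous.continuousOn (by fun_prop)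
    · refine isWeakDeriv_of_hasDerivAt (fun r _ => (hwc' r).const_mul A) ?_
      exact Continuous.continuousOn (by fun_prop)
    · exact (memLp_congr_ae hue).1 (hbd w hw ⟨C, fun r hr => (hdecay r hr).1⟩)
    · exact hbd w' hw' ⟨C, fun r hr => (hdecay r hr).2⟩
    · refine hbd _ hQw ⟨(M + l ^ 2) * C, fun r hr => ?_⟩
      rw [abs_mul, mul_assoc]
      have h1 : |q r + l ^ 2| ≤ M + l ^ 2 := (abs_add_le _ _).trans (by
        rw [abs_of_nonneg (sq_nonneg l)]
        linarith [hM r])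
      exact mul_le_mul h1 (hdecay r hr).1 (abs_nonneg _) ((abs_nonneg _).trans h1)
  -- The first two derivatives of `A w / r` by the quotient rule, with `w''` replaced through the
  -- equation.
  · let ζ₁ : ℝ → ℂ := fun r => A * ((w' r : ℂ) / (r : ℂ) ^ 1 - (w r : ℂ) / (r : ℂ) ^ 2)
    let ζ₂ : ℝ → ℂ := fun r => A * ((((q r + l ^ 2) * w r : ℝ) : ℂ) / (r : ℂ) ^ 1
      - 2 * ((w' r : ℂ) / (r : ℂ) ^ 2) + 2 * ((w r : ℂ) / (r : ℂ) ^ 3))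
    have hdiv : ∀ (f g : ℝ → ℂ) (n : ℕ) (r : ℝ), 0 < r → HasDerivAt f (g r) r →
        HasDerivAt (fun r : ℝ => f r / (r : ℂ) ^ n)
          (g r / (r : ℂ) ^ n - n * (f r / (r : ℂ) ^ (n + 1))) r := by
      intro f g n r hr hf
      have hr' : (r : ℂ) ≠ 0 := by exact_mod_cast hr.ne'
      have h2 : HasDerivAt (fun r : ℝ => (r : ℂ) ^ n) (n * (r : ℂ) ^ (n - 1) * 1) r :=
        (Complex.ofRealCLM.hasDerivAt (x := r)).pow n
      convert! hf.div h2 (pow_ne_zero n hr') using 1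
      rcases n with _ | n
      · simp
      · rw [Nat.add_sub_cancel]
        field_simp
        ring
    refine ⟨ζ₁, ζ₂, ?_, ?_, ?_⟩
    · refine (isWeakDeriv_of_hasDerivAt (f := fun r : ℝ => A * ((w r : ℂ) / (r : ℂ) ^ 1))
        (g := ζ₁) (fun r hr => ?_) ?_).congr_ae hζe (EventuallyEq.refl _ _)
      · convert! (hdiv _ (fun r => (w' r : ℂ)) 1 r hr (hwc r)).const_mul A using 1
        simp [ζ₁]
      · exact ((continuousOn_ofReal_div_pow hw' 1).sub
          (continuousOn_ofReal_div_pow hw 2)).const_mul A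
    · refine isWeakDeriv_of_hasDerivAt (fun r hr => ?_) ?_
      · convert! ((hdiv _ (fun r => (((q r + l ^ 2) * w r : ℝ) : ℂ)) 1 r hr (hwc' r)).sub
          (hdiv _ (fun r => (w' r : ℂ)) 2 r hr (hwc r))).const_mul A using 1
        simp only [ζ₂]
        push_cast
        ring
      · exact (((continuousOn_ofReal_div_pow hQw 1).sub
          ((continuousOn_ofReal_div_pow hw' 2).const_mul 2)).add
          ((continuousOn_ofReal_div_pow hw 3).const_mul 2)).const_mul A
    · rw [ae_restrict_iff' measurableSet_Ioi]
      refine Eventually.of_forall fun r hr => ?_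
      have hr' : (r : ℂ) ≠ 0 := by exact_mod_cast (ne_of_gt hr)
      have hqr : (q r : ℂ) = μ * V r := by exact_mod_cast hqV r hr
      rw [hμE, ← hqr, ← hζ' hr]
      simp only [ζ₁, ζ₂]
      push_cast
      field_simp
      ring
  · obtain ⟨r, hr, hr0⟩ := h.exists_pos_ne_zero hc
    refine ⟨r, hr, fun h0 => ?_⟩
    have := hζ r hr
    rw [h0, mul_zero] at this
    rcases mul_eq_zero.1 this.symm with h' | h'
    · exact hA h'
    · exact hr0 (by exact_mod_cast h')

end Eigen

/-! ### The matching condition for small spectral parameter -/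

/-- In the variable `x = l r₀`, `β` times the determinant is `a(l) (β K) - (β w_l(r₀)) (x M₁)`, with
`M₁` the first moment. Freezing the coefficients at `l = 0` and replacing the Bessel terms by their
asymptotics leaves Lipschitz remainders only. -/
theorem exists_unique_matching {q : ℝ → ℝ} {β r₀ : ℝ} (hβ : 0 < β) (hr₀ : 0 < r₀)
    (hq : Continuous q) {w w' : ℝ → ℝ → ℝ} (h : ∀ l, IsRegularSolution q l 1 (w l) (w' l)) :
    ∃ n₀ : ℤ, ∃ η : ℤ → ℝ, Tendsto η atTop (𝓝 0) ∧ ∀ n, n₀ ≤ n →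
      let root := fun y : ℝ => unperturbedRoot β r₀
        (matchAngle (coeffA r₀ (w 0)) (coeffB β r₀ (w 0))) n * Real.exp (y / β)
      η n ∈ Ioo (-(Real.pi / 2)) (Real.pi / 2) ∧
      (∀ y ∈ Ioo (-(Real.pi / 2)) (Real.pi / 2),
        matchDet β r₀ (root y) (w (root y)) = 0 ↔ y = η n) ∧
      ∀ y ∈ Ioo (-(Real.pi / 2)) (Real.pi / 2), root y * r₀ ≤ 1 / 2 := by
  let a : ℝ → ℝ := fun l => w l r₀ / 2 - r₀ * w' l r₀
  have ha0 : coeffA r₀ (w 0) = a 0 := by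
    rw [coeffA, (h 0).derivWithin hr₀ ⟨hr₀.le, le_rfl⟩]
  have hb0 : coeffB β r₀ (w 0) = β * w 0 r₀ := rfl
  rw [ha0, hb0]
  have hab : a 0 ≠ 0 ∨ β * w 0 r₀ ≠ 0 := by
    by_cases hw : w 0 r₀ = 0
    · left
      have := ((h 0).ne_zero_or hq one_ne_zero r₀).resolve_left (not_not.2 hw)
      simp only [a, hw]
      simpa using ⟨hr₀.ne', this⟩
    · exact Or.inr (mul_ne_zero hβ.ne' hw)
  -- `l ≤ 1 / r₀` corresponds to `x ≤ 1`.
  obtain ⟨C, hC, hL⟩ := exists_regularSolution_lipschitz (L := 1 / r₀) hq hr₀ h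
  have hdiv : ∀ x ∈ Icc (0 : ℝ) 1, x / r₀ ∈ Icc 0 (1 / r₀) := fun x hx =>
    ⟨div_nonneg hx.1 hr₀.le, div_le_div_of_nonneg_right hx.2 hr₀.le⟩
  have hsq : ∀ x y : ℝ, |(x / r₀) ^ 2 - (y / r₀) ^ 2| = |x ^ 2 - y ^ 2| / r₀ ^ 2 := fun x y => by
    rw [div_pow, div_pow, ← sub_div, abs_div, abs_of_pos (by positivity : 0 < r₀ ^ 2)]
  have hLa : ∀ x ∈ Icc (0 : ℝ) 1, ∀ y ∈ Icc (0 : ℝ) 1,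
      |a (x / r₀) - a (y / r₀)| ≤ (1 / 2 + r₀) * C / r₀ ^ 2 * |x ^ 2 - y ^ 2| := by
    intro x hx y hy
    obtain ⟨h1, h2⟩ := hL _ (hdiv x hx) _ (hdiv y hy)
    rw [hsq] at h1 h2
    have h3 : a (x / r₀) - a (y / r₀) = 1 / 2 * (w (x / r₀) r₀ - w (y / r₀) r₀)
        - r₀ * (w' (x / r₀) r₀ - w' (y / r₀) r₀) := by simp only [a]; ring
    rw [h3]
    refine (abs_sub _ _).trans ?_
    rw [abs_mul, abs_mul, abs_of_pos hr₀, abs_of_pos (by norm_num : (0 : ℝ) < 1 / 2)]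
    calc _ ≤ 1 / 2 * (C * (|x ^ 2 - y ^ 2| / r₀ ^ 2)) + r₀ * (C * (|x ^ 2 - y ^ 2| / r₀ ^ 2)) := by
          gcongr
      _ = _ := by ring
  have hLw : ∀ x ∈ Icc (0 : ℝ) 1, ∀ y ∈ Icc (0 : ℝ) 1,
      |β * w (x / r₀) r₀ - β * w (y / r₀) r₀| ≤ β * C / r₀ ^ 2 * |x ^ 2 - y ^ 2| := by
    intro x hx y hy
    obtain ⟨h1, -⟩ := hL _ (hdiv x hx) _ (hdiv y hy)
    rw [hsq] at h1
    rw [← mul_sub, abs_mul, abs_of_pos hβ]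
    calc _ ≤ β * (C * (|x ^ 2 - y ^ 2| / r₀ ^ 2)) := by gcongr
      _ = _ := by ring
  have h0mem : (0 : ℝ) ∈ Icc (0 : ℝ) 1 := ⟨le_rfl, zero_le_one⟩
  have hg := gammaNorm_pos β
  -- A single constant large enough for both Bessel terms and for `x` times their derivatives.
  have hD : 0 ≤ (β + 1 / β + 1) * (gammaNorm β + 2) := by positivity
  have hDle : gammaNorm β + 2 ≤ (β + 1 / β + 1) * (gammaNorm β + 2) := by
    have : 0 < (β + 1 / β) * (gammaNorm β + 2) := by positivity
    linarith
  have R1 : IsLipschitzRemainder fun x => (a (x / r₀) - a 0) * (β * macdonaldK β x) := by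
    refine IsLipschitzRemainder.mul_log_lipschitz (C := (1 / 2 + r₀) * C / r₀ ^ 2)
      (D := (β + 1 / β + 1) * (gammaNorm β + 2))
      (p' := fun x => β * -macdonaldMoment 1 β x) (by positivity) hD (fun x hx => ?_)
      (fun x hx y hy => ?_) (fun x hx => (abs_mul_macdonaldK_le β hx).trans hDle)
      (fun x hx => (hasDerivAt_macdonaldK β hx.1).const_mul β) (fun x hx => ?_)
    · have := hLa x (Ioc_subset_Icc_self hx) 0 h0mem
      simpa [abs_of_nonneg (sq_nonneg x)] using this
    · rw [sub_sub_sub_cancel_right]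
      exact hLa x (Ioc_subset_Icc_self hx) y (Ioc_subset_Icc_self hy)
    · have h1 := abs_mul_macdonaldMoment_one_le β hx
      have hx0 := hx.1
      rw [abs_mul, abs_of_pos hx0] at h1
      rw [abs_mul, abs_neg, abs_of_pos hβ, le_div_iff₀ hx0]
      calc _ = β * (x * |macdonaldMoment 1 β x|) := by ring
        _ ≤ β * (gammaNorm β + 2) := by gcongr
        _ ≤ _ := by
          gcongr
          have : 0 < 1 / β := by positivity
          linarith
  have R2 : IsLipschitzRemainder fun x =>
      (β * w (x / r₀) r₀ - β * w 0 r₀) * (x * macdonaldMoment 1 β x) := by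
    refine IsLipschitzRemainder.mul_log_lipschitz (C := β * C / r₀ ^ 2)
      (D := (β + 1 / β + 1) * (gammaNorm β + 2))
      (p' := fun x => -(x * macdonaldK β x) + β / x * (β * macdonaldK β x)) (by positivity) hD
      (fun x hx => ?_)
      (fun x hx y hy => ?_) (fun x hx => (abs_mul_macdonaldMoment_one_le β hx).trans hDle)
      (fun x hx => hasDerivAt_mul_macdonaldMoment_one β hx.1) (fun x hx => ?_)
    · have := hLw x (Ioc_subset_Icc_self hx) 0 h0mem
      simpa [abs_of_nonneg (sq_nonneg x)] using this
    · rw [sub_sub_sub_cancel_right]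
      exact hLw x (Ioc_subset_Icc_self hx) y (Ioc_subset_Icc_self hy)
    · have h1 := abs_mul_macdonaldK_le β hx
      have h2 := abs_macdonaldK_le hβ hx
      have hx0 := hx.1
      have hx1 := hx.2
      rw [le_div_iff₀ hx0]
      calc _ ≤ (|-(x * macdonaldK β x)| + |β / x * (β * macdonaldK β x)|) * x := by
            gcongr
            exact abs_add_le _ _
        _ = (x * |macdonaldK β x| + β / x * |β * macdonaldK β x|) * x := by
            rw [abs_neg, abs_mul x, abs_mul (β / x), abs_of_pos (div_pos hβ hx0), abs_of_pos hx0]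
        _ ≤ (1 * ((gammaNorm β + 2) / β) + β / x * (gammaNorm β + 2)) * x := by gcongr
        _ = (gammaNorm β + 2) / β * x + β * (gammaNorm β + 2) := by field_simp
        _ ≤ (gammaNorm β + 2) / β * 1 + β * (gammaNorm β + 2) := by gcongr
        _ = (β + 1 / β + 0) * (gammaNorm β + 2) := by ring
        _ ≤ _ := by gcongr; exact zero_le_one
  -- Two errors from varying `l` in the coefficients, two from the asymptotics with coefficients
  -- frozen at `l = 0`.
  have R := (R1.add (R2.const_mul (-1))).add
    (((isLipschitzRemainder_macdonaldK hβ).const_mul (a 0)).add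
    ((isLipschitzRemainder_macdonaldMoment_one hβ).const_mul (-(β * w 0 r₀))))
  obtain ⟨n₀, η, hη, hn⟩ := exists_unique_scaledRoot hβ hab R
  refine ⟨n₀, η, hη, fun n hn₀ => ?_⟩
  obtain ⟨h1, h2, h3⟩ := hn n hn₀
  refine ⟨h1, fun y hy => ?_, fun y hy => ?_⟩
  · rw [← h2 y hy]
    set α := matchAngle (a 0) (β * w 0 r₀)
    set l := unperturbedRoot β r₀ α n * Real.exp (y / β) with hl
    have hx : l * r₀ = scaledRoot β α n y := unperturbedRoot_mul_exp hr₀.ne' α n y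
    have hx0 := scaledRoot_pos β α n y
    have hl0 : 0 < l := by
      rw [← hx] at hx0
      exact pos_of_mul_pos_left hx0 hr₀.le
    have hxl : scaledRoot β α n y / r₀ = l := by
      rw [← hx]
      field_simp
    rw [matchDet_eq β hr₀ hl0 (h l), hxl, hx]
    rw [← mul_eq_zero_iff_left hβ.ne']
    refine Eq.congr ?_ rfl
    simp only [a]
    ring
  · rw [unperturbedRoot_mul_exp hr₀.ne']
    exact h3 y hy

/-! ### The effective potential -/

/-- `W(e^s)`, the inverse of `x ↦ x + log x`. -/
noncomputable def lambertExp (s : ℝ) : ℝ := lambertW (Real.exp s)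

/-- The function `x e^x` runs from `0` to at least `e^s` on `[0, e^s]`, so the inverse is attained;
taking logarithms of the defining identity gives the sum. -/
theorem lambertExp_spec (s : ℝ) : 0 < lambertExp s ∧ lambertExp s + Real.log (lambertExp s) = s := by
  have hex : ∃ x ∈ Ici (-1 : ℝ), (fun s : ℝ => s * Real.exp s) x = Real.exp s := by
    have hs := Real.exp_pos s
    obtain ⟨x, hx, hxe⟩ := intermediate_value_Icc hs.le
      (f := fun s : ℝ => s * Real.exp s) (by fun_prop)
      (show Real.exp s ∈ Icc _ _ by
        have := Real.one_le_exp hs.le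
        constructor <;> nlinarith)
    exact ⟨x, by have := hx.1; simp only [mem_Ici]; linarith, hxe⟩
  have hw : lambertExp s * Real.exp (lambertExp s) = Real.exp s := Function.invFunOn_eq hex
  have hpos : 0 < lambertExp s := by
    have := Real.exp_pos s
    rw [← hw] at this
    exact pos_of_mul_pos_left this (Real.exp_pos _).le
  refine ⟨hpos, ?_⟩
  have := congrArg Real.log hw
  rw [Real.log_mul hpos.ne' (Real.exp_pos _).ne', Real.log_exp, Real.log_exp] at this
  linarith

/-- The map `x + log x` increases at least as fast as `x`, so its inverse is a contraction in the
weak sense. -/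
theorem abs_lambertExp_sub_le (s t : ℝ) : |lambertExp s - lambertExp t| ≤ |s - t| := by
  obtain ⟨h1, h2⟩ := lambertExp_spec s
  obtain ⟨h3, h4⟩ := lambertExp_spec t
  rcases le_total (lambertExp s) (lambertExp t) with h | h
  · have := Real.log_le_log h1 h
    rw [abs_of_nonpos (by linarith), abs_of_nonpos (by linarith)]
    linarith
  · have := Real.log_le_log h3 h
    rw [abs_of_nonneg (by linarith), abs_of_nonneg (by linarith)]
    linarith

theorem continuous_lambertExp : Continuous lambertExp :=
  (LipschitzWith.of_dist_le_mul (K := 1) fun s t => by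
    simpa [Real.dist_eq] using abs_lambertExp_sub_le s t).continuous

theorem lambertExp_one : lambertExp 1 = 1 := by
  obtain ⟨h1, h2⟩ := lambertExp_spec 1
  rcases lt_trichotomy (lambertExp 1) 1 with h | h | h
  · have := Real.log_neg h1 h
    linarith
  · exact h
  · have := Real.log_pos h
    linarith

theorem hasDerivAt_lambertExp_one : HasDerivAt lambertExp (1 + 1)⁻¹ 1 := by
  refine HasDerivAt.of_local_left_inverse (f := fun x => x + Real.log x)
    continuous_lambertExp.continuousAt ?_ (by norm_num)
    (Eventually.of_forall fun s => (lambertExp_spec s).2)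
  rw [lambertExp_one]
  simpa using! (hasDerivAt_id (1 : ℝ)).add (Real.hasDerivAt_log one_ne_zero)

section Potential

variable {μ ν r₀ : ℝ} {θ : ℝ → ℝ}

theorem continuousOn_potential (hν : 0 < ν) (hθ : ContinuousOn θ (Ici 0)) :
    ContinuousOn (potential ν θ) (Ioi 0) := by
  have hθ' : ContinuousOn θ (Ioi 0) := hθ.mono Ioi_subset_Ici_self
  have h1 : ContinuousOn (fun r => lambertExp (θ r)) (Ioi 0) :=
    continuous_lambertExp.comp_continuousOn hθ'
  refine ContinuousOn.div ((h1.sub hθ').pow 2).neg (by fun_prop) fun r hr => ?_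
  have : (0 : ℝ) < r := hr
  positivity

/-- The function `W(e^θ) - θ` vanishes at `0`, because `W(e) = 1 = θ(0)`; divided by `r` it is a
difference quotient, so the potential has a finite limit. -/
theorem exists_tendsto_potential (hθ : ContDiffOn ℝ ∞ θ (Ici 0)) (hθ0 : θ 0 = 1) :
    ∃ L, Tendsto (potential ν θ) (𝓝[>] 0) (𝓝 L) := by
  have hd := ((hθ.differentiableOn (by simp)) 0 self_mem_Ici).hasDerivWithinAt
  have hW : HasDerivAt lambertExp (1 + 1)⁻¹ (θ 0) := hθ0 ▸ hasDerivAt_lambertExp_one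
  have hH := (hW.comp_hasDerivWithinAt 0 hd).sub hd
  rw [hasDerivWithinAt_iff_tendsto_slope] at hH
  have hH' := hH.mono_left (nhdsWithin_mono 0 (s := Ioi 0) fun r (hr : 0 < r) =>
    (⟨hr.le, ne_of_gt hr⟩ : r ∈ Ici 0 \ {0}))
  refine ⟨_, ((hH'.pow 2).neg.div_const ν).congr' ?_⟩
  filter_upwards [self_mem_nhdsWithin] with r hr
  have hr0 : (0 : ℝ) < r := hr
  rw [slope_def_field]
  simp only [Pi.sub_apply, Function.comp_apply, hθ0, lambertExp_one, sub_self, sub_zero, potential,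
    ← lambertExp.eq_def]
  rw [div_pow, neg_div, neg_div, div_div, mul_comm ν]

theorem betaParam_pos (h : 1 / 4 < μ * lambertW 1 ^ 2 / ν) : 0 < betaParam μ ν :=
  Real.sqrt_pos.2 (by linarith)

theorem potential_outer (hν : 0 < ν) (hr₀ : 0 < r₀) (h : 1 / 4 < μ * lambertW 1 ^ 2 / ν)
    (hθ : ∀ r : ℝ, r₀ ≤ r → θ r = 0) {r : ℝ} (hr : r₀ ≤ r) :
    μ * potential ν θ r = -(betaParam μ ν ^ 2 + 1 / 4) / r ^ 2 := by
  have hr0 := hr₀.trans_le hr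
  rw [betaParam, Real.sq_sqrt (by linarith), potential, hθ r hr, Real.exp_zero]
  field_simp
  ring

/-- The potential on `(0, ∞)` extends to a bounded continuous function on the line. -/
theorem exists_continuous_extension (hν : 0 < ν) (hr₀ : 0 < r₀)
    (h : 1 / 4 < μ * lambertW 1 ^ 2 / ν) (hθ : ContDiffOn ℝ ∞ θ (Ici 0)) (hθ0 : θ 0 = 1)
    (hθr : ∀ r : ℝ, r₀ ≤ r → θ r = 0) :
    ∃ q : ℝ → ℝ, Continuous q ∧ (∃ M, ∀ r, |q r| ≤ M) ∧ ∀ r > 0, q r = μ * potential ν θ r := by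
  obtain ⟨L, hL⟩ := exists_tendsto_potential (ν := ν) hθ hθ0
  have hc := continuousOn_potential hν hθ.continuousOn
  -- Left of the origin the extension is constant; this part only serves to have an equation on the
  -- whole line.
  let q : ℝ → ℝ := fun r => if r ≤ 0 then μ * L else μ * potential ν θ r
  have hqn : ∀ r, r ≤ 0 → q r = μ * L := fun r hr => if_pos hr
  have hqp : ∀ r, 0 < r → q r = μ * potential ν θ r := fun r hr => if_neg (not_le.2 hr)
  have hq : Continuous q := by
    refine continuous_iff_continuousAt.2 fun r => ?_
    rcases lt_trichotomy r 0 with hr | rfl | hr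
    · refine (continuousAt_const (y := μ * L)).congr ?_
      filter_upwards [Iio_mem_nhds hr] with s hs using (hqn s (le_of_lt hs)).symm
    · rw [continuousAt_iff_continuous_left_right]
      constructor
      · exact continuousWithinAt_const.congr (fun s hs => hqn s hs) (hqn 0 le_rfl)
      · rw [← continuousWithinAt_Ioi_iff_Ici]
        have h1 : Tendsto q (𝓝[>] 0) (𝓝 (μ * L)) := by
          refine (hL.const_mul μ).congr' ?_
          filter_upwards [self_mem_nhdsWithin] with s hs using (hqp s hs).symm
        rwa [ContinuousWithinAt, hqn 0 le_rfl]
    · refine ((hc.continuousAt (Ioi_mem_nhds hr)).const_mul μ).congr ?_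
      filter_upwards [Ioi_mem_nhds hr] with s hs using (hqp s hs).symm
  obtain ⟨M, hM⟩ := isCompact_Icc.exists_bound_of_continuousOn (hq.continuousOn (s := Icc 0 r₀))
  refine ⟨q, hq, ⟨max M ((betaParam μ ν ^ 2 + 1 / 4) / r₀ ^ 2), fun r => ?_⟩, hqp⟩
  rcases le_total r 0 with hr | hr
  · rw [hqn r hr, ← hqn 0 le_rfl]
    exact (hM 0 ⟨le_rfl, hr₀.le⟩).trans (le_max_left _ _)
  · rcases le_total r r₀ with hr' | hr'
    · exact (hM r ⟨hr, hr'⟩).trans (le_max_left _ _)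
    · have hr0 := hr₀.trans_le hr'
      rw [hqp r hr0, potential_outer hν hr₀ h hθr hr', neg_div, abs_neg, abs_of_pos (by positivity)]
      refine le_trans ?_ (le_max_right _ _)
      gcongr

end Potential

/-! ### Scaling of the inner solution and the normalised eigenfunction -/

section Scaling

variable {q w w' : ℝ → ℝ} {β r₀ l c : ℝ}

theorem IsRegularSolution.coeffA_eq (h : IsRegularSolution q l c w w') (hr₀ : 0 < r₀) :
    coeffA r₀ w = w r₀ / 2 - r₀ * w' r₀ := by
  rw [coeffA, h.derivWithin hr₀ ⟨hr₀.le, le_rfl⟩]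

/-- The angle depends only on the ratio, hence not on the initial slope of the inner solution. -/
theorem matchAngle_mul {b : ℝ} (hb : b ≠ 0) (x y : ℝ) :
    matchAngle (b * x) (b * y) = matchAngle x y := by
  unfold matchAngle
  by_cases hx : x = 0
  · simp [hx]
  · rw [if_neg (mul_ne_zero hb hx), if_neg hx, mul_div_mul_left _ _ hb]

theorem IsRegularSolution.matchAngle_const_mul (h : IsRegularSolution q l c w w') (hr₀ : 0 < r₀)
    {b : ℝ} (hb : b ≠ 0) :
    matchAngle (coeffA r₀ fun r => b * w r) (coeffB β r₀ fun r => b * w r)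
      = matchAngle (coeffA r₀ w) (coeffB β r₀ w) := by
  rw [(h.const_mul b).coeffA_eq hr₀, h.coeffA_eq hr₀, ← matchAngle_mul hb (w r₀ / 2 - r₀ * w' r₀)]
  congr 1
  · ring
  · simp only [coeffB]
    ring

theorem IsRegularSolution.matchDet_const_mul (h : IsRegularSolution q l c w w') (hr₀ : 0 < r₀)
    (hl : 0 < l) (b : ℝ) : matchDet β r₀ l (fun r => b * w r) = b * matchDet β r₀ l w := by
  rw [matchDet_eq β hr₀ hl (h.const_mul b), matchDet_eq β hr₀ hl h]
  ring

theorem exists_normalisation (h : IsRegularSolution q l c w w') (hc : c ≠ 0)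
    (hL : MemLp (fun r => (w r : ℂ)) 2 (volume.restrict (Ioi 0))) {ρ : ℝ} (hρ : ρ ≠ 0) :
    ∃ B : ℝ, 0 < B ∧ ∫ r in Ioi (0 : ℝ), ‖(ρ : ℂ) * (B : ℂ) * (w r : ℂ)‖ ^ 2 = 1 := by
  have hw := h.continuous
  have hi := (memLp_two_iff_integrable_sq_norm hL.1).1 hL
  have hpos : 0 < ∫ r in Ioi (0 : ℝ), ‖(w r : ℂ)‖ ^ 2 := by
    refine lt_of_le_of_ne (integral_nonneg fun r => by positivity) fun h0 => ?_
    have hz := (integral_eq_zero_iff_of_nonneg (fun r => by positivity) hi).1 h0.symm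
    have he := Measure.eqOn_open_of_ae_eq hz isOpen_Ioi
      (Continuous.continuousOn (by fun_prop)) continuousOn_const
    obtain ⟨r, hr, hr0⟩ := h.exists_pos_ne_zero hc
    have := he hr
    simp at this
    exact hr0 this
  set I := ∫ r in Ioi (0 : ℝ), ‖(w r : ℂ)‖ ^ 2
  have hs := Real.sqrt_pos.2 hpos
  have hs2 := Real.sq_sqrt hpos.le
  have hρ0 : 0 < |ρ| := abs_pos.2 hρ
  refine ⟨1 / (|ρ| * Real.sqrt I), by positivity, ?_⟩
  have : ∀ r, ‖(ρ : ℂ) * ((1 / (|ρ| * Real.sqrt I) : ℝ) : ℂ) * (w r : ℂ)‖ ^ 2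
      = 1 / I * ‖(w r : ℂ)‖ ^ 2 := fun r => by
    rw [norm_mul, norm_mul, Complex.norm_real, Complex.norm_real, Real.norm_eq_abs,
      Real.norm_of_nonneg (by positivity : 0 ≤ 1 / (|ρ| * Real.sqrt I)), mul_pow]
    congr 1
    field_simp
    exact hs2.symm
  simp only [this]
  rw [integral_const_mul]
  exact one_div_mul_cancel hpos.ne'

end Scaling

/-! ### The starting index -/

/-- Stated for arbitrary `v`, `r₀`, `β`, with the hypotheses after the integer, so that choice
yields an index depending on these three alone. The inner potential and the explicit tail determine
`q` on `(0, ∞)`. -/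
theorem exists_start_index (v : ℝ → ℝ) (r₀ β : ℝ) : ∃ n₀ : ℤ, 0 < r₀ → 0 < β →
    (∃ q : ℝ → ℝ, Continuous q ∧ (∃ M, ∀ r, |q r| ≤ M) ∧ EqOn q v (Ioc 0 r₀) ∧
      ∀ r, r₀ ≤ r → q r = -(β ^ 2 + 1 / 4) / r ^ 2) →
    ∃ (q : ℝ → ℝ) (w w' : ℝ → ℝ → ℝ) (η : ℤ → ℝ),
      Continuous q ∧ (∃ M, ∀ r, |q r| ≤ M) ∧ EqOn q v (Ioc 0 r₀) ∧
      (∀ r, r₀ ≤ r → q r = -(β ^ 2 + 1 / 4) / r ^ 2) ∧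
      (∀ l, IsRegularSolution q l 1 (w l) (w' l)) ∧
      Tendsto η atTop (𝓝 0) ∧ ∀ n, n₀ ≤ n →
        let root := fun y : ℝ => unperturbedRoot β r₀
          (matchAngle (coeffA r₀ (w 0)) (coeffB β r₀ (w 0))) n * Real.exp (y / β)
        η n ∈ Ioo (-(Real.pi / 2)) (Real.pi / 2) ∧
        (∀ y ∈ Ioo (-(Real.pi / 2)) (Real.pi / 2),
          matchDet β r₀ (root y) (w (root y)) = 0 ↔ y = η n) ∧
        ∀ y ∈ Ioo (-(Real.pi / 2)) (Real.pi / 2), root y * r₀ ≤ 1 / 2 := by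
  by_cases hgood : 0 < r₀ ∧ 0 < β ∧ ∃ q : ℝ → ℝ, Continuous q ∧ (∃ M, ∀ r, |q r| ≤ M) ∧
      EqOn q v (Ioc 0 r₀) ∧ ∀ r, r₀ ≤ r → q r = -(β ^ 2 + 1 / 4) / r ^ 2
  · obtain ⟨hr₀, hβ, q, hq, ⟨M, hM⟩, hv, ho⟩ := hgood
    choose w w' hw using fun l => exists_isRegularSolution hq hM l 1
    obtain ⟨n₀, η, hη, hn⟩ := exists_unique_matching hβ hr₀ hq hw
    exact ⟨n₀, fun _ _ _ => ⟨q, w, w', η, hq, ⟨M, hM⟩, hv, ho, hw, hη, hn⟩⟩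
  -- Default index for data without a bounded continuous extension.
  · exact ⟨0, fun h1 h2 h3 => absurd ⟨h1, h2, h3⟩ hgood⟩

end BornOppenheimer

/-! ### Assembly of the theorem -/

open BornOppenheimer in
theorem proposition3p2 :
    -- the starting index depends only on `v`, `r₀` and `β`
    ∃ N : (ℝ → ℝ) → ℝ → ℝ → ℤ,
    ∀ (μ ν r₀ : ℝ) (θ : ℝ → ℝ), 0 < μ → 0 < ν → 0 < r₀ →
      1 / 4 < μ * lambertW 1 ^ 2 / ν →
      ContDiffOn ℝ ∞ θ (Ici 0) → θ 0 = 1 → (∀ r : ℝ, r₀ ≤ r → θ r = 0) →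
      let β := betaParam μ ν
      let v := (Ioc 0 r₀).indicator (fun r => μ * potential ν θ r)
      let n₀ := N v r₀ β
      ∃ η E : ℤ → ℝ,
        -- infinitely many distinct negative eigenvalues tending to zero
        (∀ n, n₀ ≤ n → E n < 0 ∧ IsSWaveEigenvalue μ (potential ν θ) (E n)) ∧
        InjOn E (Ici n₀) ∧
        Tendsto E atTop (𝓝 0) ∧
        Tendsto η atTop (𝓝 0) ∧
        ∀ c : ℝ, c ≠ 0 →
          -- the inner solutions
          ∃ w : ℝ → ℝ → ℝ,
            (∀ l, 0 ≤ l → IsInnerSolution v r₀ c l (w l)) ∧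
            ∀ n, n₀ ≤ n →
              let α := matchAngle (coeffA r₀ (w 0)) (coeffB β r₀ (w 0))
              let root := fun y : ℝ => unperturbedRoot β r₀ α n * Real.exp (y / β)
              let l := root (η n)
              -- the number `η n` is the unique solution in `(-π/2, π/2)` of the matching condition
              (η n ∈ Ioo (-(Real.pi / 2)) (Real.pi / 2) ∧ matchDet β r₀ l (w l) = 0 ∧
                ∀ y ∈ Ioo (-(Real.pi / 2)) (Real.pi / 2),
                  matchDet β r₀ (root y) (w (root y)) = 0 → y = η n) ∧
              -- the eigenvalue
              E n = -(4 / (μ * r₀ ^ 2)) * Real.exp (2 / β * (gammaPhase β - α + η n)) *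
                Real.exp (-(2 * Real.pi / β) * n) ∧
              -- the eigenfunctions, written as `u(r) = r ζ(r)`
              (∀ ζ : ℝ → ℂ, IsSWaveEigenfunction μ (potential ν θ) (E n) ζ ↔
                ∃ B : ℂ, B ≠ 0 ∧
                  ∀ r : ℝ, 0 < r → (r : ℂ) * ζ r = gluedFunction β r₀ l (w l) B r) ∧
              -- the normalised one
              ∃ B : ℝ, 0 < B ∧
                (∫ r in Ioi (0 : ℝ), ‖gluedFunction β r₀ l (w l) B r‖ ^ 2) = 1 := by
  choose N hN using exists_start_index
  refine ⟨N, fun μ ν r₀ θ hμ hν hr₀ hlam hθ hθ0 hθr => ?_⟩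
  intro β v n₀
  have hβ : 0 < β := betaParam_pos hlam
  have hv : ∀ r ∈ Ioc 0 r₀, v r = μ * potential ν θ r := fun r hr =>
    indicator_of_mem (f := fun r => μ * potential ν θ r) hr
  obtain ⟨q, w, w', η, hq, ⟨M, hM⟩, hqv, hqo, hw, hη, hn⟩ := hN v r₀ β hr₀ hβ (by
    obtain ⟨q, h1, h2, h3⟩ := exists_continuous_extension hν hr₀ hlam hθ hθ0 hθr
    refine ⟨q, h1, h2, fun r hr => ?_, fun r hr => ?_⟩
    · rw [h3 r hr.1, hv r hr]
    · rw [h3 r (hr₀.trans_le hr)]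
      exact potential_outer hν hr₀ hlam hθr hr)
  have hqV : ∀ r > 0, q r = μ * potential ν θ r := fun r hr => by
    rcases le_total r r₀ with h | h
    · rw [hqv ⟨hr, h⟩, hv r ⟨hr, h⟩]
    · rw [hqo r h, potential_outer hν hr₀ hlam hθr h]
  set α := matchAngle (coeffA r₀ (w 0)) (coeffB β r₀ (w 0)) with hα
  let l : ℤ → ℝ := fun n => unperturbedRoot β r₀ α n * Real.exp (η n / β)
  have hroot : ∀ n y, unperturbedRoot β r₀ α n * Real.exp (y / β) * r₀ = scaledRoot β α n y :=
    fun n y => unperturbedRoot_mul_exp hr₀.ne' α n y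
  have hroot0 : ∀ n y, 0 < unperturbedRoot β r₀ α n * Real.exp (y / β) := fun n y =>
    pos_of_mul_pos_left ((scaledRoot_pos β α n y).trans_eq (hroot n y).symm) hr₀.le
  have hl0 : ∀ n, 0 < l n := fun n => hroot0 n (η n)
  have hlr : ∀ n, l n = scaledRoot β α n (η n) / r₀ := fun n => by
    rw [eq_div_iff hr₀.ne']
    exact hroot n (η n)
  let E : ℤ → ℝ := fun n => -(4 / (μ * r₀ ^ 2)) * Real.exp (2 / β * (gammaPhase β - α + η n)) *
    Real.exp (-(2 * Real.pi / β) * n)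
  have hE : ∀ n, E n = -l n ^ 2 / μ := fun n => by
    have h1 : Real.exp (2 / β * (gammaPhase β - α + η n)) * Real.exp (-(2 * Real.pi / β) * n)
        = (Real.exp ((gammaPhase β - α) / β) * Real.exp (-(n * (Real.pi / β))) *
          Real.exp (η n / β)) ^ 2 := by
      rw [← Real.exp_add, ← Real.exp_add, ← Real.exp_add, ← Real.exp_nat_mul]
      congr 1
      push_cast
      ring
    simp only [E, l, unperturbedRoot]
    rw [mul_assoc, h1]
    field_simp
    ring
  have hEneg : ∀ n, E n < 0 := fun n => by
    rw [hE]
    have := hl0 n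
    exact div_neg_of_neg_of_pos (neg_neg_of_pos (by positivity)) hμ
  have hdet : ∀ n, n₀ ≤ n → matchDet β r₀ (l n) (w (l n)) = 0 := fun n hn₀ =>
    ((hn n hn₀).2.1 (η n) (hn n hn₀).1).2 rfl
  -- The infimum is at most the value at `r₀`, which is `-(β² + 1/4) / (μ r₀²)`; since `l n * r₀ ≤ 1
  -- / 2`, the energy lies above it.
  have hinf : ∀ n, n₀ ≤ n → sInf (potential ν θ '' Ioi 0) ≤ E n := fun n hn₀ => by
    have hbdd : BddBelow (potential ν θ '' Ioi 0) := by
      refine ⟨-M / μ, ?_⟩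
      rintro _ ⟨r, hr, rfl⟩
      have h1 := (abs_le.1 (hM r)).1
      rw [hqV r hr] at h1
      rw [div_le_iff₀ hμ]
      linarith
    refine (csInf_le hbdd ⟨r₀, hr₀, rfl⟩).trans ?_
    have h1 := hqo r₀ le_rfl
    rw [hqV r₀ hr₀] at h1
    have h2 : l n * r₀ ≤ 1 / 2 := (hn n hn₀).2.2 (η n) (hn n hn₀).1
    have h3 : 0 < l n * r₀ := mul_pos (hl0 n) hr₀
    have h4 : l n ^ 2 ≤ (β ^ 2 + 1 / 4) / r₀ ^ 2 := by
      rw [le_div_iff₀ (by positivity)]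
      nlinarith [sq_nonneg β]
    rw [hE, le_div_iff₀ hμ, mul_comm, h1, neg_div]
    linarith
  have hiff : ∀ n, n₀ ≤ n → ∀ c : ℝ, c ≠ 0 → ∀ ζ : ℝ → ℂ,
      IsSWaveEigenfunction μ (potential ν θ) (E n) ζ ↔
        ∃ A : ℂ, A ≠ 0 ∧ ∀ r : ℝ, 0 < r → (r : ℂ) * ζ r = A * ((c * w (l n) r : ℝ) : ℂ) := by
    intro n hn₀ c hc ζ
    have hreg := (hw (l n)).const_mul c
    rw [mul_one] at hreg
    refine ⟨fun h => h.exists_eq_mul hμ hc hq hqV hreg (hE n), fun ⟨A, hA, hζ⟩ => ?_⟩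
    obtain ⟨C, hC⟩ := exists_regularSolution_le_exp (β := β) hr₀ (hl0 n) hc hq hqo hreg (by
      rw [(hw (l n)).matchDet_const_mul hr₀ (hl0 n), hdet n hn₀, mul_zero])
    exact hreg.isSWaveEigenfunction hμ (hl0 n) hc hq hM hqV (hE n) (hinf n hn₀)
      (half_pos (hl0 n)) hC hA hζ
  -- Monotonicity in `y` bounds the points by those with `y = π / 2`.
  have hsmall : Tendsto (fun n => scaledRoot β α n (η n)) atTop (𝓝 0) := by
    refine squeeze_zero' (Eventually.of_forall fun n => (scaledRoot_pos β α n (η n)).le) ?_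
      (tendsto_scaledRoot hβ α (Real.pi / 2))
    filter_upwards [eventually_ge_atTop n₀] with n hn₀
    have := (hn n hn₀).1.2
    unfold scaledRoot
    gcongr
  refine ⟨η, E, fun n hn₀ => ⟨hEneg n, ?_⟩, ?_, ?_, hη, fun c hc => ?_⟩
  · refine ⟨fun r => ((1 * w (l n) r : ℝ) : ℂ) / r, (hiff n hn₀ 1 one_ne_zero _).2
      ⟨1, one_ne_zero, fun r hr => ?_⟩⟩
    have hr' : (r : ℂ) ≠ 0 := by exact_mod_cast hr.ne'
    field_simp
  -- Equal energies give equal phases, so `(n - m) π = η n - η m`, which has absolute value less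
  -- than `π`.
  · intro n hn₀ m hm₀ hnm
    rw [hE, hE, div_left_inj' hμ.ne', neg_inj, pow_left_inj₀ (hl0 n).le (hl0 m).le two_ne_zero,
      hlr, hlr, div_left_inj' hr₀.ne'] at hnm
    have h1 := congrArg (macdonaldPhase β) hnm
    rw [macdonaldPhase_scaledRoot hβ.ne', macdonaldPhase_scaledRoot hβ.ne'] at h1
    obtain ⟨a1, a2⟩ := (hn n hn₀).1
    obtain ⟨b1, b2⟩ := (hn m hm₀).1
    have hpi := Real.pi_pos
    have h2 : ((n : ℝ) - m) * Real.pi = η n - η m := by linarith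
    have h3 : ((n : ℝ) - m) < 1 := by
      by_contra hcon
      nlinarith
    have h4 : -1 < ((n : ℝ) - m) := by
      by_contra hcon
      nlinarith
    have h5 : n - m < 1 := by exact_mod_cast h3
    have h6 : -1 < n - m := by exact_mod_cast h4
    omega
  · have h1 := (((hsmall.div_const r₀).pow 2).neg).div_const μ
    simp only [zero_div, ne_eq, OfNat.ofNat_ne_zero, not_false_eq_true, zero_pow, neg_zero] at h1
    refine h1.congr fun n => ?_
    rw [hE, hlr]
  -- The solution with slope `c` is `c` times the one with slope `1`: the angle is unchanged and the
  -- determinant is multiplied by `c`, so the same `η` serves every `c`.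
  · have hreg : ∀ l, IsRegularSolution q l c (fun r => c * w l r) (fun r => c * w' l r) := fun l => by
      simpa using (hw l).const_mul c
    refine ⟨fun l r => c * w l r, fun l _ => (hreg l).isInnerSolution hq hr₀ hqv, fun n hn₀ => ?_⟩
    have hangle : matchAngle (coeffA r₀ fun r => c * w 0 r) (coeffB β r₀ fun r => c * w 0 r) = α :=
      (hw 0).matchAngle_const_mul hr₀ hc
    simp only [hangle]
    have hdet' : matchDet β r₀ (l n) (fun r => c * w (l n) r) = 0 := by
      rw [(hw (l n)).matchDet_const_mul hr₀ (hl0 n), hdet n hn₀, mul_zero]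
    have hglue := gluedFunction_eq hr₀ (hl0 n) hc hq hqo (hreg (l n)) hdet'
    have hρ := innerRatio_ne_zero hr₀ (hl0 n) hc hq (hreg (l n)) hdet'
    have hρ' : (innerRatio β r₀ (l n) (fun r => c * w (l n) r) : ℂ) ≠ 0 := by exact_mod_cast hρ
    refine ⟨⟨(hn n hn₀).1, hdet', fun y hy hy0 => ?_⟩, rfl, fun ζ => ?_, ?_⟩
    · rw [(hw _).matchDet_const_mul hr₀ (hroot0 n y)] at hy0
      exact ((hn n hn₀).2.1 y hy).1 ((mul_eq_zero.1 hy0).resolve_left hc)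
    · rw [hiff n hn₀ c hc ζ]
      constructor
      · rintro ⟨A, hA, h⟩
        refine ⟨A / innerRatio β r₀ (l n) (fun r => c * w (l n) r), div_ne_zero hA hρ',
          fun r hr => ?_⟩
        rw [h r hr, hglue, mul_div_cancel₀ _ hρ']
      · rintro ⟨B, hB, h⟩
        exact ⟨_, mul_ne_zero hρ' hB, fun r hr => (h r hr).trans (hglue B r)⟩
    · obtain ⟨C, hC⟩ := exists_regularSolution_le_exp hr₀ (hl0 n) hc hq hqo (hreg (l n)) hdet'
      have hL : MemLp (fun r => ((c * w (l n) r : ℝ) : ℂ)) 2 (volume.restrict (Ioi 0)) :=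
        memLp_two_of_le_exp (r₀ := r₀) (Complex.continuous_ofReal.comp (hreg (l n)).continuous)
          (half_pos (hl0 n)) fun r hr => by
            rw [Complex.norm_real]
            exact (hC r hr).1
      obtain ⟨B, hB, hB1⟩ := exists_normalisation (hreg (l n)) hc hL hρ
      refine ⟨B, hB, ?_⟩
      change ∫ r in Ioi (0 : ℝ), ‖gluedFunction β r₀ (l n) (fun r => c * w (l n) r) B r‖ ^ 2 = 1
      simp only [hglue]
      exact hB1
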